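/- **Setting.** Work on the triangular lattice, with horizontal lattice lines; $M(R)$ is the number of lozenge tilings of a region $R$, and $H(n)=0!\,1!\cdots(n-1)!$. Let $a,b,c,k,l\ge 0$ be integers and consider the hexagon with side lengths $a,\,b+k,\,c,\,a+k,\,b,\,c+k$, clockwise from the top. Its $l$-th horizontal line above the bottom side has length $L(l)=a+k-l+\min(b,l)+\min(c,l)$; its unit segments are labeled $1,\dots,L(l)$ from left to right. For a lattice point $E$ let $d_{SW}(E),d_{NW}(E),d_{NE}(E),d_{SE}(E)$ be the length of a shortest lattice path from $E$ to the line extending the southwestern, northwestern, northeastern, southeastern side of the hexagon. For a finite set $S$ of integers let $s(S)=M(T(S))$, where $T(S)$ is the trapezoid with bottom side of length $\max S-\min S+1$, with unit segments labeled $\min S,\dots,\max S$, and slanted sides of length $|S|$, from which the up-pointing unit triangles standing on the bottom segments with labels in $S$ are removed ($s(\emptyset)=1$). **Budded ferns.** Let $A=(a_1,\dots,a_r)$ be integers and $W=(w_1,\dots,w_{r-1})$ nonnegative integers, $r\ge1$. They encode the following objects along a horizontal baseline, from left to right: $|a_1|$ consecutive unit triangles (up-pointing and above the baseline if $a_1>0$,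 down-pointing and below it if $a_1<0$), $w_1$ consecutive vertical unit lozenges bisected by the baseline, $|a_2|$ unit triangles, $w_2$ lozenges, and so on. A *budded fern* $F(A:W)$ is a union of lattice triangles having a side on the baseline, the up-pointing ones with non-overlapping bases and the down-pointing ones with non-overlapping bases, whose unit triangles with a side on the baseline form exactly this pattern. Let $L_j,R_j$ be the left and right ends of the $j$-th block of $|a_j|$ triangles, $I=\{j:a_j>0\}$, $J=\{j:a_j<0\}$, $p(A)=\sum_{j\in I}a_j$, $n(A)=-\sum_{j\in J}a_j$, and let $u$ be the smallest positive integer with $p(A)\le|a_1|+\dots+|a_u|$. The corresponding *budded bowtie* $B(A:W)$ is obtained from the baseline pattern by keeping the vertical lozenges fixed, moving the other up-pointing unit triangles to the left and the other down-pointing ones to the right on the remaining segments, and then filling up consecutive unit triangles of the same orientation (halves of lozenges included) as much as possible, i.e. taking all lattice triangles of that orientation whose base consists of segments carrying a unit triangle of that orientation. The *turning point* $T$ is the right end of the rightmost up-pointing unit triangle on the baseline of the bowtie that is not half of a lozenge; if $p(A)=0$, put $T=L_1$. **Theorem.** Let $t\ge0$, let $F(A_i:W_i)$, $1\le i\le t$,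 be budded ferns, with $r_i,I_i,J_i,u_i,L^i_j,R^i_j,T^i$ as above, and let $m_1,\dots,m_{t+1}\ge0$ be integers. Let $p=\sum_i p(A_i)$, $n=\sum_i n(A_i)$, $w=\sum_i\sum_j w^i_j$, $m=\sum_i m_i$, and suppose $$p=n+k,\qquad p+n+w+m=L(l),\qquad n+w\le\min(b,\,l,\,b+c-l).$$ Let $\mathcal F$ be the hexagon from which the ferns $F(A_1:W_1),\dots,F(A_t:W_t)$, placed from left to right on the $l$-th line, are removed, where $m_1$ is the distance from the left end of the line to the first fern, $m_{i+1}$ the distance between the $i$-th and $(i+1)$-st fern, and $m_{t+1}$ the distance from the last fern to the right end of the line. Let $\mathcal B$ be the hexagon with the budded bowties $B(A_i:W_i)$ removed instead, at the same positions on the line. Let $X^1$ (resp. $X^2$) be the set of labels of the segments on the line bounding an up-pointing (resp. down-pointing) unit triangle, not half of a lozenge, of the baseline patterns of the ferns, and define $Y^1,Y^2$ in the same way from the bowties. For points $P,Q$ on the line put $$D(P,Q)=\frac{H(d_{SW}(Q))\,H(d_{NW}(P))\,H(d_{SE}(P))\,H(d_{NE}(Q))}{H(d_{SW}(P))\,H(d_{NW}(Q))\,H(d_{SE}(Q))\,H(d_{NE}(P))}.$$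 If $n\le a$ and $n+w\le c$ (the latter is automatic if $b\le c$), then $M(\mathcal F)$ and $M(\mathcal B)$ are positive and $$\frac{M(\mathcal F)}{M(\mathcal B)}=\frac{s(X^1)\,s(X^2)}{s(Y^1)\,s(Y^2)}\prod_{i=1}^{t}\Bigg[D(L^i_{u_i},T^i)\prod_{j<u_i,\ j\in J_i}D(L^i_j,R^i_j)\prod_{j\ge u_i,\ j\in I_i}D(R^i_j,L^i_j)\Bigg].$$ Otherwise $M(\mathcal F)=M(\mathcal B)=0$. -/

import Mathlib

/-! Lozenge tilings of hexagons on the triangular lattice with collinear holes.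

The triangular lattice is identified with `ℤ × ℤ`: the point `(x, y)` stands for
`x • e₁ + y • e₂`, where `e₁` is the unit step to the right and `e₂` the unit step to the upper
right (at 60 degrees). The second coordinate is the height of the horizontal lattice line through
the point. -/

namespace FernTiling

/-- Unit triangles. `up x y` is the up-pointing one whose bottom side is the segment from `(x, y)`
to `(x + 1, y)`; `down x y` is the down-pointing one whose top side is that segment. -/
inductive Tri where
  | up (x y : ℤ) : Tri
  | down (x y : ℤ) : Tri

/-- The three corners of a unit triangle. -/
def Tri.verts : Tri → Set (ℤ × ℤ)
  | .up x y => {(x, y), (x + 1, y), (x, y + 1)}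
  | .down x y => {(x, y), (x + 1, y), (x + 1, y - 1)}

/-- The unit triangles whose corners lie in `P` (used for lattice-convex sets `P` only). -/
def regionOf (P : Set (ℤ × ℤ)) : Set Tri := {τ | τ.verts ⊆ P}

/-- A lozenge: the union of two unit triangles with a common side. The three cases are the
vertical lozenge (common horizontal side) and the two others. -/
def IsLozenge (s : Set Tri) : Prop :=
  ∃ x y : ℤ, s = {Tri.up x y, Tri.down x y} ∨ s = {Tri.up x y, Tri.down x (y + 1)} ∨
    s = {Tri.up x y, Tri.down (x - 1) (y + 1)}

/-- A lozenge tiling of `R`: a set of pairwise disjoint lozenges with union `R`. -/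
def IsTiling (R : Set Tri) (T : Set (Set Tri)) : Prop :=
  (∀ s ∈ T, IsLozenge s) ∧ T.PairwiseDisjoint id ∧ ⋃₀ T = R

/-- `M(R)`, the number of lozenge tilings of (the bounded region) `R`. -/
noncomputable def tilingCount (R : Set Tri) : ℕ := {T : Set (Set Tri) | IsTiling R T}.ncard

/-- The up-pointing lattice triangle of side `s` with lower left corner `(x, y)`. -/
def upTriangle (x y : ℤ) (s : ℕ) : Set Tri :=
  regionOf {P | x ≤ P.1 ∧ y ≤ P.2 ∧ P.1 + P.2 ≤ x + y + s}

/-- The down-pointing lattice triangle of side `s` with upper left corner `(x, y)`. -/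
def downTriangle (x y : ℤ) (s : ℕ) : Set Tri :=
  regionOf {P | P.1 ≤ x + s ∧ P.2 ≤ y ∧ x + y ≤ P.1 + P.2}

/-- The hyperfactorial `H(n) = 0! 1! ⋯ (n-1)!`. -/
def hyperfac (n : ℕ) : ℕ := ∏ i ∈ Finset.range n, i.factorial

/-- The region `T(S)`: the trapezoid of height `|S|` (slanted sides of length `|S|`) standing on
the segment from `min S - 1` to `max S` of the line at height `0`, from which the up-pointing unit
triangles on the bottom unit segments with labels in `S` are removed; the segment from `i - 1` to
`i` has label `i`. It is empty if `S` is. -/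
def dentedTrapezoid (S : Finset ℤ) : Set Tri :=
  regionOf {P | 0 ≤ P.2 ∧ P.2 ≤ S.card ∧ (∃ s ∈ S, s - 1 ≤ P.1) ∧ ∃ s ∈ S, P.1 + P.2 ≤ s} \
    {τ | ∃ s ∈ S, τ = Tri.up (s - 1) 0}

/-- `s(S) = M(T(S))`. -/
noncomputable def sCount (S : Finset ℤ) : ℕ := tilingCount (dentedTrapezoid S)

/-! ### The hexagon -/

/-- The hexagon with sides `a, b + k, c, a + k, b, c + k` clockwise from the top, placed so that its
bottom side runs from `(0, 0)` to `(a + k, 0)`. -/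
def hexagon (a b c k : ℕ) : Set Tri :=
  regionOf {P | 0 ≤ P.2 ∧ P.2 ≤ b + c + k ∧ -(b : ℤ) ≤ P.1 ∧ P.1 ≤ a + k ∧
    0 ≤ P.1 + P.2 ∧ P.1 + P.2 ≤ a + c + k}

/-- The length `L(l)` of the `l`-th horizontal line of the hexagon, counted from the bottom side. -/
def lineLength (a b c k l : ℕ) : ℤ := (a : ℤ) + k - l + min (b : ℤ) l + min (c : ℤ) l

/-- The first coordinate of the leftmost point of the `l`-th horizontal line of the hexagon. -/
def lineLeft (b l : ℕ) : ℤ := -min (b : ℤ) l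

/-- The triangular lattice as a graph. -/
def latticeGraph : SimpleGraph (ℤ × ℤ) :=
  SimpleGraph.fromRel fun P Q => Q = P + (1, 0) ∨ Q = P + (0, 1) ∨ Q = P + (-1, 1)

/-- The length of a shortest lattice path from the point `E` to the lattice line `ℓ`. -/
noncomputable def lineDist (E : ℤ × ℤ) (ℓ : Set (ℤ × ℤ)) : ℕ :=
  sInf {d | ∃ P ∈ ℓ, ∃ q : latticeGraph.Walk E P, q.length = d}

/-- Distance to the line that extends the southwestern side of the hexagon. -/
noncomputable def dSW (E : ℤ × ℤ) : ℕ := lineDist E {P | P.1 + P.2 = 0}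

/-- Distance to the line that extends the northwestern side of the hexagon. -/
noncomputable def dNW (b : ℕ) (E : ℤ × ℤ) : ℕ := lineDist E {P | P.1 = -(b : ℤ)}

/-- Distance to the line that extends the northeastern side of the hexagon. -/
noncomputable def dNE (a c k : ℕ) (E : ℤ × ℤ) : ℕ := lineDist E {P | P.1 + P.2 = a + c + k}

/-- Distance to the line that extends the southeastern side of the hexagon. -/
noncomputable def dSE (a k : ℕ) (E : ℤ × ℤ) : ℕ := lineDist E {P | P.1 = a + k}

/-- The quotient
`H(d_SW B) H(d_NW A) H(d_SE A) H(d_NE B) / (H(d_SW A) H(d_NW B) H(d_SE B) H(d_NE A))`. -/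
noncomputable def distQuot (a b c k : ℕ) (A B : ℤ × ℤ) : ℚ :=
  ((hyperfac (dSW B) : ℚ) * hyperfac (dNW b A) * hyperfac (dSE a k A) * hyperfac (dNE a c k B)) /
    ((hyperfac (dSW A) : ℚ) * hyperfac (dNW b B) * hyperfac (dSE a k B) * hyperfac (dNE a c k A))

/-! ### Budded ferns and budded bowties -/

/-- The sequences `A = (a₁, …, a_{r+1})` and `W = (w₁, …, w_r)`, with indices starting at `0` here.
They encode, from left to right along the baseline: `|a₁|` unit triangles (up-pointing if `a₁ > 0`,
down-pointing if `a₁ < 0`), `w₁` vertical unit lozenges bisected by the baseline, `|a₂|` unit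
triangles, `w₂` vertical unit lozenges, and so on. Normal forms (such as `aⱼ ≠ 0` in the interior)
are not required. -/
structure Code where
  r : ℕ
  a : Fin (r + 1) → ℤ
  w : Fin r → ℕ

namespace Code

/-- Distance from the left end of the structure to the left end `L_j` of the `j`-th block of unit
triangles. -/
def left (C : Code) (j : Fin (C.r + 1)) : ℕ :=
  ∑ i : Fin C.r with i.castSucc < j, ((C.a i.castSucc).natAbs + C.w i)

/-- Distance from the left end of the structure to the right end `R_j` of the `j`-th block of unit
triangles. -/
def right (C : Code) (j : Fin (C.r + 1)) : ℕ := C.left j + (C.a j).natAbs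

/-- Number of up-pointing unit triangles of the code. -/
def p (C : Code) : ℕ := ∑ j with 0 < C.a j, (C.a j).natAbs

/-- Number of down-pointing unit triangles of the code. -/
def n (C : Code) : ℕ := ∑ j with C.a j < 0, (C.a j).natAbs

/-- Number of vertical lozenges of the code. -/
def wSum (C : Code) : ℕ := ∑ i, C.w i

/-- The length of the part of the baseline that the structure occupies. -/
def len (C : Code) : ℕ := ∑ j, (C.a j).natAbs + ∑ i, C.w i

/-- Unit segments (`s` stands for the one from `s` to `s + 1`, measured from the left end) of the
up-pointing blocks. -/
def upSeg (C : Code) : Finset ℕ :=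
  (Finset.univ.filter fun j => 0 < C.a j).biUnion fun j => Finset.Ico (C.left j) (C.right j)

/-- Unit segments of the down-pointing blocks. -/
def downSeg (C : Code) : Finset ℕ :=
  (Finset.univ.filter fun j => C.a j < 0).biUnion fun j => Finset.Ico (C.left j) (C.right j)

/-- Unit segments that bisect the vertical lozenges. -/
def lozSeg (C : Code) : Finset ℕ :=
  Finset.univ.biUnion fun i : Fin C.r =>
    Finset.Ico (C.right i.castSucc) (C.right i.castSucc + C.w i)

/-- The up-pointing segments of the bowtie: the vertical lozenges stay where they are, and on the
remaining segments all `p` up-pointing unit triangles are moved to the left. -/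
def bowUpSeg (C : Code) : Finset ℕ :=
  (C.upSeg ∪ C.downSeg).filter fun s => ((C.upSeg ∪ C.downSeg).filter (· < s)).card < C.p

/-- The down-pointing segments of the bowtie. -/
def bowDownSeg (C : Code) : Finset ℕ := (C.upSeg ∪ C.downSeg) \ C.bowUpSeg

/-- The turning point `T`, as a distance from the left end: the right end of the rightmost
up-pointing segment of the bowtie. It is the left end of the structure if there are none. -/
def turn (C : Code) : ℕ := C.bowUpSeg.sup (· + 1)

/-- `u`: the first index with `p ≤ |a₁| + ⋯ + |a_u|`. -/
def u (C : Code) : Fin (C.r + 1) :=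
  (Finset.univ.filter fun j => C.p ≤ ∑ i with i ≤ j, (C.a i).natAbs).min' (by
    refine ⟨Fin.last C.r, ?_⟩
    simp only [Finset.mem_filter, Finset.mem_univ, true_and, Fin.le_last, Finset.filter_true]
    exact Finset.sum_le_sum_of_subset (Finset.subset_univ _))

end Code

/-- A budded fern `F(A : W)`: collinear lattice triangles (lobes and buds) with a side on the
baseline, up-pointing ones with non-overlapping bases and down-pointing ones with non-overlapping
bases, whose baseline representation is the one encoded by `(A, W)`. A triangle is given by the
pair of the position of its left corner on the baseline (measured from the left end of the fern)
and its side length. -/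
structure BuddedFern extends Code where
  ups : Finset (ℕ × ℕ)
  downs : Finset (ℕ × ℕ)
  ups_disjoint : (ups : Set (ℕ × ℕ)).PairwiseDisjoint fun q => Finset.Ico q.1 (q.1 + q.2)
  downs_disjoint : (downs : Set (ℕ × ℕ)).PairwiseDisjoint fun q => Finset.Ico q.1 (q.1 + q.2)
  ups_cover : (ups.biUnion fun q => Finset.Ico q.1 (q.1 + q.2)) = toCode.upSeg ∪ toCode.lozSeg
  downs_cover :
    (downs.biUnion fun q => Finset.Ico q.1 (q.1 + q.2)) = toCode.downSeg ∪ toCode.lozSeg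

/-- The region covered by the budded fern whose leftmost baseline point is `(x, y)`. -/
def BuddedFern.hole (F : BuddedFern) (x y : ℤ) : Set Tri :=
  (⋃ q ∈ F.ups, upTriangle (x + q.1) y q.2) ∪ ⋃ q ∈ F.downs, downTriangle (x + q.1) y q.2

/-- The region covered by the budded bowtie `B(A : W)` whose leftmost baseline point is `(x, y)`.
Consecutive unit triangles of the same orientation on the baseline, including the halves of the
vertical lozenges, are filled up as much as possible: the result consists of all lattice triangles
whose base consists of segments carrying a unit triangle of that orientation. -/
def Code.bowtieHole (C : Code) (x y : ℤ) : Set Tri :=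
  {τ | ∃ z s : ℕ, Finset.Ico z (z + s) ⊆ C.bowUpSeg ∪ C.lozSeg ∧ τ ∈ upTriangle (x + z) y s} ∪
  {τ | ∃ z s : ℕ, Finset.Ico z (z + s) ⊆ C.bowDownSeg ∪ C.lozSeg ∧ τ ∈ downTriangle (x + z) y s}

/-! ### Hexagons with budded ferns or budded bowties removed -/

section Region

variable {t : ℕ}

/-- Distance from the left end of the line to the left end of the `i`-th structure, if the
successive gaps on the line are `m 0, m 1, …, m t`. -/
def offset (F : Fin t → BuddedFern) (m : Fin (t + 1) → ℕ) (i : Fin t) : ℕ :=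
  ∑ j with j ≤ i.castSucc, m j + ∑ j with j < i, (F j).len

/-- The hexagon with the budded ferns removed along the `l`-th horizontal line. -/
def fernRegion (a b c k l : ℕ) (F : Fin t → BuddedFern) (m : Fin (t + 1) → ℕ) : Set Tri :=
  hexagon a b c k \ ⋃ i, (F i).hole (lineLeft b l + offset F m i) l

/-- The hexagon with the corresponding budded bowties removed, at the same positions. -/
def bowtieRegion (a b c k l : ℕ) (F : Fin t → BuddedFern) (m : Fin (t + 1) → ℕ) : Set Tri :=
  hexagon a b c k \ ⋃ i, (F i).bowtieHole (lineLeft b l + offset F m i) l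

/-- The labels on the line (`1, 2, …` from left to right) of the segments that the `S i` select in
the `i`-th structure. -/
def labels (F : Fin t → BuddedFern) (m : Fin (t + 1) → ℕ) (S : Fin t → Finset ℕ) : Finset ℤ :=
  Finset.univ.biUnion fun i => (S i).image fun s => ((offset F m i + s + 1 : ℕ) : ℤ)

/-- `X¹`: labels of segments that bound only an up-pointing hole of the ferns' baseline
representations. -/
def labelsX1 (F : Fin t → BuddedFern) (m : Fin (t + 1) → ℕ) : Finset ℤ :=
  labels F m fun i => (F i).upSeg

/-- `X²`: labels of segments that bound only a down-pointing hole of the ferns' baseline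
representations. -/
def labelsX2 (F : Fin t → BuddedFern) (m : Fin (t + 1) → ℕ) : Finset ℤ :=
  labels F m fun i => (F i).downSeg

/-- `Y¹`: labels of segments that bound only an up-pointing hole of the bowties' baseline
representations. -/
def labelsY1 (F : Fin t → BuddedFern) (m : Fin (t + 1) → ℕ) : Finset ℤ :=
  labels F m fun i => (F i).bowUpSeg

/-- `Y²`: labels of segments that bound only a down-pointing hole of the bowties' baseline
representations. -/
def labelsY2 (F : Fin t → BuddedFern) (m : Fin (t + 1) → ℕ) : Finset ℤ :=
  labels F m fun i => (F i).bowDownSeg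

/-- The lattice point on the `l`-th line at distance `s` from the left end of the `i`-th
structure. -/
def point (b l : ℕ) (F : Fin t → BuddedFern) (m : Fin (t + 1) → ℕ) (i : Fin t) (s : ℕ) : ℤ × ℤ :=
  (lineLeft b l + offset F m i + s, l)

/-- The vertex `L_j` of the `i`-th fern. -/
def ptL (b l : ℕ) (F : Fin t → BuddedFern) (m : Fin (t + 1) → ℕ) (i : Fin t)
    (j : Fin ((F i).r + 1)) : ℤ × ℤ :=
  point b l F m i ((F i).left j)

/-- The vertex `R_j` of the `i`-th fern. -/
def ptR (b l : ℕ) (F : Fin t → BuddedFern) (m : Fin (t + 1) → ℕ) (i : Fin t)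
    (j : Fin ((F i).r + 1)) : ℤ × ℤ :=
  point b l F m i ((F i).right j)

/-- The turning point of the `i`-th bowtie. -/
def ptT (b l : ℕ) (F : Fin t → BuddedFern) (m : Fin (t + 1) → ℕ) (i : Fin t) : ℤ × ℤ :=
  point b l F m i (F i).turn

end Region

end FernTiling

open FernTiling

/-! Cut the hexagon along the `l`-th line. A tiling is determined by the set `Z` of free segments of the
line that are crossed by vertical lozenges and by tilings of the two halves. Each half, extended by
one lattice triangle at either end of the line, is a trapezoid whose long side lies on the line, and
removing a lattice triangle standing on that side is the same as removing the unit triangles along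
its base, because the rest of it is tiled by forced vertical lozenges
(`tilingCount_diff_triangles`). The number of tilings of a trapezoid of height `h` with `h` unit
dents at the positions `S` is the Vandermonde product of `S` divided by `H(h)`
(`tilingCount_trap`): cutting off the lowest strip replaces `S` by an interlacing set, and the sum
of the Vandermonde products over all interlacing sets telescopes (`sum_vandermonde_interlacing`).

Therefore the number of tilings of a hexagon with holes is a sum over `Z` of products of two
Vandermonde products (`tilingCount_hexagon_diff`). The fern and the bowtie have triangular holes on
the same segments of the line and differ only in which of them point up. In every summand the
factors that involve `Z` are the same for both (`vdm_mul_vdm`), so that the quotient of the two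
tiling counts is a quotient of Vandermonde products of the hole positions, which gives
the `s(X)`, times a product over the up-pointing holes of quotients of distances to the two
extensions of the line. The latter are quotients of factorials of distances to the sides of
the hexagon, and over a block of consecutive segments they multiply to quotients of hyperfactorials
(`prod_Ico_segWeight`). The common sum is positive iff some `Z` has the size
that both halves require, which is the condition `n ≤ a ∧ n + w ≤ c`. -/

namespace FernTiling

/-! ### Tilings of general regions -/

theorem IsLozenge.nonempty {s : Set Tri} (hs : IsLozenge s) : s.Nonempty := by
  obtain ⟨x, y, h | h | h⟩ := hs <;> exact ⟨_, h ▸ Set.mem_insert _ _⟩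

theorem isLozenge_vertical (x y : ℤ) : IsLozenge {Tri.up x y, Tri.down x y} :=
  ⟨x, y, Or.inl rfl⟩

theorem IsTiling.subset {R : Set Tri} {T : Set (Set Tri)} (hT : IsTiling R T) {s : Set Tri}
    (hs : s ∈ T) : s ⊆ R := hT.2.2 ▸ Set.subset_sUnion_of_mem hs

theorem IsTiling.eq_of_mem {R : Set Tri} {T : Set (Set Tri)} (hT : IsTiling R T) {s s' : Set Tri}
    (hs : s ∈ T) (hs' : s' ∈ T) {τ : Tri} (h : τ ∈ s) (h' : τ ∈ s') : s = s' :=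
  hT.2.1.elim hs hs' (Set.not_disjoint_iff.2 ⟨τ, h, h'⟩)

theorem IsTiling.exists_mem {R : Set Tri} {T : Set (Set Tri)} (hT : IsTiling R T) {τ : Tri}
    (h : τ ∈ R) : ∃ s ∈ T, τ ∈ s := by
  rw [← hT.2.2] at h
  exact h

theorem finite_isTiling {R : Set Tri} (hR : R.Finite) :
    {T : Set (Set Tri) | IsTiling R T}.Finite :=
  hR.powerset.powerset.subset fun _ hT _ hs => hT.subset hs

theorem tilingCount_empty : tilingCount ∅ = 1 := by
  rw [tilingCount, Set.ncard_eq_one]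
  refine ⟨∅, Set.ext fun T => ⟨fun hT => ?_, ?_⟩⟩
  · refine Set.eq_empty_of_forall_notMem fun s hs => ?_
    exact (hT.1 s hs).nonempty.ne_empty (Set.subset_empty_iff.1 (hT.subset hs))
  · rintro rfl
    simp [IsTiling]

/-- Lozenges that belong to every tiling may be cut out of the region. -/
theorem tilingCount_diff_forced {R : Set Tri} {V : Set (Set Tri)} (hV : ∀ s ∈ V, IsLozenge s)
    (hdisj : V.PairwiseDisjoint id) (hsub : ⋃₀ V ⊆ R) (hforced : ∀ T, IsTiling R T → V ⊆ T) :
    tilingCount (R \ ⋃₀ V) = tilingCount R := by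
  have hVT : ∀ T, IsTiling (R \ ⋃₀ V) T → Disjoint T V := by
    intro T hT
    rw [Set.disjoint_left]
    intro s hs hs'
    obtain ⟨τ, hτ⟩ := (hV s hs').nonempty
    exact (hT.subset hs hτ).2 ⟨s, hs', hτ⟩
  have himage : {T | IsTiling R T} = (fun T => T ∪ V) '' {T | IsTiling (R \ ⋃₀ V) T} := by
    ext T
    constructor
    · intro hT
      refine ⟨T \ V, ⟨fun s hs => hT.1 s hs.1, hT.2.1.subset Set.sdiff_subset, ?_⟩,
        Set.sdiff_union_of_subset (hforced T hT)⟩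
      ext τ
      constructor
      · rintro ⟨s, hs, hτ⟩
        refine ⟨hT.subset hs.1 hτ, ?_⟩
        rintro ⟨s', hs', hτ'⟩
        exact hs.2 (hT.eq_of_mem hs.1 (hforced T hT hs') hτ hτ' ▸ hs')
      · rintro ⟨hτ, hτ'⟩
        obtain ⟨s, hs, hτs⟩ := hT.exists_mem hτ
        exact ⟨s, ⟨hs, fun h => hτ' ⟨s, h, hτs⟩⟩, hτs⟩
    · rintro ⟨T', hT', rfl⟩
      have hT'' : IsTiling (R \ ⋃₀ V) T' := hT'
      refine ⟨?_, ?_, ?_⟩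
      · rintro s (hs | hs)
        exacts [hT''.1 s hs, hV s hs]
      · rw [Set.pairwiseDisjoint_union]
        refine ⟨hT''.2.1, hdisj, fun s hs s' hs' _ => Set.disjoint_left.2 fun τ h h' => ?_⟩
        exact (hT''.subset hs h).2 ⟨s', hs', h'⟩
      · rw [Set.sUnion_union, hT''.2.2, Set.sdiff_union_of_subset hsub]
  rw [tilingCount, tilingCount, himage, Set.InjOn.ncard_image]
  intro T₁ h₁ T₂ h₂ h
  have := congrArg (· \ V) h
  simpa [Set.union_sdiff_right, (hVT T₁ h₁).sdiff_eq_left, (hVT T₂ h₂).sdiff_eq_left] using this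

/-- Tilings of a region that is cut in two along the line at height `l`, classified by the set of
vertical lozenges that cross the line. -/
theorem tilingCount_union {R₁ R₂ : Set Tri} (hfin₁ : R₁.Finite) (hfin₂ : R₂.Finite)
    (hdisj : Disjoint R₁ R₂) (l : ℤ) (X : Finset ℤ)
    (hX : ∀ x ∈ X, Tri.up x l ∈ R₁ ∧ Tri.down x l ∈ R₂)
    (hcross : ∀ s, IsLozenge s → s ⊆ R₁ ∪ R₂ →
      s ⊆ R₁ ∨ s ⊆ R₂ ∨ ∃ x ∈ X, s = {Tri.up x l, Tri.down x l}) :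
    tilingCount (R₁ ∪ R₂) = ∑ Z ∈ X.powerset,
      tilingCount (R₁ \ {τ | ∃ x ∈ Z, τ = Tri.up x l}) *
        tilingCount (R₂ \ {τ | ∃ x ∈ Z, τ = Tri.down x l}) := by
  classical
  set V : ℤ → Set Tri := fun x => {Tri.up x l, Tri.down x l} with hVdef
  have hVinj : ∀ x y, V x = V y → x = y := by
    intro x y h
    have : Tri.up x l ∈ V y := h ▸ Set.mem_insert _ _
    simpa [hVdef] using this
  set f : Set (Set Tri) → Finset ℤ := fun T => X.filter fun x => V x ∈ T with hf
  have hfin := finite_isTiling (hfin₁.union hfin₂)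
  have hn₁ : ∀ x ∈ X, Tri.down x l ∉ R₁ := fun x hx h =>
    Set.disjoint_left.1 hdisj h (hX x hx).2
  have hn₂ : ∀ x ∈ X, Tri.up x l ∉ R₂ := fun x hx h =>
    Set.disjoint_left.1 hdisj (hX x hx).1 h
  rw [tilingCount, Set.ncard_eq_toFinset_card _ hfin,
    Finset.card_eq_sum_card_fiberwise (f := f) (t := X.powerset)
      (fun T _ => Finset.mem_coe.2 (Finset.mem_powerset.2 (Finset.filter_subset _ _)))]
  refine Finset.sum_congr rfl fun Z hZ => ?_
  rw [Finset.mem_powerset] at hZ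
  set A := R₁ \ {τ | ∃ x ∈ Z, τ = Tri.up x l} with hA
  set B := R₂ \ {τ | ∃ x ∈ Z, τ = Tri.down x l} with hB
  have hAB : Disjoint A B := hdisj.mono Set.sdiff_subset Set.sdiff_subset
  have hVA : ∀ x ∈ Z, Disjoint A (V x) := by
    intro x hx
    rw [Set.disjoint_left]
    rintro τ hτ (rfl | rfl)
    exacts [hτ.2 ⟨x, hx, rfl⟩, hn₁ x (hZ hx) hτ.1]
  have hVB : ∀ x ∈ Z, Disjoint B (V x) := by
    intro x hx
    rw [Set.disjoint_left]
    rintro τ hτ (rfl | rfl)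
    exacts [hn₂ x (hZ hx) hτ.1, hτ.2 ⟨x, hx, rfl⟩]
  set g : Set (Set Tri) × Set (Set Tri) → Set (Set Tri) :=
    fun q => q.1 ∪ q.2 ∪ V '' (Z : Set ℤ) with hg
  -- The parts of a glued tiling can be recovered from it.
  have hrec₁ : ∀ T₁ T₂, IsTiling A T₁ → IsTiling B T₂ → {s ∈ g (T₁, T₂) | s ⊆ R₁} = T₁ := by
    intro T₁ T₂ h₁ h₂
    ext s
    constructor
    · rintro ⟨(hs | hs) | ⟨x, hx, rfl⟩, hs'⟩
      · exact hs
      · obtain ⟨τ, hτ⟩ := (h₂.1 s hs).nonempty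
        exact absurd (h₂.subset hs hτ).1 (Set.disjoint_left.1 hdisj (hs' hτ))
      · exact absurd (hs' (Set.mem_insert_of_mem _ rfl)) (hn₁ x (hZ hx))
    · exact fun hs => ⟨Or.inl (Or.inl hs), (h₁.subset hs).trans Set.sdiff_subset⟩
  have hrec₂ : ∀ T₁ T₂, IsTiling A T₁ → IsTiling B T₂ → {s ∈ g (T₁, T₂) | s ⊆ R₂} = T₂ := by
    intro T₁ T₂ h₁ h₂
    ext s
    constructor
    · rintro ⟨(hs | hs) | ⟨x, hx, rfl⟩, hs'⟩
      · obtain ⟨τ, hτ⟩ := (h₁.1 s hs).nonempty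
        exact absurd (hs' hτ) (Set.disjoint_left.1 hdisj (h₁.subset hs hτ).1)
      · exact hs
      · exact absurd (hs' (Set.mem_insert _ _)) (hn₂ x (hZ hx))
    · exact fun hs => ⟨Or.inl (Or.inr hs), (h₂.subset hs).trans Set.sdiff_subset⟩
  have himage : (↑({T ∈ hfin.toFinset | f T = Z}) : Set (Set (Set Tri))) =
      g '' ({T | IsTiling A T} ×ˢ {T | IsTiling B T}) := by
    ext T
    simp only [Finset.coe_filter, Set.Finite.mem_toFinset, Set.mem_ofPred_eq]
    constructor
    · rintro ⟨hT, rfl⟩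
      have hmem : ∀ x, x ∈ f T ↔ x ∈ X ∧ V x ∈ T := fun x => by simp [hf]
      refine ⟨({s ∈ T | s ⊆ R₁}, {s ∈ T | s ⊆ R₂}), ⟨⟨fun s hs => hT.1 s hs.1,
        hT.2.1.subset (Set.sep_subset _ _), ?_⟩, ⟨fun s hs => hT.1 s hs.1,
        hT.2.1.subset (Set.sep_subset _ _), ?_⟩⟩, ?_⟩
      · ext τ
        constructor
        · rintro ⟨s, ⟨hs, hs'⟩, hτ⟩
          refine ⟨hs' hτ, ?_⟩
          rintro ⟨x, hx, rfl⟩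
          have hx' := (hmem x).1 hx
          have := hT.eq_of_mem hs hx'.2 hτ (Set.mem_insert _ _)
          exact hn₁ x hx'.1 (hs' (this ▸ Set.mem_insert_of_mem _ rfl))
        · rintro ⟨hτ, hτ'⟩
          obtain ⟨s, hs, hτs⟩ := hT.exists_mem (Or.inl hτ)
          rcases hcross s (hT.1 s hs) (hT.subset hs) with h | h | ⟨x, hx, rfl⟩
          · exact ⟨s, ⟨hs, h⟩, hτs⟩
          · exact absurd (h hτs) (Set.disjoint_left.1 hdisj hτ)
          · rcases hτs with rfl | rfl
            · exact absurd ⟨x, (hmem x).2 ⟨hx, hs⟩, rfl⟩ hτ'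
            · exact absurd hτ (hn₁ x hx)
      · ext τ
        constructor
        · rintro ⟨s, ⟨hs, hs'⟩, hτ⟩
          refine ⟨hs' hτ, ?_⟩
          rintro ⟨x, hx, rfl⟩
          have hx' := (hmem x).1 hx
          have := hT.eq_of_mem hs hx'.2 hτ (Set.mem_insert_of_mem _ rfl)
          exact hn₂ x hx'.1 (hs' (this ▸ Set.mem_insert _ _))
        · rintro ⟨hτ, hτ'⟩
          obtain ⟨s, hs, hτs⟩ := hT.exists_mem (Or.inr hτ)
          rcases hcross s (hT.1 s hs) (hT.subset hs) with h | h | ⟨x, hx, rfl⟩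
          · exact absurd hτ (Set.disjoint_left.1 hdisj (h hτs))
          · exact ⟨s, ⟨hs, h⟩, hτs⟩
          · rcases hτs with rfl | rfl
            · exact absurd hτ (hn₂ x hx)
            · exact absurd ⟨x, (hmem x).2 ⟨hx, hs⟩, rfl⟩ hτ'
      · ext s
        constructor
        · rintro ((hs | hs) | ⟨x, hx, rfl⟩)
          exacts [hs.1, hs.1, ((hmem x).1 hx).2]
        · intro hs
          rcases hcross s (hT.1 s hs) (hT.subset hs) with h | h | ⟨x, hx, rfl⟩
          · exact Or.inl (Or.inl ⟨hs, h⟩)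
          · exact Or.inl (Or.inr ⟨hs, h⟩)
          · exact Or.inr ⟨x, (hmem x).2 ⟨hx, hs⟩, rfl⟩
    · rintro ⟨⟨T₁, T₂⟩, ⟨h₁, h₂⟩, rfl⟩
      have h₁ : IsTiling A T₁ := h₁
      have h₂ : IsTiling B T₂ := h₂
      refine ⟨⟨?_, ?_, ?_⟩, ?_⟩
      · rintro s ((hs | hs) | ⟨x, hx, rfl⟩)
        exacts [h₁.1 s hs, h₂.1 s hs, isLozenge_vertical x l]
      · rw [hg, Set.pairwiseDisjoint_union, Set.pairwiseDisjoint_union]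
        refine ⟨⟨h₁.2.1, h₂.2.1, fun s hs s' hs' _ => hAB.mono (h₁.subset hs) (h₂.subset hs')⟩,
          ?_, ?_⟩
        · rintro _ ⟨x, hx, rfl⟩ _ ⟨y, hy, rfl⟩ hxy
          refine Set.disjoint_left.2 fun τ h h' => hxy ?_
          rcases h with rfl | rfl <;> rcases h' with h' | h' <;> simp_all
        · rintro s (hs | hs) _ ⟨x, hx, rfl⟩ _
          exacts [(hVA x hx).mono_left (h₁.subset hs), (hVB x hx).mono_left (h₂.subset hs)]
      · rw [hg, Set.sUnion_union, Set.sUnion_union, h₁.2.2, h₂.2.2]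
        ext τ
        constructor
        · rintro ((h | h) | ⟨_, ⟨x, hx, rfl⟩, rfl | rfl⟩)
          exacts [Or.inl h.1, Or.inr h.1, Or.inl (hX x (hZ hx)).1, Or.inr (hX x (hZ hx)).2]
        · rintro (h | h)
          · by_cases h' : ∃ x ∈ Z, τ = Tri.up x l
            · obtain ⟨x, hx, rfl⟩ := h'
              exact Or.inr ⟨V x, ⟨x, hx, rfl⟩, Set.mem_insert _ _⟩
            · exact Or.inl (Or.inl ⟨h, h'⟩)
          · by_cases h' : ∃ x ∈ Z, τ = Tri.down x l
            · obtain ⟨x, hx, rfl⟩ := h'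
              exact Or.inr ⟨V x, ⟨x, hx, rfl⟩, Set.mem_insert_of_mem _ rfl⟩
            · exact Or.inl (Or.inr ⟨h, h'⟩)
      · ext x
        simp only [hf, Finset.mem_filter]
        constructor
        · rintro ⟨hx, (hs | hs) | ⟨y, hy, hxy⟩⟩
          · exact absurd (h₁.subset hs (Set.mem_insert_of_mem _ rfl)).1 (hn₁ x hx)
          · exact absurd (h₂.subset hs (Set.mem_insert _ _)).1 (hn₂ x hx)
          · exact hVinj y x hxy ▸ hy
        · exact fun hx => ⟨hZ hx, Or.inr ⟨x, hx, rfl⟩⟩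
  rw [← Set.ncard_coe_finset, himage, Set.InjOn.ncard_image, Set.ncard_prod]
  · rfl
  · rintro ⟨T₁, T₂⟩ ⟨h₁, h₂⟩ ⟨T₁', T₂'⟩ ⟨h₁', h₂'⟩ h
    refine Prod.ext ?_ ?_
    · exact (hrec₁ T₁ T₂ h₁ h₂).symm.trans (h ▸ hrec₁ T₁' T₂' h₁' h₂')
    · exact (hrec₂ T₁ T₂ h₁ h₂).symm.trans (h ▸ hrec₂ T₁' T₂' h₁' h₂')

/-! ### Reflection in a horizontal line -/

/-- The effect on unit triangles of the reflection in the line at height `0`, which maps the lattice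
point `(x, y)` to `(x + y, -y)`. -/
def Tri.reflect : Tri → Tri
  | .up x y => .down (x + y) (-y)
  | .down x y => .up (x + y) (-y)

theorem Tri.reflect_involutive : Function.Involutive Tri.reflect := by
  rintro (⟨x, y⟩ | ⟨x, y⟩) <;> simp [Tri.reflect]

theorem IsLozenge.reflect {s : Set Tri} (hs : IsLozenge s) : IsLozenge (Tri.reflect '' s) := by
  obtain ⟨x, y, rfl | rfl | rfl⟩ := hs
  · refine ⟨x + y, -y, Or.inl ?_⟩
    simp [Set.image_pair, Tri.reflect, Set.pair_comm]
  · refine ⟨x + (y + 1), -(y + 1), Or.inr (Or.inr ?_)⟩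
    simp [Set.image_pair, Tri.reflect, Set.pair_comm]
    ring_nf
  · refine ⟨x + y, -(y + 1), Or.inr (Or.inl ?_)⟩
    simp [Set.image_pair, Tri.reflect, Set.pair_comm]

theorem IsTiling.reflect {R : Set Tri} {T : Set (Set Tri)} (hT : IsTiling R T) :
    IsTiling (Tri.reflect '' R) (Set.image Tri.reflect '' T) := by
  refine ⟨?_, ?_, ?_⟩
  · rintro _ ⟨s, hs, rfl⟩
    exact (hT.1 s hs).reflect
  · rintro _ ⟨s, hs, rfl⟩ _ ⟨s', hs', rfl⟩ h
    exact (Set.disjoint_image_iff Tri.reflect_involutive.injective).2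
      (hT.2.1 hs hs' fun h' => h (h' ▸ rfl))
  · rw [← hT.2.2, Set.sUnion_eq_biUnion, Set.sUnion_eq_biUnion, Set.image_iUnion₂,
      Set.biUnion_image]

theorem tilingCount_reflect (R : Set Tri) : tilingCount (Tri.reflect '' R) = tilingCount R := by
  have hinv : ∀ T : Set (Set Tri), Set.image Tri.reflect '' (Set.image Tri.reflect '' T) = T :=
    Function.LeftInverse.image_image
      (Function.LeftInverse.image_image Tri.reflect_involutive.leftInverse)
  have hR : Tri.reflect '' (Tri.reflect '' R) = R :=
    Tri.reflect_involutive.leftInverse.image_image R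
  have : {T | IsTiling (Tri.reflect '' R) T} =
      Set.image (Set.image Tri.reflect) '' {T | IsTiling R T} := by
    ext T
    constructor
    · exact fun hT => ⟨Set.image Tri.reflect '' T, hR ▸ IsTiling.reflect hT, hinv T⟩
    · rintro ⟨T', hT', rfl⟩
      exact IsTiling.reflect hT'
  rw [tilingCount, this, Set.ncard_image_of_injective _
    (Tri.reflect_involutive.injective.image_injective.image_injective), tilingCount]

/-! ### Vandermonde products of interlacing sets -/

/-- The Vandermonde product `∏ (y - x)` over all pairs `x < y` of elements of `S`. -/
def vdm (S : Finset ℤ) : ℤ := ∏ x ∈ S, ∏ y ∈ S with x < y, (y - x)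

/-- The number of elements of `S` below `x`. -/
def below (S : Finset ℤ) (x : ℤ) : ℕ := (S.filter (· < x)).card

theorem vdm_image {n : ℕ} {s : Fin n → ℤ} (hs : StrictMono s) :
    vdm (Finset.univ.image s) = (Matrix.vandermonde s).det := by
  rw [Matrix.det_vandermonde, vdm, Finset.prod_image hs.injective.injOn]
  refine Finset.prod_congr rfl fun i _ => ?_
  rw [Finset.filter_image, Finset.prod_image hs.injective.injOn]
  refine Finset.prod_congr ?_ fun _ _ => rfl
  ext j
  simp [hs.lt_iff_lt]

theorem lt_below_image_iff {n : ℕ} {s : Fin n → ℤ} (hs : StrictMono s) (x : ℤ) (i : Fin n) :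
    (i : ℕ) < below (Finset.univ.image s) x ↔ s i < x := by
  have hcard : below (Finset.univ.image s) x = (Finset.univ.filter fun j => s j < x).card := by
    rw [below, Finset.filter_image, Finset.card_image_of_injective _ hs.injective]
  rw [hcard]
  constructor
  · intro h
    by_contra! hx
    have : (Finset.univ.filter fun j => s j < x) ⊆ Finset.Iio i := by
      intro j hj
      rw [Finset.mem_Iio]
      exact hs.lt_iff_lt.1 ((Finset.mem_filter.1 hj).2.trans_le hx)
    have := Finset.card_le_card this
    rw [Fin.card_Iio] at this
    omega
  · intro h
    have : Finset.Iic i ⊆ Finset.univ.filter fun j => s j < x := by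
      intro j hj
      exact Finset.mem_filter.2
        ⟨Finset.mem_univ _, (hs.monotone (Finset.mem_Iic.1 hj)).trans_lt h⟩
    have := Finset.card_le_card this
    rw [Fin.card_Iic] at this
    omega

theorem below_le_card (S : Finset ℤ) (x : ℤ) : below S x ≤ S.card :=
  Finset.card_le_card (Finset.filter_subset _ _)

open Polynomial in
theorem descPochhammer_eval_add_one (j : ℕ) (x : ℤ) :
    (descPochhammer ℤ (j + 1)).eval (x + 1) - (descPochhammer ℤ (j + 1)).eval x =
      (j + 1) * (descPochhammer ℤ j).eval x := by
  rw [descPochhammer_succ_left, eval_mul, eval_X, eval_comp, ← descPochhammer_succ_left,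
    descPochhammer_succ_eval]
  simp
  ring

open Polynomial in
theorem sum_Ico_descPochhammer (j : ℕ) {x y : ℤ} (hxy : x ≤ y) :
    ∑ z ∈ Finset.Ico x y, (j + 1 : ℤ) * (descPochhammer ℤ j).eval z =
      (descPochhammer ℤ (j + 1)).eval y - (descPochhammer ℤ (j + 1)).eval x := by
  induction y, hxy using Int.leInduction with
  | base => simp
  | succ y hxy ih =>
    have : Finset.Ico x (y + 1) = insert y (Finset.Ico x y) := by
      ext z
      simp only [Finset.mem_Ico, Finset.mem_insert]
      omega
    rw [this, Finset.sum_insert (by simp), ih, ← descPochhammer_eval_add_one]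
    ring

open Polynomial in
theorem det_descPochhammer {n : ℕ} (s : Fin n → ℤ) :
    (Matrix.of fun i j : Fin n => (descPochhammer ℤ j).eval (s i)).det =
      (Matrix.vandermonde s).det :=
  (Matrix.det_eval_matrixOfPolynomials_eq_det_vandermonde s (fun j => descPochhammer ℤ j)
    (fun j => descPochhammer_natDegree ℤ j) fun j => monic_descPochhammer ℤ j).symm

open Polynomial in
/-- The sum of the Vandermonde determinants of all `t` that interlace `s`. In the basis of the falling
factorials the determinant is multilinear in its rows, each row sum telescopes, and the resulting
determinant of differences is the Vandermonde determinant of `s` after row operations. -/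
theorem sum_vandermonde_interlacing {h : ℕ} {s : Fin (h + 1) → ℤ} (hs : StrictMono s) :
    (h.factorial : ℤ) *
        ∑ t ∈ Fintype.piFinset fun i : Fin h => Finset.Ico (s i.castSucc) (s i.succ),
          (Matrix.vandermonde t).det = (Matrix.vandermonde s).det := by
  have hfac : (h.factorial : ℤ) = ∏ j : Fin h, ((j : ℤ) + 1) := by
    rw [← Finset.prod_range_add_one_eq_factorial, Nat.cast_prod,
      Fin.prod_univ_eq_prod_range (fun j => (j : ℤ) + 1)]
    simp
  have hmulti := (Matrix.detRowAlternating (n := Fin h) (R := ℤ)).toMultilinearMap.map_sum_finset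
    (fun (_ : Fin h) (z : ℤ) (j : Fin h) => ((j : ℤ) + 1) * (descPochhammer ℤ j).eval z)
    (fun i => Finset.Ico (s i.castSucc) (s i.succ))
  calc _ = ∑ t ∈ Fintype.piFinset fun i : Fin h => Finset.Ico (s i.castSucc) (s i.succ),
        (Matrix.of fun i j : Fin h =>
          ((j : ℤ) + 1) * (descPochhammer ℤ j).eval (t i)).det := by
        rw [Finset.mul_sum]
        refine Finset.sum_congr rfl fun t _ => ?_
        rw [← det_descPochhammer, hfac, ← Matrix.det_mul_row]
        rfl
    _ = (Matrix.of fun i j : Fin h => (descPochhammer ℤ (j + 1)).eval (s i.succ) -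
          (descPochhammer ℤ (j + 1)).eval (s i.castSucc)).det := by
        refine hmulti.symm.trans ?_
        refine congrArg Matrix.det (Matrix.ext fun i j => ?_)
        rw [Finset.sum_apply]
        exact sum_Ico_descPochhammer j (hs.monotone i.castSucc_le_succ)
    _ = _ := by
        rw [← det_descPochhammer s, eq_comm]
        rw [Matrix.det_eq_of_forall_row_eq_smul_add_pred
          (B := Matrix.of fun i j => Fin.cases ((descPochhammer ℤ j).eval (s 0))
            (fun i => (descPochhammer ℤ j).eval (s i.succ) -
              (descPochhammer ℤ j).eval (s i.castSucc)) i) (fun _ => 1)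
          (fun j => by simp) (fun i j => by simp), Matrix.det_succ_column_zero,
          Fin.sum_univ_succ]
        simp only [Fin.val_zero, pow_zero, one_mul, Matrix.of_apply, Fin.cases_zero,
          descPochhammer_zero, eval_one, Fin.cases_succ, sub_self, mul_zero, zero_mul,
          Finset.sum_const_zero, add_zero]
        rfl

/-- `S'` interlaces `S`: the numbers of elements below `x` satisfy the inequalities that express
`s₁ ≤ s'₁ < s₂ ≤ s'₂ < ⋯`. If there is one element less in `S'` than in `S`, then this means
exactly one element of `S'` from each element of `S` up to the next one. -/
def Interlaces (S S' : Finset ℤ) : Prop :=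
  ∀ x, below S' x ≤ below S x ∧ below S (x + 1) ≤ below S' x + 1

theorem interlaces_image_iff {h : ℕ} {s : Fin (h + 1) → ℤ} {t : Fin h → ℤ} (hs : StrictMono s)
    (ht : StrictMono t) : Interlaces (Finset.univ.image s) (Finset.univ.image t) ↔
      ∀ i : Fin h, s i.castSucc ≤ t i ∧ t i < s i.succ := by
  have hsb := lt_below_image_iff hs
  have htb := lt_below_image_iff ht
  constructor
  · intro H i
    constructor
    · have h1 := (H (t i + 1)).1
      have h2 := (htb (t i + 1) i).2 (by omega)
      have h3 := (hsb (t i + 1) i.castSucc).1 (by simp; omega)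
      omega
    · have h1 := (H (s i.succ)).2
      have h2 := (hsb (s i.succ + 1) i.succ).2 (by omega)
      rw [Fin.val_succ] at h2
      exact (htb _ _).1 (by omega)
  · intro H x
    have hcs := below_le_card (Finset.univ.image s) (x + 1)
    have hct := below_le_card (Finset.univ.image t) x
    rw [Finset.card_image_of_injective _ hs.injective, Finset.card_univ, Fintype.card_fin] at hcs
    rw [Finset.card_image_of_injective _ ht.injective, Finset.card_univ, Fintype.card_fin] at hct
    constructor
    · by_contra! hlt
      have h1 := (htb x ⟨below (Finset.univ.image s) x, by omega⟩).1 hlt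
      have h2 := (H ⟨below (Finset.univ.image s) x, by omega⟩).1
      have h3 := (hsb x _).2 (h2.trans_lt h1)
      simp at h3
    · by_contra! hlt
      set i : Fin h := ⟨below (Finset.univ.image t) x, by omega⟩ with hi
      have h1 := (hsb (x + 1) i.succ).1 (by rw [Fin.val_succ]; exact hlt)
      have h2 := (htb x i).2 (by have := (H i).2; omega)
      simp [hi] at h2

/-- The Vandermonde sum over all `Z` that interlace `S`. For `h = 0` the only such `Z` is empty, so that
it does not matter which segments `X` provides. -/
theorem sum_vdm_interlacing {h : ℕ} {S : Finset ℤ} (hS : S.card = h + 1) {A B : ℤ}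
    (hSAB : S ⊆ Finset.Ico A (B + 1)) {X : Finset ℤ} (hX : h ≠ 0 → X = Finset.Ico A B)
    [DecidablePred (Interlaces S)] :
    (h.factorial : ℤ) * ∑ Z ∈ X.powerset with Z.card = h ∧ Interlaces S Z, vdm Z = vdm S := by
  set s := S.orderEmbOfFin hS with hsdef
  have hs : StrictMono s := (S.orderEmbOfFin hS).strictMono
  have himg : Finset.univ.image s = S := S.image_orderEmbOfFin_univ hS
  have hmono : ∀ t ∈ Fintype.piFinset fun i : Fin h => Finset.Ico (s i.castSucc) (s i.succ),
      StrictMono t := by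
    intro t ht i j hij
    rw [Fintype.mem_piFinset] at ht
    have h1 := Finset.mem_Ico.1 (ht i)
    have h2 := Finset.mem_Ico.1 (ht j)
    exact h1.2.trans_le ((hs.monotone (by
      rw [Fin.le_def, Fin.val_succ, Fin.val_castSucc]; exact hij)).trans h2.1)
  have hvdm : vdm S = (Matrix.vandermonde s).det := by rw [← vdm_image hs, himg]
  rw [hvdm, ← sum_vandermonde_interlacing hs]
  congr 1
  symm
  refine Finset.sum_bij (fun t _ => Finset.univ.image t) ?_ ?_ ?_ ?_
  · intro t ht
    have htm := hmono t ht
    rw [Fintype.mem_piFinset] at ht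
    rw [Finset.mem_filter, Finset.mem_powerset]
    refine ⟨?_, ?_, ?_⟩
    · intro z hz
      obtain ⟨i, -, rfl⟩ := Finset.mem_image.1 hz
      have hi := Finset.mem_Ico.1 (ht i)
      have h1 := Finset.mem_Ico.1 (hSAB (S.orderEmbOfFin_mem hS i.castSucc))
      have h2 := Finset.mem_Ico.1 (hSAB (S.orderEmbOfFin_mem hS i.succ))
      rw [hX (by have := i.isLt; omega), Finset.mem_Ico]
      rw [← hsdef] at h1 h2
      omega
    · rw [Finset.card_image_of_injective _ htm.injective, Finset.card_univ, Fintype.card_fin]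
    · have := (interlaces_image_iff hs htm).2 fun i => Finset.mem_Ico.1 (ht i)
      rwa [himg] at this
  · intro t ht t' ht' heq
    have h1 := hmono t ht
    have h2 := hmono t' ht'
    have hc : (Finset.univ.image t).card = h := by
      rw [Finset.card_image_of_injective _ h1.injective, Finset.card_univ, Fintype.card_fin]
    have e1 := Finset.orderEmbOfFin_unique hc
      (fun i => Finset.mem_image_of_mem _ (Finset.mem_univ i)) h1
    have e2 := Finset.orderEmbOfFin_unique hc
      (fun i => heq ▸ Finset.mem_image_of_mem _ (Finset.mem_univ i)) h2
    exact e1.trans e2.symm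
  · intro Z hZ
    obtain ⟨-, hZc, hZ⟩ := Finset.mem_filter.1 hZ
    have ht := (Z.orderEmbOfFin hZc).strictMono
    have hZi := Z.image_orderEmbOfFin_univ hZc
    refine ⟨Z.orderEmbOfFin hZc, ?_, hZi⟩
    rw [← hZi, ← himg] at hZ
    rw [Fintype.mem_piFinset]
    exact fun i => Finset.mem_Ico.2 ((interlaces_image_iff hs ht).1 hZ i)
  · intro t ht
    exact (vdm_image (hmono t ht)).symm

/-! ### Tilings of a horizontal strip -/

theorem up_mem_regionOf {P : Set (ℤ × ℤ)} {x y : ℤ} :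
    Tri.up x y ∈ regionOf P ↔ (x, y) ∈ P ∧ (x + 1, y) ∈ P ∧ (x, y + 1) ∈ P := by
  simp [regionOf, Tri.verts, Set.insert_subset_iff]

theorem down_mem_regionOf {P : Set (ℤ × ℤ)} {x y : ℤ} :
    Tri.down x y ∈ regionOf P ↔ (x, y) ∈ P ∧ (x + 1, y) ∈ P ∧ (x + 1, y - 1) ∈ P := by
  simp [regionOf, Tri.verts, Set.insert_subset_iff]

/-- The part of the strip between the lines at heights `y` and `y + 1` that consists of the
up-pointing unit triangles at `P` and the down-pointing ones at `Q`. -/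
def strip (P Q : Finset ℤ) (y : ℤ) : Set Tri :=
  {τ | (∃ x ∈ P, τ = Tri.up x y) ∨ ∃ x ∈ Q, τ = Tri.down x (y + 1)}

theorem up_mem_strip {P Q : Finset ℤ} {x y z : ℤ} :
    Tri.up x z ∈ strip P Q y ↔ x ∈ P ∧ z = y := by
  simp [strip]

theorem down_mem_strip {P Q : Finset ℤ} {x y z : ℤ} :
    Tri.down x z ∈ strip P Q y ↔ x ∈ Q ∧ z = y + 1 := by
  simp [strip]

theorem finite_strip (P Q : Finset ℤ) (y : ℤ) : (strip P Q y).Finite := by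
  classical
  refine ((P.image fun x => Tri.up x y).finite_toSet.union
    (Q.image fun x => Tri.down x (y + 1)).finite_toSet).subset ?_
  rintro τ (⟨x, hx, rfl⟩ | ⟨x, hx, rfl⟩)
  · exact Or.inl (by simpa using hx)
  · exact Or.inr (by simpa using hx)

theorem below_add_one (S : Finset ℤ) (x : ℤ) :
    below S (x + 1) = below S x + if x ∈ S then 1 else 0 := by
  have : S.filter (· < x + 1) = S.filter (· < x) ∪ S.filter (· = x) := by
    rw [← Finset.filter_or]
    exact Finset.filter_congr fun z _ => by omega
  rw [below, this, Finset.card_union_of_disjoint, Finset.filter_eq', below]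
  · split_ifs <;> simp
  · exact Finset.disjoint_filter.2 fun z _ h h' => by omega

theorem exists_below_eq_zero (S : Finset ℤ) : ∃ x₀, ∀ z ∈ S, x₀ < z := by
  obtain ⟨x₀, hx₀⟩ := S.finite_toSet.bddBelow
  exact ⟨x₀ - 1, fun z hz => by have := hx₀ hz; omega⟩

theorem below_eq_zero {S : Finset ℤ} {x : ℤ} (h : ∀ z ∈ S, x ≤ z) : below S x = 0 := by
  rw [below, Finset.card_eq_zero, Finset.filter_eq_empty_iff]
  exact fun z hz => not_lt.2 (h z hz)

theorem below_eq_card {S : Finset ℤ} {x : ℤ} (h : ∀ z ∈ S, z < x) : below S x = S.card := by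
  rw [below, Finset.filter_true_of_mem h]

/-- The only candidate for a tiling of a strip. The up-pointing triangle at `x` is matched with the
down-pointing one to its left iff the down-pointing triangles to the left of `x` outnumber the
up-pointing ones; otherwise it is matched with the one to its right. -/
def stripTiling (P Q : Finset ℤ) (y : ℤ) : Set (Set Tri) :=
  {s | (∃ x ∈ P, below Q x = below P x ∧ s = {Tri.up x y, Tri.down x (y + 1)}) ∨
    ∃ x, below Q x = below P x + 1 ∧ s = {Tri.up x y, Tri.down (x - 1) (y + 1)}}

theorem IsTiling.strip_cases {P Q : Finset ℤ} {y : ℤ} {T : Set (Set Tri)}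
    (hT : IsTiling (strip P Q y) T) {s : Set Tri} (hs : s ∈ T) :
    ∃ x ∈ P, (x ∈ Q ∧ s = {Tri.up x y, Tri.down x (y + 1)}) ∨
      (x - 1 ∈ Q ∧ s = {Tri.up x y, Tri.down (x - 1) (y + 1)}) := by
  have hsub := hT.subset hs
  obtain ⟨x, z, rfl | rfl | rfl⟩ := hT.1 s hs <;>
    rw [Set.insert_subset_iff, Set.singleton_subset_iff, up_mem_strip, down_mem_strip] at hsub
  · omega
  · obtain ⟨⟨hx, rfl⟩, hx', -⟩ := hsub
    exact ⟨x, hx, Or.inl ⟨hx', rfl⟩⟩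
  · obtain ⟨⟨hx, rfl⟩, hx', -⟩ := hsub
    exact ⟨x, hx, Or.inr ⟨hx', rfl⟩⟩

/-- In a tiling of a strip, the lozenge that crosses the position `x` is present iff one
down-pointing triangle to the left of `x` is not matched with an up-pointing one to the left
of `x`. -/
theorem IsTiling.below_strip {P Q : Finset ℤ} {y : ℤ} {T : Set (Set Tri)}
    (hT : IsTiling (strip P Q y) T) (x : ℤ) :
    (x ∈ P ∧ {Tri.up x y, Tri.down (x - 1) (y + 1)} ∈ T ∧ below Q x = below P x + 1) ∨
      ({Tri.up x y, Tri.down (x - 1) (y + 1)} ∉ T ∧ below Q x = below P x) := by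
  have hP : ∀ x, ({Tri.up x y, Tri.down (x - 1) (y + 1)} : Set Tri) ∈ T → x ∈ P := fun x h =>
    (up_mem_strip.1 (hT.subset h (Set.mem_insert _ _))).1
  obtain ⟨x₀, hx₀⟩ := exists_below_eq_zero (P ∪ Q)
  have hlow : ∀ x ≤ x₀, {Tri.up x y, Tri.down (x - 1) (y + 1)} ∉ T ∧ below Q x = below P x := by
    intro x hx
    refine ⟨fun h => ?_, ?_⟩
    · have := hx₀ x (Finset.mem_union_left _ (hP x h))
      omega
    · rw [below_eq_zero, below_eq_zero]
      · exact fun z hz => (hx.trans_lt (hx₀ z (Finset.mem_union_left _ hz))).le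
      · exact fun z hz => (hx.trans_lt (hx₀ z (Finset.mem_union_right _ hz))).le
  rcases le_total x x₀ with hx | hx
  · exact Or.inr (hlow x hx)
  induction x, hx using Int.leInduction with
  | base => exact Or.inr (hlow x₀ le_rfl)
  | succ x hx ih =>
    have hQ := below_add_one Q x
    have hPx := below_add_one P x
    -- The lozenges of the three relevant kinds at `x` and `x + 1`.
    have h2 : ({Tri.up x y, Tri.down x (y + 1)} : Set Tri) ∈ T → x ∈ P ∧ x ∈ Q := fun h =>
      ⟨(up_mem_strip.1 (hT.subset h (Set.mem_insert _ _))).1,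
        (down_mem_strip.1 (hT.subset h (Set.mem_insert_of_mem _ rfl))).1⟩
    have h3 : ({Tri.up (x + 1) y, Tri.down (x + 1 - 1) (y + 1)} : Set Tri) ∈ T → x ∈ Q := by
      intro h
      have := (down_mem_strip.1 (hT.subset h (Set.mem_insert_of_mem _ rfl))).1
      rwa [add_sub_cancel_right] at this
    have h23 : ({Tri.up x y, Tri.down x (y + 1)} : Set Tri) ∈ T →
        ({Tri.up (x + 1) y, Tri.down (x + 1 - 1) (y + 1)} : Set Tri) ∉ T := by
      intro h h'
      have := hT.eq_of_mem h h' (τ := Tri.down x (y + 1)) (by simp) (by simp)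
      have : Tri.up x y ∈ ({Tri.up (x + 1) y, Tri.down (x + 1 - 1) (y + 1)} : Set Tri) :=
        this ▸ Set.mem_insert _ _
      simp at this
    have h22 : ({Tri.up x y, Tri.down x (y + 1)} : Set Tri) ∈ T →
        ({Tri.up x y, Tri.down (x - 1) (y + 1)} : Set Tri) ∉ T := by
      intro h h'
      have := hT.eq_of_mem h h' (τ := Tri.up x y) (by simp) (by simp)
      have : Tri.down x (y + 1) ∈ ({Tri.up x y, Tri.down (x - 1) (y + 1)} : Set Tri) :=
        this ▸ Set.mem_insert_of_mem _ rfl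
      simp at this
      omega
    have hcovP : x ∈ P → ({Tri.up x y, Tri.down x (y + 1)} : Set Tri) ∈ T ∨
        ({Tri.up x y, Tri.down (x - 1) (y + 1)} : Set Tri) ∈ T := by
      intro hx
      obtain ⟨s, hs, hxs⟩ := hT.exists_mem (up_mem_strip.2 ⟨hx, rfl⟩)
      obtain ⟨z, -, ⟨-, rfl⟩ | ⟨-, rfl⟩⟩ := hT.strip_cases hs
      all_goals
        obtain rfl : x = z := by simpa using hxs
        simp [hs]
    have hcovQ : x ∈ Q → ({Tri.up x y, Tri.down x (y + 1)} : Set Tri) ∈ T ∨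
        ({Tri.up (x + 1) y, Tri.down (x + 1 - 1) (y + 1)} : Set Tri) ∈ T := by
      intro hx
      obtain ⟨s, hs, hxs⟩ := hT.exists_mem (down_mem_strip.2 ⟨hx, rfl⟩)
      obtain ⟨z, -, ⟨-, rfl⟩ | ⟨-, rfl⟩⟩ := hT.strip_cases hs
      · obtain rfl : x = z := by simpa using hxs
        exact Or.inl hs
      · obtain rfl : x = z - 1 := by simpa using hxs
        right
        simpa using hs
    have hP1 := hP (x + 1)
    by_cases a1 : ({Tri.up x y, Tri.down x (y + 1)} : Set Tri) ∈ T <;>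
    by_cases a2 : ({Tri.up x y, Tri.down (x - 1) (y + 1)} : Set Tri) ∈ T <;>
    by_cases a3 : ({Tri.up (x + 1) y, Tri.down (x + 1 - 1) (y + 1)} : Set Tri) ∈ T <;>
    by_cases a4 : x ∈ P <;> by_cases a5 : x ∈ Q <;>
    simp only [a1, a2, a3, a4, a5, if_true, if_false, true_and, false_and, and_false, or_false,
      false_or, not_true, not_false_iff, true_imp_iff, false_imp_iff, and_true, or_true]
      at * <;> first | omega | exact ⟨hP1, by omega⟩

/-- A strip has at most one tiling. -/
theorem isTiling_strip_iff {P Q : Finset ℤ} {y : ℤ} {T : Set (Set Tri)} :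
    IsTiling (strip P Q y) T ↔ T = stripTiling P Q y ∧
      ∀ x, below P x ≤ below Q x ∧ below Q x ≤ below P (x + 1) := by
  constructor
  · intro hT
    refine ⟨Set.Subset.antisymm ?_ ?_, fun x => ?_⟩
    · intro s hs
      obtain ⟨x, hx, ⟨-, rfl⟩ | ⟨-, rfl⟩⟩ := hT.strip_cases hs
      · refine Or.inl ⟨x, hx, ?_, rfl⟩
        rcases hT.below_strip x with ⟨-, h, -⟩ | h
        · have := hT.eq_of_mem hs h (τ := Tri.up x y) (by simp) (by simp)
          have : Tri.down x (y + 1) ∈ ({Tri.up x y, Tri.down (x - 1) (y + 1)} : Set Tri) :=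
            this ▸ Set.mem_insert_of_mem _ rfl
          simp at this
          omega
        · exact h.2
      · rcases hT.below_strip x with h | h
        · exact Or.inr ⟨x, h.2.2, rfl⟩
        · exact absurd hs h.1
    · rintro s (⟨x, hx, h, rfl⟩ | ⟨x, h, rfl⟩)
      · rcases hT.below_strip x with h' | h'
        · omega
        obtain ⟨s, hs, hxs⟩ := hT.exists_mem (up_mem_strip.2 ⟨hx, rfl⟩)
        obtain ⟨z, -, ⟨-, rfl⟩ | ⟨-, rfl⟩⟩ := hT.strip_cases hs <;>
          obtain rfl : x = z := by simpa using hxs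
        exacts [hs, absurd hs h'.1]
      · rcases hT.below_strip x with h' | h'
        · exact h'.2.1
        · omega
    · have := below_add_one P x
      rcases hT.below_strip x with h | h
      · rw [if_pos h.1] at this
        omega
      · omega
  · rintro ⟨rfl, H⟩
    have hQ := below_add_one Q
    have hP := below_add_one P
    have hside : ∀ x, below Q x = below P x + 1 → x ∈ P ∧ x - 1 ∈ Q := by
      intro x hx
      have h1 := H x
      have h2 := H (x - 1)
      have h3 := hQ (x - 1)
      have h4 := hP x
      rw [sub_add_cancel] at h2 h3
      constructor
      · by_contra h
        rw [if_neg h] at h4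
        omega
      · by_contra h
        rw [if_neg h] at h3
        omega
    have hright : ∀ x ∈ P, below Q x = below P x → x ∈ Q := by
      intro x hx h
      have h1 := H (x + 1)
      have h2 := hQ x
      have h3 := hP x
      rw [if_pos hx] at h3
      by_contra h'
      rw [if_neg h'] at h2
      omega
    refine ⟨?_, ?_, ?_⟩
    · rintro s (⟨x, -, -, rfl⟩ | ⟨x, -, rfl⟩)
      exacts [⟨x, y, Or.inr (Or.inl rfl)⟩, ⟨x, y, Or.inr (Or.inr rfl)⟩]
    · intro s hs s' hs' hne
      refine Set.disjoint_left.2 fun τ hτ hτ' => hne ?_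
      rcases hs with ⟨x, hx, h, rfl⟩ | ⟨x, h, rfl⟩ <;>
      rcases hs' with ⟨z, hz, h', rfl⟩ | ⟨z, h', rfl⟩ <;>
      rcases hτ with rfl | rfl <;> rcases hτ' with hτ' | hτ' <;>
      simp only [Tri.up.injEq, Tri.down.injEq, Set.mem_singleton_iff, reduceCtorEq, and_true,
        sub_left_inj] at hτ'
      all_goals try subst hτ'
      all_goals first | rfl | omega | skip
      · have h1 := hQ (z - 1)
        have h2 := hP (z - 1)
        rw [sub_add_cancel, if_pos hx] at h2
        rw [sub_add_cancel, if_pos (hright _ hx h)] at h1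
        omega
      · have h1 := hQ (x - 1)
        have h2 := hP (x - 1)
        rw [sub_add_cancel, if_pos hz] at h2
        rw [sub_add_cancel, if_pos (hright _ hz h')] at h1
        omega
    · ext τ
      constructor
      · rintro ⟨s, ⟨x, hx, h, rfl⟩ | ⟨x, h, rfl⟩, rfl | rfl⟩
        · exact up_mem_strip.2 ⟨hx, rfl⟩
        · exact down_mem_strip.2 ⟨hright x hx h, rfl⟩
        · exact up_mem_strip.2 ⟨(hside x h).1, rfl⟩
        · exact down_mem_strip.2 ⟨(hside x h).2, rfl⟩
      · rintro (⟨x, hx, rfl⟩ | ⟨x, hx, rfl⟩)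
        · have h1 := H x
          have h2 := hP x
          rw [if_pos hx] at h2
          rcases Nat.lt_or_ge (below P x) (below Q x) with h | h
          · exact ⟨_, Or.inr ⟨x, by omega, rfl⟩, Set.mem_insert _ _⟩
          · exact ⟨_, Or.inl ⟨x, hx, by omega, rfl⟩, Set.mem_insert _ _⟩
        · have h1 := H x
          have h2 := hP x
          have h3 := hQ x
          rw [if_pos hx] at h3
          by_cases h : x ∈ P ∧ below Q x = below P x
          · exact ⟨_, Or.inl ⟨x, h.1, h.2, rfl⟩, Set.mem_insert_of_mem _ rfl⟩
          · refine ⟨_, Or.inr ⟨x + 1, ?_, rfl⟩, ?_⟩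
            · split_ifs at h2 with hxP
              · have : below Q x ≠ below P x := fun h' => h ⟨hxP, h'⟩
                omega
              · omega
            · rw [add_sub_cancel_right]
              exact Set.mem_insert_of_mem _ rfl

theorem tilingCount_strip (P Q : Finset ℤ) (y : ℤ)
    [Decidable (∀ x, below P x ≤ below Q x ∧ below Q x ≤ below P (x + 1))] :
    tilingCount (strip P Q y) =
      if ∀ x, below P x ≤ below Q x ∧ below Q x ≤ below P (x + 1) then 1 else 0 := by
  rw [tilingCount]
  simp_rw [isTiling_strip_iff]
  split_ifs with h
  · simp [h]
  · simp [h]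

/-! ### Dented trapezoids -/

theorem finite_regionOf {P : Set (ℤ × ℤ)} (hP : P.Finite) : (regionOf P).Finite := by
  refine ((hP.image fun q => Tri.up q.1 q.2).union (hP.image fun q => Tri.down q.1 q.2)).subset ?_
  rintro (⟨x, y⟩ | ⟨x, y⟩) h
  · exact Or.inl ⟨(x, y), (up_mem_regionOf.1 h).1, rfl⟩
  · exact Or.inr ⟨(x, y), (down_mem_regionOf.1 h).1, rfl⟩

/-- The trapezoid of height `h` whose bottom side has length `N` and left end `(A, y₀)`. The left
side follows the direction `(0, 1)`, the right side the direction `(-1, 1)`. -/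
def trap (A : ℤ) (N : ℕ) (y₀ : ℤ) (h : ℕ) : Set Tri :=
  regionOf {P | A ≤ P.1 ∧ y₀ ≤ P.2 ∧ P.2 ≤ y₀ + h ∧ P.1 + P.2 ≤ A + N + y₀}

/-- The up-pointing unit triangles standing on the segments `S` of the line at height `y`. -/
def dents (S : Finset ℤ) (y : ℤ) : Set Tri := {τ | ∃ x ∈ S, τ = Tri.up x y}

theorem up_mem_trap {A : ℤ} {N : ℕ} {y₀ : ℤ} {h : ℕ} {x y : ℤ} :
    Tri.up x y ∈ trap A N y₀ h ↔ A ≤ x ∧ y₀ ≤ y ∧ y + 1 ≤ y₀ + h ∧ x + y + 1 ≤ A + N + y₀ := by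
  simp only [trap, up_mem_regionOf, Set.mem_ofPred_eq]
  omega

theorem down_mem_trap {A : ℤ} {N : ℕ} {y₀ : ℤ} {h : ℕ} {x y : ℤ} :
    Tri.down x y ∈ trap A N y₀ h ↔
      A ≤ x ∧ y₀ + 1 ≤ y ∧ y ≤ y₀ + h ∧ x + y + 1 ≤ A + N + y₀ := by
  simp only [trap, down_mem_regionOf, Set.mem_ofPred_eq]
  omega

theorem up_mem_dents {S : Finset ℤ} {x y z : ℤ} : Tri.up x z ∈ dents S y ↔ x ∈ S ∧ z = y := by
  simp [dents]

theorem down_notMem_dents {S : Finset ℤ} {x y z : ℤ} : Tri.down x z ∉ dents S y := by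
  simp [dents]

theorem finite_trap (A : ℤ) (N : ℕ) (y₀ : ℤ) (h : ℕ) : (trap A N y₀ h).Finite := by
  refine finite_regionOf (((Set.finite_Icc A (A + N)).prod
    (Set.finite_Icc y₀ (y₀ + h))).subset ?_)
  rintro ⟨x, y⟩ hP
  simp only [Set.mem_ofPred_eq] at hP
  simp only [Set.mem_prod, Set.mem_Icc]
  omega

theorem trap_zero_height (A : ℤ) (N : ℕ) (y₀ : ℤ) : trap A N y₀ 0 = ∅ := by
  refine Set.eq_empty_of_forall_notMem ?_
  rintro (⟨x, y⟩ | ⟨x, y⟩) h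
  · rw [up_mem_trap] at h
    omega
  · rw [down_mem_trap] at h
    omega

theorem below_sdiff {A B : ℤ} {S : Finset ℤ} (hS : S ⊆ Finset.Ico A B) (x : ℤ) :
    (below (Finset.Ico A B \ S) x : ℤ) + below S x = max (min x B - A) 0 := by
  have h1 : (Finset.Ico A B \ S).filter (· < x) ∪ S.filter (· < x) = Finset.Ico A (min x B) := by
    rw [← Finset.filter_union, Finset.sdiff_union_of_subset hS]
    ext z
    simp only [Finset.mem_filter, Finset.mem_Ico]
    omega
  have h2 : Disjoint ((Finset.Ico A B \ S).filter (· < x)) (S.filter (· < x)) :=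
    Finset.disjoint_filter_filter Finset.sdiff_disjoint
  rw [below, below, ← Nat.cast_add, ← Finset.card_union_of_disjoint h2, h1, Int.card_Ico]
  omega

/-- A strip between a dented line and the next dented line can be tiled iff the two sets of dents
interlace. -/
theorem below_sdiff_iff_interlaces {A : ℤ} {M : ℕ} {S Z : Finset ℤ}
    (hS : S ⊆ Finset.Ico A (A + M + 1)) (hZ : Z ⊆ Finset.Ico A (A + M)) :
    (∀ x, below (Finset.Ico A (A + M + 1) \ S) x ≤ below (Finset.Ico A (A + M) \ Z) x ∧
      below (Finset.Ico A (A + M) \ Z) x ≤ below (Finset.Ico A (A + M + 1) \ S) (x + 1)) ↔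
      S.card = Z.card + 1 ∧ Interlaces S Z := by
  have hS' := below_sdiff hS
  have hZ' := below_sdiff hZ
  have hSlow : ∀ x ≤ A, below S x = 0 := fun x hx =>
    below_eq_zero fun z hz => by have := Finset.mem_Ico.1 (hS hz); omega
  have hZlow : ∀ x ≤ A, below Z x = 0 := fun x hx =>
    below_eq_zero fun z hz => by have := Finset.mem_Ico.1 (hZ hz); omega
  have hShigh : ∀ x, A + M + 1 ≤ x → below S x = S.card := fun x hx =>
    below_eq_card fun z hz => by have := Finset.mem_Ico.1 (hS hz); omega
  have hZhigh : ∀ x, A + M ≤ x → below Z x = Z.card := fun x hx =>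
    below_eq_card fun z hz => by have := Finset.mem_Ico.1 (hZ hz); omega
  constructor
  · intro H
    refine ⟨?_, fun x => ?_⟩
    · have h0 := H (A + M + 1)
      have h1 := hS' (A + M + 1)
      have h2 := hZ' (A + M + 1)
      have h3 := hS' (A + M + 1 + 1)
      have h4 := hShigh (A + M + 1) (by omega)
      have h5 := hShigh (A + M + 1 + 1) (by omega)
      have h6 := hZhigh (A + M + 1) (by omega)
      omega
    · have h0 := H x
      have h1 := hS' x
      have h2 := hS' (x + 1)
      have h3 := hZ' x
      rcases lt_or_ge x A with hx | hx
      · have := hSlow x (by omega)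
        have := hSlow (x + 1) (by omega)
        have := hZlow x (by omega)
        omega
      · rcases lt_or_ge x (A + M + 1) with hx' | hx'
        · omega
        · have := hShigh x (by omega)
          have := hShigh (x + 1) (by omega)
          have := hZhigh x (by omega)
          omega
  · rintro ⟨hc, H⟩ x
    have h0 := H x
    have h1 := hS' x
    have h2 := hS' (x + 1)
    have h3 := hZ' x
    rcases lt_or_ge x A with hx | hx
    · have := hSlow x (by omega)
      have := hSlow (x + 1) (by omega)
      have := hZlow x (by omega)
      omega
    · rcases lt_or_ge x (A + M + 1) with hx' | hx'
      · omega
      · have := hShigh x (by omega)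
        have := hShigh (x + 1) (by omega)
        have := hZhigh x (by omega)
        omega

/-- Cutting off the lowest strip of a dented trapezoid. If the strip is the whole trapezoid, then no
vertical lozenge crosses its top side. -/
theorem tilingCount_trap_succ (A : ℤ) (M : ℕ) (y₀ : ℤ) (h : ℕ) {S : Finset ℤ}
    (hS : S ⊆ Finset.Ico A (A + M + 1)) [DecidablePred (Interlaces S)] :
    tilingCount (trap A (M + 1) y₀ (h + 1) \ dents S y₀) =
      ∑ Z ∈ (if h = 0 then ∅ else Finset.Ico A (A + M)).powerset,
        tilingCount (trap A M (y₀ + 1) h \ dents Z (y₀ + 1)) *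
          if S.card = Z.card + 1 ∧ Interlaces S Z then 1 else 0 := by
  classical
  have hsplit : trap A (M + 1) y₀ (h + 1) \ dents S y₀ = trap A M (y₀ + 1) h ∪
      strip (Finset.Ico A (A + M + 1) \ S) (Finset.Ico A (A + M)) y₀ := by
    ext τ
    rcases τ with ⟨x, y⟩ | ⟨x, y⟩
    · simp only [Set.mem_sdiff, Set.mem_union, up_mem_trap, up_mem_dents, up_mem_strip,
        Finset.mem_sdiff, Finset.mem_Ico]
      by_cases hx : x ∈ S
      · simp only [hx, true_and, not_true_eq_false, and_false, false_and, or_false]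
        have := Finset.mem_Ico.1 (hS hx)
        push_cast
        omega
      · simp only [hx, false_and, not_false_eq_true, and_true]
        push_cast
        omega
    · simp only [Set.mem_sdiff, Set.mem_union, down_mem_trap, down_notMem_dents, down_mem_strip,
        Finset.mem_Ico, not_false_eq_true, and_true]
      push_cast
      omega
  have hXsub : (if h = 0 then ∅ else Finset.Ico A (A + M)) ⊆ Finset.Ico A (A + M) := by
    split_ifs
    exacts [Finset.empty_subset _, le_rfl]
  rw [hsplit, tilingCount_union (finite_trap _ _ _ _) (finite_strip _ _ _) ?_ (y₀ + 1)
    (if h = 0 then ∅ else Finset.Ico A (A + M))]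
  · refine Finset.sum_congr rfl fun Z hZ => ?_
    have hZ' := (Finset.mem_powerset.1 hZ).trans hXsub
    have hstrip : strip (Finset.Ico A (A + M + 1) \ S) (Finset.Ico A (A + M)) y₀ \
        {τ | ∃ x ∈ Z, τ = Tri.down x (y₀ + 1)} =
        strip (Finset.Ico A (A + M + 1) \ S) (Finset.Ico A (A + M) \ Z) y₀ := by
      ext τ
      rcases τ with ⟨x, y⟩ | ⟨x, y⟩
      · simp [up_mem_strip]
      · simp only [Set.mem_sdiff, down_mem_strip, Set.mem_ofPred_eq, Tri.down.injEq,
          Finset.mem_sdiff]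
        constructor
        · rintro ⟨⟨h1, h2⟩, h3⟩
          exact ⟨⟨h1, fun h4 => h3 ⟨x, h4, rfl, h2⟩⟩, h2⟩
        · rintro ⟨⟨h1, h2⟩, h3⟩
          exact ⟨⟨h1, h3⟩, fun ⟨z, hz, hxz, _⟩ => h2 (hxz ▸ hz)⟩
    rw [hstrip, tilingCount_strip]
    simp only [below_sdiff_iff_interlaces hS hZ']
    rfl
  · intro x hx
    split_ifs at hx with h0
    · simp at hx
    · rw [up_mem_trap, down_mem_strip]
      have := Finset.mem_Ico.1 hx
      exact ⟨by omega, hx, rfl⟩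
  · rintro s ⟨x, y, rfl | rfl | rfl⟩ hs <;>
      simp only [Set.insert_subset_iff, Set.singleton_subset_iff, Set.mem_union, up_mem_trap,
        down_mem_trap, up_mem_strip, down_mem_strip, Finset.mem_Ico, Finset.mem_sdiff] at hs ⊢
    · by_cases hy : y = y₀ + 1
      · by_cases h0 : h = 0
        · omega
        · right; right
          subst hy
          refine ⟨x, ?_, rfl⟩
          rw [if_neg h0, Finset.mem_Ico]
          omega
      · left
        omega
    · by_cases hy : y = y₀
      · right; left
        rcases hs with ⟨h1 | h1, h2 | h2⟩
        all_goals first | omega | exact ⟨h1, h2⟩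
      · left
        omega
    · by_cases hy : y = y₀
      · right; left
        rcases hs with ⟨h1 | h1, h2 | h2⟩
        all_goals first | omega | exact ⟨h1, h2⟩
      · left
        omega
  · rw [Set.disjoint_left]
    rintro (⟨x, y⟩ | ⟨x, y⟩) h1 h2
    · rw [up_mem_trap] at h1
      rw [up_mem_strip] at h2
      omega
    · rw [down_mem_trap] at h1
      rw [down_mem_strip] at h2
      omega

theorem hyperfac_succ (n : ℕ) : hyperfac (n + 1) = hyperfac n * n.factorial :=
  Finset.prod_range_succ _ _

/-- The formula of Cohn, Larsen and Propp for the number of tilings of a dented trapezoid. For `h = 0`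
the region is empty and has one tiling whatever `S` is, so that `S` has to be empty. -/
theorem tilingCount_trap (h : ℕ) : ∀ (A : ℤ) (N : ℕ) (y₀ : ℤ) (S : Finset ℤ), h ≤ N →
    S ⊆ Finset.Ico A (A + N) → (h = 0 → S = ∅) →
    (tilingCount (trap A N y₀ h \ dents S y₀) : ℤ) * hyperfac h =
      if S.card = h then vdm S else 0 := by
  classical
  induction h with
  | zero =>
    intro A N y₀ S _ _ hS
    rw [hS rfl, trap_zero_height, Set.empty_sdiff, tilingCount_empty]
    simp [hyperfac, vdm]
  | succ h ih =>
    intro A N y₀ S hN hS _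
    obtain ⟨M, rfl⟩ : ∃ M, N = M + 1 := ⟨N - 1, by omega⟩
    have hS' : S ⊆ Finset.Ico A (A + M + 1) := by
      rwa [Nat.cast_add, Nat.cast_one, ← add_assoc] at hS
    rw [tilingCount_trap_succ A M y₀ h hS', hyperfac_succ, Nat.cast_sum, Nat.cast_mul,
      Finset.sum_mul]
    have hterm : ∀ Z ∈ (if h = 0 then ∅ else Finset.Ico A (A + M)).powerset,
        ((tilingCount (trap A M (y₀ + 1) h \ dents Z (y₀ + 1)) *
          (if S.card = Z.card + 1 ∧ Interlaces S Z then 1 else 0) : ℕ) : ℤ) *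
            ((hyperfac h : ℤ) * h.factorial) =
        if S.card = h + 1 then
          h.factorial * if Z.card = h ∧ Interlaces S Z then vdm Z else 0 else 0 := by
      intro Z hZ
      rw [Finset.mem_powerset] at hZ
      have := ih A M (y₀ + 1) Z (by omega)
        (by
          split_ifs at hZ
          exacts [hZ.trans (Finset.empty_subset _), hZ])
        (fun h0 => by rwa [if_pos h0, Finset.subset_empty] at hZ)
      calc _ = ((tilingCount (trap A M (y₀ + 1) h \ dents Z (y₀ + 1)) : ℤ) * hyperfac h) *
            h.factorial * (if S.card = Z.card + 1 ∧ Interlaces S Z then 1 else 0) := by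
            push_cast
            ring
        _ = _ := by
            rw [this]
            by_cases h1 : Z.card = h
            · by_cases h2 : S.card = h + 1 <;> by_cases h3 : Interlaces S Z <;>
                simp [h1, h2, h3, mul_comm]
            · by_cases h2 : S.card = h + 1 <;> simp [h1]
    rw [Finset.sum_congr rfl hterm]
    by_cases hc : S.card = h + 1
    · simp only [hc, if_true]
      rw [← Finset.mul_sum, ← Finset.sum_filter]
      exact sum_vdm_interlacing hc hS' fun h0 => if_neg h0
    · simp [hc]

/-! ### Lattice triangles as holes -/

theorem up_mem_upTriangle {z l : ℤ} {s : ℕ} {x y : ℤ} :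
    Tri.up x y ∈ upTriangle z l s ↔ z ≤ x ∧ l ≤ y ∧ x + y + 1 ≤ z + l + s := by
  simp only [upTriangle, up_mem_regionOf, Set.mem_ofPred_eq]
  omega

theorem down_mem_upTriangle {z l : ℤ} {s : ℕ} {x y : ℤ} :
    Tri.down x y ∈ upTriangle z l s ↔ z ≤ x ∧ l + 1 ≤ y ∧ x + y + 1 ≤ z + l + s := by
  simp only [upTriangle, down_mem_regionOf, Set.mem_ofPred_eq]
  omega

theorem up_mem_downTriangle {z l : ℤ} {s : ℕ} {x y : ℤ} :
    Tri.up x y ∈ downTriangle z l s ↔ x + 1 ≤ z + s ∧ y + 1 ≤ l ∧ z + l ≤ x + y := by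
  simp only [downTriangle, up_mem_regionOf, Set.mem_ofPred_eq]
  omega

theorem down_mem_downTriangle {z l : ℤ} {s : ℕ} {x y : ℤ} :
    Tri.down x y ∈ downTriangle z l s ↔ x + 1 ≤ z + s ∧ y ≤ l ∧ z + l ≤ x + y := by
  simp only [downTriangle, down_mem_regionOf, Set.mem_ofPred_eq]
  omega

/-- The union of the up-pointing lattice triangles on the line at height `l` that are given by the
positions of their left corners and their side lengths. -/
def triangles (Q : Set (ℤ × ℕ)) (l : ℤ) : Set Tri := {τ | ∃ q ∈ Q, τ ∈ upTriangle q.1 l q.2}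

/-- The segments on which the lattice triangles `Q` stand. -/
def IsBase (Q : Set (ℤ × ℕ)) (U : Finset ℤ) : Prop :=
  ∀ x, x ∈ U ↔ ∃ q ∈ Q, q.1 ≤ x ∧ x < q.1 + q.2

/-- Removing lattice triangles standing on a line amounts to removing only the unit triangles along
the line: the remaining part of the triangles is covered by vertical lozenges in every tiling. -/
theorem tilingCount_diff_triangles {R : Set Tri} {Q : Set (ℤ × ℕ)} {U : Finset ℤ} {l : ℤ}
    (hQU : IsBase Q U) (hR : triangles Q l ⊆ R) :
    tilingCount (R \ triangles Q l) = tilingCount (R \ dents U l) := by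
  set V : Set (Set Tri) := {s | ∃ x y, l < y ∧ Tri.up x y ∈ triangles Q l ∧
    s = {Tri.up x y, Tri.down x y}} with hV
  have hdown : ∀ x y, l < y → Tri.up x y ∈ triangles Q l → Tri.down x y ∈ triangles Q l := by
    rintro x y hy ⟨q, hq, h⟩
    refine ⟨q, hq, ?_⟩
    rw [up_mem_upTriangle] at h
    rw [down_mem_upTriangle]
    omega
  have hregion : R \ triangles Q l = (R \ dents U l) \ ⋃₀ V := by
    rw [sdiff_sdiff]
    congr 1
    ext τ
    rcases τ with ⟨x, y⟩ | ⟨x, y⟩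
    · constructor
      · intro h
        by_cases hy : y = l
        · left
          obtain ⟨q, hq, h⟩ := h
          rw [up_mem_upTriangle] at h
          exact up_mem_dents.2 ⟨(hQU x).2 ⟨q, hq, by omega⟩, hy⟩
        · right
          refine ⟨_, ⟨x, y, ?_, h, rfl⟩, Set.mem_insert _ _⟩
          obtain ⟨q, hq, h⟩ := h
          rw [up_mem_upTriangle] at h
          omega
      · rintro (h | ⟨_, ⟨x', y', hy, h, rfl⟩, h'⟩)
        · rw [up_mem_dents] at h
          obtain ⟨q, hq, hx⟩ := (hQU x).1 h.1
          refine ⟨q, hq, ?_⟩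
          rw [up_mem_upTriangle]
          omega
        · obtain ⟨rfl, rfl⟩ : x = x' ∧ y = y' := by simpa using h'
          exact h
    · constructor
      · rintro ⟨q, hq, h⟩
        rw [down_mem_upTriangle] at h
        refine Or.inr ⟨_, ⟨x, y, by omega, ⟨q, hq, ?_⟩, rfl⟩, Set.mem_insert_of_mem _ rfl⟩
        rw [up_mem_upTriangle]
        omega
      · rintro (h | ⟨_, ⟨x', y', hy, h, rfl⟩, h'⟩)
        · exact absurd h down_notMem_dents
        · obtain ⟨rfl, rfl⟩ : x = x' ∧ y = y' := by simpa using h'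
          exact hdown _ _ hy h
  rw [hregion]
  -- It remains to show that all vertical lozenges inside the triangles are forced, row by row.
  refine tilingCount_diff_forced ?_ ?_ ?_ ?_
  · rintro _ ⟨x, y, -, -, rfl⟩
    exact isLozenge_vertical x y
  · rintro _ ⟨x, y, -, -, rfl⟩ _ ⟨x', y', -, -, rfl⟩ hne
    refine Set.disjoint_left.2 fun τ h h' => hne ?_
    rcases h with rfl | rfl <;> rcases h' with h' | h' <;> simp_all
  · rintro τ ⟨_, ⟨x, y, hy, h, rfl⟩, rfl | rfl⟩
    · exact ⟨hR h, fun h' => hy.ne' (up_mem_dents.1 h').2⟩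
    · exact ⟨hR (hdown _ _ hy h), down_notMem_dents⟩
  · intro T hT
    have key : ∀ d : ℕ, ∀ x, Tri.up x (l + 1 + d) ∈ triangles Q l →
        {Tri.up x (l + 1 + d), Tri.down x (l + 1 + d)} ∈ T := by
      intro d
      induction d with
      | zero =>
        intro x hx
        have hmem := hdown x _ (by omega) hx
        obtain ⟨s, hs, hxs⟩ := hT.exists_mem ⟨hR hmem, down_notMem_dents⟩
        have hsub := hT.subset hs
        obtain ⟨q, hq, hx⟩ := hx
        rw [up_mem_upTriangle] at hx
        obtain ⟨x', y', rfl | rfl | rfl⟩ := hT.1 s hs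
        · obtain ⟨rfl, rfl⟩ : x = x' ∧ l + 1 + ((0 : ℕ) : ℤ) = y' := by simpa using hxs
          exact hs
        · obtain ⟨rfl, h⟩ : x = x' ∧ l + 1 + ((0 : ℕ) : ℤ) = y' + 1 := by simpa using hxs
          refine absurd (up_mem_dents.2 ⟨?_, ?_⟩) (hsub (Set.mem_insert _ _)).2
          · exact (hQU _).2 ⟨q, hq, by omega⟩
          · omega
        · obtain ⟨h', h⟩ : x = x' - 1 ∧ l + 1 + ((0 : ℕ) : ℤ) = y' + 1 := by simpa using hxs
          refine absurd (up_mem_dents.2 ⟨?_, ?_⟩) (hsub (Set.mem_insert _ _)).2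
          · exact (hQU _).2 ⟨q, hq, by omega⟩
          · omega
      | succ d ih =>
        intro x hx
        have hmem := hdown x _ (by omega) hx
        obtain ⟨s, hs, hxs⟩ := hT.exists_mem ⟨hR hmem, down_notMem_dents⟩
        obtain ⟨q, hq, hx⟩ := hx
        rw [up_mem_upTriangle] at hx
        push_cast at hx hxs
        -- The two up-pointing neighbours one row below already lie in vertical lozenges.
        have hno : ∀ x', x' = x ∨ x' = x + 1 → Tri.up x' (l + 1 + d) ∉ s := by
          intro x' hx' h
          have := ih x' ⟨q, hq, by rw [up_mem_upTriangle]; omega⟩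
          have := hT.eq_of_mem hs this h (Set.mem_insert _ _)
          rw [this] at hxs
          simp at hxs
        obtain ⟨x', y', rfl | rfl | rfl⟩ := hT.1 s hs
        · obtain ⟨rfl, h⟩ : x = x' ∧ l + 1 + ((d : ℤ) + 1) = y' := by simpa using hxs
          subst h
          push_cast
          exact hs
        · obtain ⟨rfl, h⟩ : x = x' ∧ l + 1 + ((d : ℤ) + 1) = y' + 1 := by simpa using hxs
          obtain rfl : y' = l + 1 + d := by omega
          exact absurd (Set.mem_insert _ _) (hno x (Or.inl rfl))
        · obtain ⟨h', h⟩ : x = x' - 1 ∧ l + 1 + ((d : ℤ) + 1) = y' + 1 := by simpa using hxs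
          obtain rfl : y' = l + 1 + d := by omega
          exact absurd (Set.mem_insert _ _) (hno x' (Or.inr (by omega)))
    rintro _ ⟨x, y, hy, h, rfl⟩
    obtain ⟨d, rfl⟩ : ∃ d : ℕ, y = l + 1 + d := ⟨(y - l - 1).toNat, by omega⟩
    exact key d x h

/-! ### Cutting a holey hexagon along a horizontal line -/

/-- The unit triangles above the horizontal line at height `l`. -/
def aboveLine (l : ℤ) : Set Tri :=
  {τ | (∃ x y, l ≤ y ∧ τ = Tri.up x y) ∨ ∃ x y, l < y ∧ τ = Tri.down x y}

theorem up_mem_aboveLine {l x y : ℤ} : Tri.up x y ∈ aboveLine l ↔ l ≤ y := by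
  simp [aboveLine]

theorem down_mem_aboveLine {l x y : ℤ} : Tri.down x y ∈ aboveLine l ↔ l < y := by
  simp [aboveLine]

theorem tilingCount_split {R : Set Tri} (hR : R.Finite) (l : ℤ) {X : Finset ℤ}
    (hX : ∀ x, x ∈ X ↔ Tri.up x l ∈ R ∧ Tri.down x l ∈ R) :
    tilingCount R = ∑ Z ∈ X.powerset,
      tilingCount ((R ∩ aboveLine l) \ dents Z l) *
        tilingCount ((R \ aboveLine l) \ {τ | ∃ x ∈ Z, τ = Tri.down x l}) := by
  conv_lhs => rw [← Set.inter_union_sdiff R (aboveLine l)]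
  refine tilingCount_union (hR.subset Set.inter_subset_left) (hR.subset Set.sdiff_subset)
    (Set.disjoint_sdiff_right.mono_left Set.inter_subset_right) l X ?_ ?_
  · intro x hx
    have := (hX x).1 hx
    exact ⟨⟨this.1, up_mem_aboveLine.2 le_rfl⟩, this.2,
      fun h => absurd (down_mem_aboveLine.1 h) (lt_irrefl _)⟩
  · rintro s ⟨x, y, rfl | rfl | rfl⟩ hs <;>
      rw [Set.inter_union_sdiff, Set.insert_subset_iff, Set.singleton_subset_iff] at hs <;>
      simp only [Set.insert_subset_iff, Set.singleton_subset_iff, Set.mem_inter_iff,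
        Set.mem_sdiff, up_mem_aboveLine, down_mem_aboveLine, hs, true_and]
    · by_cases hy : y = l
      · subst hy
        exact Or.inr (Or.inr ⟨x, (hX x).2 hs, rfl⟩)
      · omega
    · omega
    · omega

theorem tilingCount_preimage_reflect (R : Set Tri) :
    tilingCount (Tri.reflect ⁻¹' R) = tilingCount R := by
  rw [← tilingCount_reflect (Tri.reflect ⁻¹' R),
    Set.image_preimage_eq _ Tri.reflect_involutive.surjective]

theorem up_mem_preimage_reflect {R : Set Tri} {x y : ℤ} :
    Tri.up x y ∈ Tri.reflect ⁻¹' R ↔ Tri.down (x + y) (-y) ∈ R := Iff.rfl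

theorem down_mem_preimage_reflect {R : Set Tri} {x y : ℤ} :
    Tri.down x y ∈ Tri.reflect ⁻¹' R ↔ Tri.up (x + y) (-y) ∈ R := Iff.rfl

/-- The union of the down-pointing lattice triangles hanging from the line at height `l` that are
given by the positions of their left corners and their side lengths. -/
def downTriangles (Q : Set (ℤ × ℕ)) (l : ℤ) : Set Tri := {τ | ∃ q ∈ Q, τ ∈ downTriangle q.1 l q.2}

theorem preimage_reflect_triangles (Q : Set (ℤ × ℕ)) (l : ℤ) :
    Tri.reflect ⁻¹' triangles ((fun q => (q.1 + l, q.2)) '' Q) (-l) = downTriangles Q l := by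
  ext τ
  constructor
  · rintro ⟨_, ⟨q, hq, rfl⟩, h⟩
    refine ⟨q, hq, ?_⟩
    rcases τ with ⟨x, y⟩ | ⟨x, y⟩
    · simp only [Tri.reflect, down_mem_upTriangle] at h
      rw [up_mem_downTriangle]
      omega
    · simp only [Tri.reflect, up_mem_upTriangle] at h
      rw [down_mem_downTriangle]
      omega
  · rintro ⟨q, hq, h⟩
    refine ⟨_, ⟨q, hq, rfl⟩, ?_⟩
    rcases τ with ⟨x, y⟩ | ⟨x, y⟩
    · rw [up_mem_downTriangle] at h
      simp only [Tri.reflect, down_mem_upTriangle]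
      omega
    · rw [down_mem_downTriangle] at h
      simp only [Tri.reflect, up_mem_upTriangle]
      omega

theorem triangles_insert (q : ℤ × ℕ) (Q : Set (ℤ × ℕ)) (l : ℤ) :
    triangles (insert q Q) l = upTriangle q.1 l q.2 ∪ triangles Q l := by
  ext τ
  simp [triangles]

theorem IsBase.insert {Q : Set (ℤ × ℕ)} {U : Finset ℤ} (h : IsBase Q U) (q : ℤ × ℕ) :
    IsBase (insert q Q) (Finset.Ico q.1 (q.1 + q.2) ∪ U) := by
  intro x
  rw [Finset.mem_union, Finset.mem_Ico, h x]
  simp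

theorem IsBase.card_le {Q : Set (ℤ × ℕ)} {U : Finset ℤ} (h : IsBase Q U) {q : ℤ × ℕ} (hq : q ∈ Q) :
    q.2 ≤ U.card := by
  have : Finset.Ico q.1 (q.1 + q.2) ⊆ U := fun x hx => (h x).2 ⟨q, hq, Finset.mem_Ico.1 hx⟩
  have := Finset.card_le_card this
  rw [Int.card_Ico] at this
  omega

theorem up_mem_triangles_iff {Q : Set (ℤ × ℕ)} {U : Finset ℤ} (h : IsBase Q U) {x l : ℤ} :
    Tri.up x l ∈ triangles Q l ↔ x ∈ U := by
  rw [h x]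
  refine exists_congr fun q => and_congr_right fun _ => ?_
  rw [up_mem_upTriangle]
  omega

theorem down_mem_downTriangles_iff {Q : Set (ℤ × ℕ)} {U : Finset ℤ} (h : IsBase Q U) {x l : ℤ} :
    Tri.down x l ∈ downTriangles Q l ↔ x ∈ U := by
  rw [h x]
  refine exists_congr fun q => and_congr_right fun _ => ?_
  rw [down_mem_downTriangle]
  omega

theorem tilingCount_trap_diff_triangles {A : ℤ} {N : ℕ} {y₀ : ℤ} {h : ℕ} {Q : Set (ℤ × ℕ)}
    {U Z : Finset ℤ} (hQU : IsBase Q U) (hU : U ⊆ Finset.Ico A (A + N)) (hQ : ∀ q ∈ Q, q.2 ≤ h)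
    (hZ : Disjoint U Z) :
    tilingCount ((trap A N y₀ h \ triangles Q y₀) \ dents Z y₀) =
      tilingCount (trap A N y₀ h \ dents (U ∪ Z) y₀) := by
  have h1 : (trap A N y₀ h \ triangles Q y₀) \ dents Z y₀ =
      (trap A N y₀ h \ dents Z y₀) \ triangles Q y₀ := by
    rw [sdiff_sdiff, sdiff_sdiff, sup_comm]
  have h2 : (trap A N y₀ h \ dents Z y₀) \ dents U y₀ = trap A N y₀ h \ dents (U ∪ Z) y₀ := by
    rw [sdiff_sdiff]
    congr 1
    ext τ
    simp only [dents, Finset.mem_union, Set.mem_ofPred_eq, Set.sup_eq_union, Set.mem_union]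
    constructor
    · rintro (⟨x, hx, rfl⟩ | ⟨x, hx, rfl⟩)
      exacts [⟨x, Or.inr hx, rfl⟩, ⟨x, Or.inl hx, rfl⟩]
    · rintro ⟨x, hx | hx, rfl⟩
      exacts [Or.inr ⟨x, hx, rfl⟩, Or.inl ⟨x, hx, rfl⟩]
  rw [h1, tilingCount_diff_triangles hQU, h2]
  rintro τ ⟨q, hq, hτ⟩
  have hqU : ∀ x, q.1 ≤ x → x < q.1 + q.2 → A ≤ x ∧ x < A + N := fun x h1 h2 =>
    Finset.mem_Ico.1 (hU ((hQU x).2 ⟨q, hq, h1, h2⟩))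
  have hqh := hQ q hq
  rcases τ with ⟨x, y⟩ | ⟨x, y⟩
  · refine ⟨?_, fun h' => ?_⟩
    · rw [up_mem_upTriangle] at hτ
      rw [up_mem_trap]
      have h1 := hqU q.1 le_rfl (by omega)
      have h2 := hqU (q.1 + q.2 - 1) (by omega) (by omega)
      omega
    · obtain ⟨hx, rfl⟩ := up_mem_dents.1 h'
      exact Finset.disjoint_left.1 hZ ((up_mem_triangles_iff hQU).1 ⟨q, hq, hτ⟩) hx
  · refine ⟨?_, down_notMem_dents⟩
    rw [down_mem_upTriangle] at hτ
    rw [down_mem_trap]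
    have h1 := hqU q.1 le_rfl (by omega)
    have h2 := hqU (q.1 + q.2 - 1) (by omega) (by omega)
    omega

theorem up_mem_hexagon {a b c k : ℕ} {x y : ℤ} : Tri.up x y ∈ hexagon a b c k ↔
    0 ≤ y ∧ y + 1 ≤ b + c + k ∧ -b ≤ x ∧ x + 1 ≤ a + k ∧ 0 ≤ x + y ∧ x + y + 1 ≤ a + c + k := by
  simp only [hexagon, up_mem_regionOf, Set.mem_ofPred_eq]
  omega

theorem down_mem_hexagon {a b c k : ℕ} {x y : ℤ} : Tri.down x y ∈ hexagon a b c k ↔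
    1 ≤ y ∧ y ≤ b + c + k ∧ -b ≤ x ∧ x + 1 ≤ a + k ∧ 0 ≤ x + y ∧ x + y + 1 ≤ a + c + k := by
  simp only [hexagon, down_mem_regionOf, Set.mem_ofPred_eq]
  omega

theorem finite_hexagon (a b c k : ℕ) : (hexagon a b c k).Finite := by
  refine finite_regionOf (((Set.finite_Icc (-(b : ℤ)) (a + k)).prod
    (Set.finite_Icc (0 : ℤ) (b + c + k))).subset ?_)
  rintro ⟨x, y⟩ hP
  simp only [Set.mem_ofPred_eq] at hP
  simp only [Set.mem_prod, Set.mem_Icc]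
  omega

/-- The unit segments of the `l`-th line of the hexagon. -/
noncomputable def lineSegs (a b c k l : ℕ) : Finset ℤ :=
  Finset.Ico (lineLeft b l) (lineLeft b l + lineLength a b c k l)

/-- The segments by which the `l`-th line has to be extended to become the bottom side of a
trapezoid that contains the part of the hexagon above the line. -/
noncomputable def extUp (a b c k l : ℕ) : Finset ℤ :=
  Finset.Ico (a + k : ℤ) (a + k + (c - l : ℕ)) ∪ Finset.Ico (-b : ℤ) (-b + (b - l : ℕ))

/-- The segments by which the `l`-th line has to be extended to become the top side of a
trapezoid that contains the part of the hexagon below the line. -/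
noncomputable def extDown (a b c k l : ℕ) : Finset ℤ :=
  Finset.Ico (a + c + k - l : ℤ) (a + c + k - l + (l - c : ℕ)) ∪
    Finset.Ico (-l : ℤ) (-l + (l - b : ℕ))

/-- The part of the hexagon above the line is a trapezoid from which one lattice triangle at each end
of its bottom side is removed. -/
theorem upper_part {a b c k l hu : ℕ} (hhu : hu + l = b + c + k)
    (Qu Qd : Set (ℤ × ℕ)) :
    (hexagon a b c k \ (triangles Qu l ∪ downTriangles Qd l)) ∩ aboveLine l =
      trap (-b) (a + hu) l hu \
        triangles (insert ((a + k : ℤ), c - l) (insert ((-b : ℤ), b - l) Qu)) l := by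
  ext τ
  rw [triangles_insert, triangles_insert]
  rcases τ with ⟨x, y⟩ | ⟨x, y⟩
  · have h1 : Tri.up x y ∈ downTriangles Qd l → y + 1 ≤ l := by
      rintro ⟨q, -, hq⟩
      exact (up_mem_downTriangle.1 hq).2.1
    by_cases h2 : Tri.up x y ∈ triangles Qu l
    · simp [h2]
    · by_cases h3 : Tri.up x y ∈ downTriangles Qd l
      · have := h1 h3
        simp only [Set.mem_inter_iff, Set.mem_sdiff, Set.mem_union, h2, h3, up_mem_aboveLine,
          up_mem_trap]
        omega
      · simp only [Set.mem_inter_iff, Set.mem_sdiff, Set.mem_union, h2, h3, up_mem_aboveLine,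
          up_mem_trap, up_mem_hexagon, up_mem_upTriangle, or_false, not_false_eq_true, and_true]
        push_cast
        omega
  · have h1 : Tri.down x y ∈ downTriangles Qd l → y ≤ l := by
      rintro ⟨q, -, hq⟩
      exact (down_mem_downTriangle.1 hq).2.1
    by_cases h2 : Tri.down x y ∈ triangles Qu l
    · simp [h2]
    · by_cases h3 : Tri.down x y ∈ downTriangles Qd l
      · have := h1 h3
        simp only [Set.mem_inter_iff, Set.mem_sdiff, Set.mem_union, h2, h3, down_mem_aboveLine,
          down_mem_trap]
        omega
      · simp only [Set.mem_inter_iff, Set.mem_sdiff, Set.mem_union, h2, h3, down_mem_aboveLine,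
          down_mem_trap, down_mem_hexagon, down_mem_upTriangle, or_false, not_false_eq_true,
          and_true]
        push_cast
        omega

/-- The part of the hexagon below the line is, up to reflection, a trapezoid from which one lattice
triangle at each end of its bottom side is removed. -/
theorem lower_part {a b c k l : ℕ} (hl : l ≤ b + c) (Qu Qd : Set (ℤ × ℕ)) :
    (hexagon a b c k \ (triangles Qu l ∪ downTriangles Qd l)) \ aboveLine l =
      Tri.reflect ⁻¹' (trap 0 (a + k + l) (-l) l \
        triangles (insert ((a + c + k : ℤ), l - c) (insert ((0 : ℤ), l - b)
          ((fun q => (q.1 + l, q.2)) '' Qd))) (-l)) := by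
  rw [Set.preimage_sdiff, triangles_insert, triangles_insert, Set.preimage_union,
    Set.preimage_union, preimage_reflect_triangles]
  ext τ
  rcases τ with ⟨x, y⟩ | ⟨x, y⟩
  · have h1 : Tri.up x y ∈ triangles Qu l → l ≤ y := by
      rintro ⟨q, -, hq⟩
      exact (up_mem_upTriangle.1 hq).2.1
    by_cases h2 : Tri.up x y ∈ downTriangles Qd l
    · simp [h2]
    · by_cases h3 : Tri.up x y ∈ triangles Qu l
      · have := h1 h3
        simp only [Set.mem_sdiff, Set.mem_union, h2, h3, up_mem_aboveLine,
          up_mem_preimage_reflect, down_mem_trap]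
        omega
      · simp only [Set.mem_sdiff, Set.mem_union, h2, h3, up_mem_aboveLine, up_mem_hexagon,
          up_mem_preimage_reflect, down_mem_trap, down_mem_upTriangle, or_false,
          not_false_eq_true, and_true]
        push_cast
        omega
  · have h1 : Tri.down x y ∈ triangles Qu l → l < y := by
      rintro ⟨q, -, hq⟩
      have := (down_mem_upTriangle.1 hq).2.1
      omega
    by_cases h2 : Tri.down x y ∈ downTriangles Qd l
    · simp [h2]
    · by_cases h3 : Tri.down x y ∈ triangles Qu l
      · have := h1 h3
        simp only [Set.mem_sdiff, Set.mem_union, h2, h3, down_mem_aboveLine,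
          down_mem_preimage_reflect, up_mem_trap]
        omega
      · simp only [Set.mem_sdiff, Set.mem_union, h2, h3, down_mem_aboveLine, down_mem_hexagon,
          down_mem_preimage_reflect, up_mem_trap, up_mem_upTriangle, or_false,
          not_false_eq_true, and_true]
        push_cast
        omega

theorem vdm_map_add (S : Finset ℤ) (d : ℤ) : vdm (S.map (addRightEmbedding d)) = vdm S := by
  rw [vdm, Finset.prod_map]
  refine Finset.prod_congr rfl fun x _ => ?_
  rw [Finset.filter_map, Finset.prod_map]
  refine Finset.prod_congr ?_ fun y _ => ?_
  · ext y
    simp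
  · simp

theorem vdm_pos (S : Finset ℤ) : 0 < vdm S :=
  Finset.prod_pos fun _ _ => Finset.prod_pos fun _ hy => by
    have := (Finset.mem_filter.1 hy).2
    omega

theorem mem_lineSegs {a b c k l : ℕ} {x : ℤ} : x ∈ lineSegs a b c k l ↔
    -(b : ℤ) ≤ x ∧ -(l : ℤ) ≤ x ∧ x < a + k ∧ x < a + c + k - l := by
  rw [lineSegs, lineLeft, lineLength, Finset.mem_Ico]
  omega

theorem mem_extUp {a b c k l : ℕ} {x : ℤ} : x ∈ extUp a b c k l ↔
    (a + k ≤ x ∧ x < a + k + (c - l : ℕ)) ∨ (-(b : ℤ) ≤ x ∧ x < -b + (b - l : ℕ)) := by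
  rw [extUp, Finset.mem_union, Finset.mem_Ico, Finset.mem_Ico]

theorem mem_extDown {a b c k l : ℕ} {x : ℤ} : x ∈ extDown a b c k l ↔
    (a + c + k - l ≤ x ∧ x < a + c + k - l + (l - c : ℕ)) ∨
      (-(l : ℤ) ≤ x ∧ x < -l + (l - b : ℕ)) := by
  rw [extDown, Finset.mem_union, Finset.mem_Ico, Finset.mem_Ico]

theorem disjoint_extUp_lineSegs (a b c k l : ℕ) :
    Disjoint (extUp a b c k l) (lineSegs a b c k l) := by
  rw [Finset.disjoint_left]
  intro x hx
  rw [mem_lineSegs]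
  rw [mem_extUp] at hx
  omega

theorem disjoint_extDown_lineSegs (a b c k l : ℕ) :
    Disjoint (extDown a b c k l) (lineSegs a b c k l) := by
  rw [Finset.disjoint_left]
  intro x hx
  rw [mem_lineSegs]
  rw [mem_extDown] at hx
  omega

theorem card_extUp (a b c k l : ℕ) : (extUp a b c k l).card = (c - l) + (b - l) := by
  rw [extUp, Finset.card_union_of_disjoint, Int.card_Ico, Int.card_Ico]
  · omega
  · rw [Finset.disjoint_left]
    intro x h h'
    rw [Finset.mem_Ico] at h h'
    omega

theorem card_extDown {a b c k l : ℕ} (hl : l ≤ b + c) :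
    (extDown a b c k l).card = (l - c) + (l - b) := by
  rw [extDown, Finset.card_union_of_disjoint, Int.card_Ico, Int.card_Ico]
  · omega
  · rw [Finset.disjoint_left]
    intro x h h'
    rw [Finset.mem_Ico] at h h'
    omega

theorem tilingCount_upper_part {a b c k l hu : ℕ} (hhu : hu + l = b + c + k) (hl : l ≤ b + c)
    {Qu Qd : Set (ℤ × ℕ)} {U Z : Finset ℤ} (hQU : IsBase Qu U) (hU : U ⊆ lineSegs a b c k l)
    (hUc : U.card ≤ hu) (hZ : Z ⊆ lineSegs a b c k l) (hUZ : Disjoint U Z)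
    (hZ0 : hu = 0 → Z = ∅) :
    (tilingCount (((hexagon a b c k \ (triangles Qu l ∪ downTriangles Qd l)) ∩
      aboveLine l) \ dents Z l) : ℤ) * hyperfac hu =
      if (c - l) + (b - l) + U.card + Z.card = hu then vdm (extUp a b c k l ∪ U ∪ Z) else 0 := by
  have hb : IsBase (insert ((a + k : ℤ), c - l) (insert ((-b : ℤ), b - l) Qu))
      (extUp a b c k l ∪ U) := by
    have := (hQU.insert ((-b : ℤ), b - l)).insert ((a + k : ℤ), c - l)
    rwa [← Finset.union_assoc] at this
  have hd : Disjoint (extUp a b c k l ∪ U) Z :=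
    Finset.disjoint_union_left.2 ⟨(disjoint_extUp_lineSegs a b c k l).mono_right hZ, hUZ⟩
  have hcard : (extUp a b c k l ∪ U ∪ Z).card = (c - l) + (b - l) + U.card + Z.card := by
    rw [Finset.card_union_of_disjoint hd, Finset.card_union_of_disjoint
      ((disjoint_extUp_lineSegs a b c k l).mono_right hU), card_extUp]
  have hsub : extUp a b c k l ∪ U ∪ Z ⊆ Finset.Ico (-b : ℤ) (-b + (a + hu : ℕ)) := by
    intro x hx
    rw [Finset.mem_union, Finset.mem_union] at hx
    rw [Finset.mem_Ico]
    rcases hx with (h | h) | h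
    · rw [mem_extUp] at h
      omega
    · have := mem_lineSegs.1 (hU h)
      omega
    · have := mem_lineSegs.1 (hZ h)
      omega
  have htrap := tilingCount_trap hu (-b) (a + hu) l _ (by omega) hsub (fun h0 => by
    rw [← Finset.card_eq_zero, hcard, hZ0 h0, Finset.card_empty]
    omega)
  rw [hcard] at htrap
  rw [upper_part hhu, tilingCount_trap_diff_triangles hb (Finset.subset_union_left.trans hsub) ?_
    hd, htrap]
  rintro q (rfl | rfl | hq)
  · dsimp only
    omega
  · dsimp only
    omega
  · exact (hQU.card_le hq).trans hUc

theorem tilingCount_lower_part {a b c k l : ℕ} (hl : l ≤ b + c)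
    {Qu Qd : Set (ℤ × ℕ)} {D Z : Finset ℤ} (hQD : IsBase Qd D) (hD : D ⊆ lineSegs a b c k l)
    (hDc : D.card ≤ l) (hZ : Z ⊆ lineSegs a b c k l) (hDZ : Disjoint D Z) (hZ0 : l = 0 → Z = ∅) :
    (tilingCount (((hexagon a b c k \ (triangles Qu l ∪ downTriangles Qd l)) \
      aboveLine l) \ {τ | ∃ x ∈ Z, τ = Tri.down x l}) : ℤ) * hyperfac l =
      if (l - c) + (l - b) + D.card + Z.card = l then vdm (extDown a b c k l ∪ D ∪ Z) else 0 := by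
  have hb : IsBase (insert ((a + c + k : ℤ), l - c) (insert ((0 : ℤ), l - b)
      ((fun q => (q.1 + l, q.2)) '' Qd)))
      ((extDown a b c k l ∪ D).map (addRightEmbedding (l : ℤ))) := by
    intro x
    simp only [Set.mem_insert_iff, Set.mem_image, exists_eq_or_imp, Finset.mem_map,
      addRightEmbedding_apply, Finset.mem_union, mem_extDown]
    constructor
    · rintro ⟨z, (h | h) | h, rfl⟩
      · left
        omega
      · right; left
        omega
      · right; right
        obtain ⟨q, hq, h⟩ := (hQD z).1 h
        exact ⟨_, ⟨q, hq, rfl⟩, by dsimp only; omega⟩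
    · rintro (h | h | ⟨_, ⟨q, hq, rfl⟩, h⟩)
      · exact ⟨x - l, by omega, by omega⟩
      · exact ⟨x - l, by omega, by omega⟩
      · refine ⟨x - l, Or.inr ((hQD _).2 ⟨q, hq, ?_⟩), by omega⟩
        dsimp only at h
        omega
  have hd : Disjoint (extDown a b c k l ∪ D) Z :=
    Finset.disjoint_union_left.2 ⟨(disjoint_extDown_lineSegs a b c k l).mono_right hZ, hDZ⟩
  have hcard : (extDown a b c k l ∪ D ∪ Z).card = (l - c) + (l - b) + D.card + Z.card := by
    rw [Finset.card_union_of_disjoint hd, Finset.card_union_of_disjoint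
      ((disjoint_extDown_lineSegs a b c k l).mono_right hD), card_extDown hl]
  have hsub : (extDown a b c k l ∪ D ∪ Z).map (addRightEmbedding (l : ℤ)) ⊆
      Finset.Ico (0 : ℤ) (0 + (a + k + l : ℕ)) := by
    intro x hx
    obtain ⟨z, hz, rfl⟩ := Finset.mem_map.1 hx
    rw [Finset.mem_union, Finset.mem_union] at hz
    rw [Finset.mem_Ico, addRightEmbedding_apply]
    rcases hz with (h | h) | h
    · rw [mem_extDown] at h
      omega
    · have := mem_lineSegs.1 (hD h)
      omega
    · have := mem_lineSegs.1 (hZ h)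
      omega
  have hlow : (Tri.reflect ⁻¹' (trap 0 (a + k + l) (-l) l \
        triangles (insert ((a + c + k : ℤ), l - c) (insert ((0 : ℤ), l - b)
          ((fun q => (q.1 + l, q.2)) '' Qd))) (-l))) \ {τ | ∃ x ∈ Z, τ = Tri.down x l} =
      Tri.reflect ⁻¹' ((trap 0 (a + k + l) (-l) l \
        triangles (insert ((a + c + k : ℤ), l - c) (insert ((0 : ℤ), l - b)
          ((fun q => (q.1 + l, q.2)) '' Qd))) (-l)) \
        dents (Z.map (addRightEmbedding (l : ℤ))) (-l)) := by
    conv_rhs => rw [Set.preimage_sdiff]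
    congr 1
    ext τ
    rcases τ with ⟨x, y⟩ | ⟨x, y⟩
    · exact iff_of_false (by simp) fun h => down_notMem_dents h
    · rw [down_mem_preimage_reflect, up_mem_dents]
      simp only [Set.mem_ofPred_eq, Tri.down.injEq, Finset.mem_map, addRightEmbedding_apply]
      constructor
      · rintro ⟨z, hz, rfl, rfl⟩
        exact ⟨⟨x, hz, rfl⟩, rfl⟩
      · rintro ⟨⟨z, hz, h⟩, h'⟩
        exact ⟨z, hz, by omega, by omega⟩
  have htrap := tilingCount_trap l 0 (a + k + l) (-l) _ (by omega) hsub (fun h0 => by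
    rw [← Finset.card_eq_zero, Finset.card_map, hcard, hZ0 h0, Finset.card_empty]
    omega)
  rw [Finset.card_map, hcard, vdm_map_add, Finset.map_union] at htrap
  rw [lower_part hl, hlow, tilingCount_preimage_reflect, tilingCount_trap_diff_triangles hb
    ((Finset.map_subset_map.2 Finset.subset_union_left).trans hsub) ?_
    ((Finset.disjoint_map _).2 hd), htrap]
  rintro q (rfl | rfl | ⟨q, hq, rfl⟩)
  · dsimp only
    omega
  · dsimp only
    omega
  · exact (hQD.card_le hq).trans hDc

/-- The number of tilings of a hexagon with holes along the `l`-th line, as a sum over the sets `Z`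
of free segments that are crossed by vertical lozenges. -/
theorem tilingCount_hexagon_diff {a b c k l hu n w : ℕ} (hhu : hu + l = b + c + k)
    (h3 : (n : ℤ) + w ≤ min (b : ℤ) (min (l : ℤ) ((b : ℤ) + c - l)))
    {Qu Qd : Set (ℤ × ℕ)} {U D : Finset ℤ} (hQU : IsBase Qu U) (hQD : IsBase Qd D)
    (hU : U ⊆ lineSegs a b c k l) (hD : D ⊆ lineSegs a b c k l)
    (hUc : U.card = n + k + w) (hDc : D.card = n + w) :
    (tilingCount (hexagon a b c k \ (triangles Qu l ∪ downTriangles Qd l)) : ℤ) *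
        (hyperfac hu * hyperfac l) =
      ∑ Z ∈ (lineSegs a b c k l \ (U ∪ D)).powerset with
          (Z.card : ℤ) = min (b : ℤ) l + min (c : ℤ) l - l - n - w,
        vdm (extUp a b c k l ∪ U ∪ Z) * vdm (extDown a b c k l ∪ D ∪ Z) := by
  classical
  have hl : l ≤ b + c := by omega
  set X : Finset ℤ := if hu = 0 ∨ l = 0 then ∅ else lineSegs a b c k l \ (U ∪ D) with hXdef
  have hXsub : X ⊆ lineSegs a b c k l \ (U ∪ D) := by
    rw [hXdef]
    split_ifs
    exacts [Finset.empty_subset _, le_rfl]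
  have hX : ∀ x, x ∈ X ↔
      Tri.up x l ∈ hexagon a b c k \ (triangles Qu l ∪ downTriangles Qd l) ∧
        Tri.down x l ∈ hexagon a b c k \ (triangles Qu l ∪ downTriangles Qd l) := by
    intro x
    have h1 : Tri.up x l ∉ downTriangles Qd l := by
      rintro ⟨q, -, hq⟩
      have := (up_mem_downTriangle.1 hq).2.1
      omega
    have h2 : Tri.down x l ∉ triangles Qu l := by
      rintro ⟨q, -, hq⟩
      have := (down_mem_upTriangle.1 hq).2.1
      omega
    simp only [Set.mem_sdiff, Set.mem_union, up_mem_triangles_iff hQU,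
      down_mem_downTriangles_iff hQD, h1, h2, up_mem_hexagon, down_mem_hexagon, or_false, false_or]
    rw [hXdef]
    split_ifs with h0
    · simp only [Finset.notMem_empty, false_iff]
      omega
    · rw [Finset.mem_sdiff, Finset.mem_union, mem_lineSegs]
      by_cases hxU : x ∈ U <;> by_cases hxD : x ∈ D <;>
        simp only [hxU, hxD, or_self, or_true, true_or, not_true_eq_false, not_false_eq_true,
          and_false, false_and, and_true]
      omega
  rw [tilingCount_split ((finite_hexagon a b c k).subset Set.sdiff_subset) l hX, Nat.cast_sum,
    Finset.sum_mul]
  refine (Finset.sum_congr rfl (g := fun Z : Finset ℤ =>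
    if (Z.card : ℤ) = min (b : ℤ) l + min (c : ℤ) l - l - n - w then
      vdm (extUp a b c k l ∪ U ∪ Z) * vdm (extDown a b c k l ∪ D ∪ Z) else 0)
    fun Z hZ => ?_).trans ?_
  · rw [Finset.mem_powerset] at hZ
    have hZs := hZ.trans hXsub
    have hZL := hZs.trans Finset.sdiff_subset
    have hdisj : Disjoint (U ∪ D) Z := Finset.disjoint_sdiff.mono_right hZs
    rw [Finset.disjoint_union_left] at hdisj
    have hZ0 : hu = 0 ∨ l = 0 → Z = ∅ := by
      intro h0
      rwa [hXdef, if_pos h0, Finset.subset_empty] at hZ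
    have e1 := tilingCount_upper_part (Qd := Qd) hhu hl hQU hU (by omega) hZL hdisj.1
      fun h0 => hZ0 (Or.inl h0)
    have e2 := tilingCount_lower_part (Qu := Qu) hl hQD hD (by omega) hZL hdisj.2
      fun h0 => hZ0 (Or.inr h0)
    refine (congrArg (· * _) (Nat.cast_mul _ _)).trans ((mul_mul_mul_comm _ _ _ _).trans ?_)
    rw [e1, e2]
    by_cases hz : (Z.card : ℤ) = min (b : ℤ) l + min (c : ℤ) l - l - n - w
    · rw [if_pos hz, if_pos (by omega), if_pos (by omega)]
    · rw [if_neg hz, if_neg (by omega), zero_mul]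
  rw [← Finset.sum_filter]
  refine Finset.sum_congr (Finset.ext fun Z => ?_) fun _ _ => rfl
  rw [Finset.mem_filter, Finset.mem_filter, Finset.mem_powerset, Finset.mem_powerset]
  refine and_congr_left fun hz => ⟨fun h => h.trans hXsub, fun h => ?_⟩
  -- If one of the two halves is empty, then no lozenge crosses the line.
  by_cases h0 : hu = 0 ∨ l = 0
  · have : Z = ∅ := by
      rw [← Finset.card_eq_zero]
      omega
    rw [this]
    exact Finset.empty_subset _
  · rwa [hXdef, if_neg h0]

/-! ### Separating the holes from the rest of a Vandermonde product -/

/-- The product of the distances between the elements of `A` and those of `B`. -/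
def cross (A B : Finset ℤ) : ℤ := ∏ x ∈ A, ∏ y ∈ B, |x - y|

theorem vdm_union {A B : Finset ℤ} (h : Disjoint A B) :
    vdm (A ∪ B) = vdm A * vdm B * cross A B := by
  have hcross : cross A B = (∏ x ∈ A, ∏ y ∈ B with x < y, (y - x)) *
      ∏ x ∈ B, ∏ y ∈ A with x < y, (y - x) := by
    simp_rw [Finset.prod_filter]
    rw [Finset.prod_comm (s := B), ← Finset.prod_mul_distrib, cross]
    refine Finset.prod_congr rfl fun x hx => ?_
    rw [← Finset.prod_mul_distrib]
    refine Finset.prod_congr rfl fun y hy => ?_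
    have hne : x ≠ y := fun hxy => Finset.disjoint_left.1 h hx (hxy ▸ hy)
    rcases lt_or_gt_of_ne hne with hlt | hlt
    · rw [if_pos hlt, if_neg (by omega), abs_of_neg (by omega)]
      ring
    · rw [if_neg (by omega), if_pos hlt, abs_of_pos (by omega)]
      ring
  have hsplit : ∀ x, ∏ y ∈ A ∪ B with x < y, (y - x) =
      (∏ y ∈ A with x < y, (y - x)) * ∏ y ∈ B with x < y, (y - x) := fun x => by
    rw [Finset.filter_union, Finset.prod_union (Finset.disjoint_filter_filter h)]
  rw [vdm, Finset.prod_union h]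
  simp_rw [hsplit]
  rw [Finset.prod_mul_distrib, Finset.prod_mul_distrib, hcross, vdm, vdm]
  ring

theorem cross_union_left {A B C : Finset ℤ} (h : Disjoint A B) :
    cross (A ∪ B) C = cross A C * cross B C :=
  Finset.prod_union h

theorem cross_union_right {A B C : Finset ℤ} (h : Disjoint B C) :
    cross A (B ∪ C) = cross A B * cross A C := by
  rw [cross, cross, cross, ← Finset.prod_mul_distrib]
  exact Finset.prod_congr rfl fun x _ => Finset.prod_union h

theorem cross_pos {A B : Finset ℤ} (h : Disjoint A B) : 0 < cross A B :=
  Finset.prod_pos fun x hx => Finset.prod_pos fun y hy =>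
    abs_pos.2 fun hxy => Finset.disjoint_left.1 h hx (by rwa [sub_eq_zero.1 hxy])

/-- The contribution of the triangular holes on `X` (above the line) and `X'` (below the line)
splits off; the rest depends only on the union of `X` and `X'`. -/
theorem vdm_mul_vdm {E E' X X' W Z : Finset ℤ} (hX : Disjoint X X')
    (hXW : Disjoint X W) (hXW' : Disjoint X' W) (hE : Disjoint E (X ∪ W ∪ Z))
    (hE' : Disjoint E' (X' ∪ W ∪ Z)) (hZ : Disjoint (X ∪ X' ∪ W) Z) :
    vdm (E ∪ (X ∪ W) ∪ Z) * vdm (E' ∪ (X' ∪ W) ∪ Z) =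
      (vdm X * vdm X' * (cross X E * cross X' E')) *
        (vdm (E ∪ (W ∪ Z)) * vdm (E' ∪ (W ∪ Z)) * cross (X ∪ X') (W ∪ Z)) := by
  have key : ∀ {E X : Finset ℤ}, Disjoint X W → Disjoint E (X ∪ W ∪ Z) → Disjoint X Z →
      vdm (E ∪ (X ∪ W) ∪ Z) = vdm X * cross X E * (vdm (E ∪ (W ∪ Z)) * cross X (W ∪ Z)) := by
    intro E X hXW hE hZ
    rw [Finset.union_assoc, Finset.disjoint_union_right] at hE
    have h1 : E ∪ (X ∪ W) ∪ Z = X ∪ (E ∪ (W ∪ Z)) := by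
      ext x
      simp only [Finset.mem_union]
      tauto
    rw [h1, vdm_union (Finset.disjoint_union_right.2
      ⟨hE.1.symm, Finset.disjoint_union_right.2 ⟨hXW, hZ⟩⟩), cross_union_right hE.2]
    ring
  rw [Finset.disjoint_union_left, Finset.disjoint_union_left] at hZ
  rw [key hXW hE hZ.1.1, key hXW' hE' hZ.1.2, cross_union_left hX]
  ring

/-! ### Factorials of distances -/

theorem prod_Ico_sub_left {u v x : ℤ} (huv : u ≤ v) (hvx : v ≤ x) :
    (∏ e ∈ Finset.Ico u v, |x - e|) * ((x - v).toNat.factorial : ℤ) = (x - u).toNat.factorial := by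
  induction v, huv using Int.leInduction with
  | base => simp
  | succ v huv ih =>
    have : Finset.Ico u (v + 1) = insert v (Finset.Ico u v) := by
      ext z
      simp only [Finset.mem_Ico, Finset.mem_insert]
      omega
    rw [this, Finset.prod_insert (by simp), ← ih (by omega)]
    obtain ⟨d, hd⟩ : ∃ d : ℕ, x - v = d + 1 := ⟨(x - v - 1).toNat, by omega⟩
    have h1 : (x - (v + 1)).toNat = d := by omega
    have h2 : (x - v).toNat = d + 1 := by omega
    rw [h1, h2, hd, Nat.factorial_succ, abs_of_nonneg (by omega)]
    push_cast
    ring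

theorem prod_Ico_sub_right {u v x : ℤ} (huv : u ≤ v) (hxu : x < u) :
    (∏ e ∈ Finset.Ico u v, |x - e|) * ((u - 1 - x).toNat.factorial : ℤ) =
      (v - 1 - x).toNat.factorial := by
  induction v, huv using Int.leInduction with
  | base => simp
  | succ v huv ih =>
    have : Finset.Ico u (v + 1) = insert v (Finset.Ico u v) := by
      ext z
      simp only [Finset.mem_Ico, Finset.mem_insert]
      omega
    rw [this, Finset.prod_insert (by simp), mul_assoc, ih]
    obtain ⟨d, hd⟩ : ∃ d : ℕ, v - x = d + 1 := ⟨(v - x - 1).toNat, by omega⟩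
    have h1 : (v + 1 - 1 - x).toNat = d + 1 := by omega
    have h2 : (v - 1 - x).toNat = d := by omega
    rw [h1, h2, Nat.factorial_succ, abs_sub_comm, hd, abs_of_nonneg (by omega)]
    push_cast
    ring

theorem extUp_eq {a b c k l : ℕ} (hl : l ≤ b + c) : extUp a b c k l =
    Finset.Ico (lineLeft b l + lineLength a b c k l) (a + c + k - l) ∪
      Finset.Ico (-b : ℤ) (lineLeft b l) := by
  ext x
  rw [mem_extUp, Finset.mem_union, Finset.mem_Ico, Finset.mem_Ico, lineLeft, lineLength]
  omega

theorem extDown_eq {a b c k l : ℕ} : extDown a b c k l =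
    Finset.Ico (lineLeft b l + lineLength a b c k l) (a + k) ∪
      Finset.Ico (-l : ℤ) (lineLeft b l) := by
  ext x
  rw [mem_extDown, Finset.mem_union, Finset.mem_Ico, Finset.mem_Ico, lineLeft, lineLength]
  omega

/-- The quotient of the products of the distances from the segment `x` to the two extensions of the
line, in terms of the distances to the sides of the hexagon. -/
theorem prod_extDown_div_prod_extUp {a b c k l : ℕ} (hl : l ≤ b + c) {x : ℤ}
    (hx : x ∈ lineSegs a b c k l) :
    ((∏ e ∈ extDown a b c k l, |x - e| : ℤ) : ℚ) / (∏ e ∈ extUp a b c k l, |x - e| : ℤ) =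
      ((x + l).toNat.factorial * (a + k - 1 - x).toNat.factorial : ℚ) /
        ((x + b).toNat.factorial * (a + c + k - l - 1 - x).toNat.factorial) := by
  have hx' := Finset.mem_Ico.1 hx
  have hlen : lineLeft b l + lineLength a b c k l = a + k - l + min (c : ℤ) l := by
    rw [lineLeft, lineLength]
    ring
  have hleft : lineLeft b l = -min (b : ℤ) l := rfl
  have u1 := prod_Ico_sub_left (u := -b) (v := lineLeft b l) (x := x) (by omega) hx'.1
  have u2 := prod_Ico_sub_right (u := lineLeft b l + lineLength a b c k l)
    (v := a + c + k - l) (x := x) (by omega) hx'.2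
  have d1 := prod_Ico_sub_left (u := -l) (v := lineLeft b l) (x := x) (by omega) hx'.1
  have d2 := prod_Ico_sub_right (u := lineLeft b l + lineLength a b c k l)
    (v := a + k) (x := x) (by omega) hx'.2
  have hdisj : ∀ u v : ℤ, Disjoint (Finset.Ico (lineLeft b l + lineLength a b c k l) u)
      (Finset.Ico v (lineLeft b l)) := fun u v => Finset.disjoint_left.2 fun z h h' => by
    rw [Finset.mem_Ico] at h h'
    omega
  rw [sub_neg_eq_add] at u1 d1
  rw [extUp_eq hl, extDown_eq, Finset.prod_union (hdisj _ _), Finset.prod_union (hdisj _ _)]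
  have f1 : ((x - lineLeft b l).toNat.factorial : ℚ) ≠ 0 :=
    Nat.cast_ne_zero.2 (Nat.factorial_ne_zero _)
  have f2 : ((lineLeft b l + lineLength a b c k l - 1 - x).toNat.factorial : ℚ) ≠ 0 :=
    Nat.cast_ne_zero.2 (Nat.factorial_ne_zero _)
  rw [← Int.cast_inj (α := ℚ)] at u1 u2 d1 d2
  simp only [Int.cast_mul, Int.cast_natCast] at u1 u2 d1 d2 ⊢
  rw [← u1, ← u2, ← d1, ← d2, ← mul_div_mul_right _ _ (mul_ne_zero f1 f2)]
  congr 1 <;> ring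

/-! ### Distances in the triangular lattice -/

theorem lineDist_eq {φ : ℤ × ℤ → ℤ} (hφ : ∀ P Q, latticeGraph.Adj P Q → φ P ≤ φ Q + 1)
    (hstep : ∀ x y, φ (x + 1, y) = φ (x, y) + 1) (C : ℤ) (E : ℤ × ℤ) :
    lineDist E {P | φ P = C} = (φ E - C).natAbs := by
  have hlower : ∀ P Q (q : latticeGraph.Walk P Q), (φ P - φ Q).natAbs ≤ q.length := by
    intro P Q q
    induction q with
    | nil => simp
    | cons h q ih =>
      have h1 := hφ _ _ h
      have h2 := hφ _ _ h.symm
      rw [SimpleGraph.Walk.length_cons]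
      omega
  have hadj : ∀ x y : ℤ, latticeGraph.Adj (x, y) (x + 1, y) := by
    intro x y
    rw [latticeGraph, SimpleGraph.fromRel_adj]
    refine ⟨fun h => ?_, Or.inl (Or.inl ?_)⟩
    · have := congrArg Prod.fst h
      simp at this
    · simp
  have hwalk : ∀ (d : ℕ) (x y : ℤ), ∃ q : latticeGraph.Walk (x, y) (x + d, y), q.length = d := by
    intro d
    induction d with
    | zero =>
      intro x y
      exact ⟨SimpleGraph.Walk.nil.copy rfl (by simp), by simp⟩
    | succ d ih =>
      intro x y
      obtain ⟨q, hq⟩ := ih (x + 1) y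
      refine ⟨(SimpleGraph.Walk.cons (hadj x y) q).copy rfl ?_, ?_⟩
      · push_cast
        ring_nf
      · rw [SimpleGraph.Walk.length_copy, SimpleGraph.Walk.length_cons, hq]
  have hstep' : ∀ (d : ℕ) (x y : ℤ), φ (x + d, y) = φ (x, y) + d := by
    intro d
    induction d with
    | zero => simp
    | succ d ih =>
      intro x y
      have := hstep (x + d) y
      rw [ih] at this
      push_cast
      rw [← add_assoc, this]
      ring
  obtain ⟨x, y⟩ := E
  refine le_antisymm (Nat.sInf_le ?_) (le_csInf ?_ ?_)
  · rcases le_total (φ (x, y)) C with h | h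
    · obtain ⟨q, hq⟩ := hwalk (φ (x, y) - C).natAbs x y
      refine ⟨_, ?_, q, hq⟩
      rw [Set.mem_ofPred_eq, hstep']
      omega
    · obtain ⟨q, hq⟩ := hwalk (φ (x, y) - C).natAbs (x - (φ (x, y) - C).natAbs) y
      refine ⟨(x - (φ (x, y) - C).natAbs, y), ?_, (q.copy rfl (by simp)).reverse, by simpa using hq⟩
      have := hstep' (φ (x, y) - C).natAbs (x - (φ (x, y) - C).natAbs) y
      rw [sub_add_cancel] at this
      rw [Set.mem_ofPred_eq]
      omega
  · rcases le_total (φ (x, y)) C with h | h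
    · obtain ⟨q, hq⟩ := hwalk (φ (x, y) - C).natAbs x y
      refine ⟨_, _, ?_, q, hq⟩
      rw [Set.mem_ofPred_eq, hstep']
      omega
    · obtain ⟨q, hq⟩ := hwalk (φ (x, y) - C).natAbs (x - (φ (x, y) - C).natAbs) y
      refine ⟨_, (x - (φ (x, y) - C).natAbs, y), ?_, (q.copy rfl (by simp)).reverse, rfl⟩
      have := hstep' (φ (x, y) - C).natAbs (x - (φ (x, y) - C).natAbs) y
      rw [sub_add_cancel] at this
      rw [Set.mem_ofPred_eq]
      omega
  · rintro d ⟨P, hP, q, rfl⟩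
    have := hlower _ _ q
    have hP' : φ P = C := hP
    rwa [hP'] at this

theorem latticeGraph_adj_iff {P Q : ℤ × ℤ} : latticeGraph.Adj P Q ↔
    ((Q.1 = P.1 + 1 ∧ Q.2 = P.2) ∨ (Q.1 = P.1 ∧ Q.2 = P.2 + 1) ∨
      (Q.1 = P.1 - 1 ∧ Q.2 = P.2 + 1)) ∨
    ((P.1 = Q.1 + 1 ∧ P.2 = Q.2) ∨ (P.1 = Q.1 ∧ P.2 = Q.2 + 1) ∨
      (P.1 = Q.1 - 1 ∧ P.2 = Q.2 + 1)) := by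
  rw [latticeGraph, SimpleGraph.fromRel_adj]
  simp only [Prod.ext_iff, Prod.fst_add, Prod.snd_add, ne_eq]
  omega

theorem lineDist_fst (C : ℤ) (E : ℤ × ℤ) : lineDist E {P | P.1 = C} = (E.1 - C).natAbs :=
  lineDist_eq (φ := fun P => P.1)
    (fun P Q h => by
      rw [latticeGraph_adj_iff] at h
      omega) (fun _ _ => rfl) C E

theorem lineDist_add (C : ℤ) (E : ℤ × ℤ) :
    lineDist E {P | P.1 + P.2 = C} = (E.1 + E.2 - C).natAbs :=
  lineDist_eq (φ := fun P => P.1 + P.2)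
    (fun P Q h => by
      rw [latticeGraph_adj_iff] at h
      omega) (fun x y => by dsimp only; ring) C E

/-- The function on the points of the `l`-th line whose quotients are the `distQuot`. -/
noncomputable def distWeight (a b c k l : ℕ) (x : ℤ) : ℚ :=
  (hyperfac (dSW (x, l)) * hyperfac (dNE a c k (x, l))) /
    (hyperfac (dNW b (x, l)) * hyperfac (dSE a k (x, l)))

theorem hyperfac_ne_zero (n : ℕ) : (hyperfac n : ℚ) ≠ 0 :=
  Nat.cast_ne_zero.2 (Finset.prod_ne_zero_iff.2 fun _ _ => Nat.factorial_ne_zero _)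

theorem distWeight_ne_zero (a b c k l : ℕ) (x : ℤ) : distWeight a b c k l x ≠ 0 :=
  div_ne_zero (mul_ne_zero (hyperfac_ne_zero _) (hyperfac_ne_zero _))
    (mul_ne_zero (hyperfac_ne_zero _) (hyperfac_ne_zero _))

theorem distQuot_eq (a b c k l : ℕ) (x y : ℤ) : distQuot a b c k (x, l) (y, l) =
    distWeight a b c k l y / distWeight a b c k l x := by
  rw [distQuot, distWeight, distWeight, div_div_div_eq]
  congr 1 <;> ring

theorem distWeight_add_one {a b c k l : ℕ} (hl : l ≤ b + c) {x : ℤ}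
    (hx : x ∈ lineSegs a b c k l) :
    distWeight a b c k l (x + 1) / distWeight a b c k l x =
      ((∏ e ∈ extDown a b c k l, |x - e| : ℤ) : ℚ) / (∏ e ∈ extUp a b c k l, |x - e| : ℤ) := by
  rw [prod_extDown_div_prod_extUp hl hx]
  rw [mem_lineSegs] at hx
  obtain ⟨d₁, h1⟩ : ∃ d : ℕ, x + l = d := ⟨(x + l).toNat, by omega⟩
  obtain ⟨d₂, h2⟩ : ∃ d : ℕ, x + b = d := ⟨(x + b).toNat, by omega⟩
  obtain ⟨d₃, h3⟩ : ∃ d : ℕ, a + k - 1 - x = d := ⟨(a + k - 1 - x).toNat, by omega⟩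
  obtain ⟨d₄, h4⟩ : ∃ d : ℕ, a + c + k - l - 1 - x = d :=
    ⟨(a + c + k - l - 1 - x).toNat, by omega⟩
  have e1 : dSW (x, l) = d₁ := by
    rw [dSW, lineDist_add]
    dsimp only
    omega
  have e1' : dSW (x + 1, l) = d₁ + 1 := by
    rw [dSW, lineDist_add]
    dsimp only
    omega
  have e2 : dNW b (x, l) = d₂ := by
    rw [dNW, lineDist_fst]
    dsimp only
    omega
  have e2' : dNW b (x + 1, l) = d₂ + 1 := by
    rw [dNW, lineDist_fst]
    dsimp only
    omega
  have e3 : dSE a k (x, l) = d₃ + 1 := by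
    rw [dSE, lineDist_fst]
    dsimp only
    omega
  have e3' : dSE a k (x + 1, l) = d₃ := by
    rw [dSE, lineDist_fst]
    dsimp only
    omega
  have e4 : dNE a c k (x, l) = d₄ + 1 := by
    rw [dNE, lineDist_add]
    dsimp only
    omega
  have e4' : dNE a c k (x + 1, l) = d₄ := by
    rw [dNE, lineDist_add]
    dsimp only
    omega
  have H := hyperfac_ne_zero
  have Fa : ∀ n : ℕ, (n.factorial : ℚ) ≠ 0 := fun n => Nat.cast_ne_zero.2 n.factorial_ne_zero
  rw [distWeight, distWeight, e1, e1', e2, e2', e3, e3', e4, e4', h1, h2, h3, h4]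
  simp only [hyperfac_succ, Nat.cast_mul, Int.toNat_natCast]
  have := H d₁
  have := H d₂
  have := H d₃
  have := H d₄
  have := Fa d₁
  have := Fa d₂
  have := Fa d₃
  have := Fa d₄
  field_simp

/-! ### Combinatorics of codes -/

namespace Code

variable (C : Code)

theorem left_zero : C.left 0 = 0 :=
  Finset.sum_eq_zero fun _ hi => absurd (Finset.mem_filter.1 hi).2 (Fin.not_lt_zero _)

theorem left_succ (i : Fin C.r) : C.left i.succ = C.right i.castSucc + C.w i := by
  have : (Finset.univ.filter fun i' : Fin C.r => i'.castSucc < i.succ) =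
      insert i (Finset.univ.filter fun i' : Fin C.r => i'.castSucc < i.castSucc) := by
    ext i'
    simp only [Finset.mem_filter, Finset.mem_univ, true_and, Finset.mem_insert, Fin.lt_def,
      Fin.ext_iff, Fin.val_castSucc, Fin.val_succ]
    omega
  rw [left, this, Finset.sum_insert (by simp), right, left]
  ring

theorem left_le_right (j : Fin (C.r + 1)) : C.left j ≤ C.right j := Nat.le_add_right _ _

theorem left_mono : Monotone C.left := Fin.monotone_iff_le_succ.2 fun i => by
  rw [left_succ]
  exact (C.left_le_right _).trans (Nat.le_add_right _ _)

theorem right_add_w_le_left {i : Fin C.r} {j : Fin (C.r + 1)} (h : i.castSucc < j) :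
    C.right i.castSucc + C.w i ≤ C.left j := by
  rw [← left_succ]
  refine C.left_mono ?_
  rw [Fin.le_def, Fin.val_succ]
  exact h

theorem right_le_left {j j' : Fin (C.r + 1)} (h : j < j') : C.right j ≤ C.left j' := by
  obtain ⟨i, rfl⟩ : ∃ i : Fin C.r, i.castSucc = j :=
    Fin.exists_castSucc_eq.2 (ne_of_lt (h.trans_le (Fin.le_last _)))
  exact (Nat.le_add_right _ _).trans (C.right_add_w_le_left h)

theorem right_last : C.right (Fin.last C.r) = C.len := by
  rw [right, len, left, Fin.sum_univ_castSucc, Finset.filter_true_of_mem fun i _ =>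
    Fin.castSucc_lt_last i, Finset.sum_add_distrib]
  ring

theorem right_le_len (j : Fin (C.r + 1)) : C.right j ≤ C.len := by
  rw [← right_last]
  rcases (Fin.le_last j).eq_or_lt with rfl | h
  · rfl
  · exact (C.right_le_left h).trans (C.left_le_right _)

/-- The segments of the `j`-th block of unit triangles. -/
def block (j : Fin (C.r + 1)) : Finset ℕ := Finset.Ico (C.left j) (C.right j)

theorem card_block (j : Fin (C.r + 1)) : (C.block j).card = (C.a j).natAbs := by
  rw [block, Nat.card_Ico, right, Nat.add_sub_cancel_left]

theorem disjoint_block {j j' : Fin (C.r + 1)} (h : j ≠ j') : Disjoint (C.block j) (C.block j') := by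
  rw [Finset.disjoint_left]
  intro s hs hs'
  rw [block, Finset.mem_Ico] at hs hs'
  rcases lt_or_gt_of_ne h with h | h <;> have := C.right_le_left h <;> omega

theorem disjoint_block_biUnion {I J : Finset (Fin (C.r + 1))} (h : Disjoint I J) :
    Disjoint (I.biUnion C.block) (J.biUnion C.block) := by
  rw [Finset.disjoint_biUnion_left]
  intro j hj
  rw [Finset.disjoint_biUnion_right]
  exact fun j' hj' => C.disjoint_block fun hjj' => Finset.disjoint_left.1 h hj (hjj' ▸ hj')

theorem card_block_biUnion (I : Finset (Fin (C.r + 1))) :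
    (I.biUnion C.block).card = ∑ j ∈ I, (C.a j).natAbs := by
  rw [Finset.card_biUnion fun j _ j' _ h => C.disjoint_block h]
  exact Finset.sum_congr rfl fun j _ => C.card_block j

theorem upSeg_eq : C.upSeg = (Finset.univ.filter fun j => 0 < C.a j).biUnion C.block := rfl

theorem downSeg_eq : C.downSeg = (Finset.univ.filter fun j => C.a j < 0).biUnion C.block := rfl

theorem card_upSeg : C.upSeg.card = C.p := C.card_block_biUnion _

theorem card_downSeg : C.downSeg.card = C.n := C.card_block_biUnion _

theorem disjoint_upSeg_downSeg : Disjoint C.upSeg C.downSeg :=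
  C.disjoint_block_biUnion (Finset.disjoint_filter.2 fun _ _ h h' => by omega)

theorem upSeg_union_downSeg : C.upSeg ∪ C.downSeg = Finset.univ.biUnion C.block := by
  ext s
  simp only [upSeg_eq, downSeg_eq, Finset.mem_union, Finset.mem_biUnion, Finset.mem_filter,
    Finset.mem_univ, true_and]
  constructor
  · rintro (⟨j, -, h⟩ | ⟨j, -, h⟩) <;> exact ⟨j, h⟩
  · rintro ⟨j, h⟩
    rcases lt_trichotomy (C.a j) 0 with h0 | h0 | h0
    · exact Or.inr ⟨j, h0, h⟩
    · rw [block, Finset.mem_Ico, right, h0] at h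
      simp at h
      omega
    · exact Or.inl ⟨j, h0, h⟩

theorem disjoint_union_lozSeg : Disjoint (C.upSeg ∪ C.downSeg) C.lozSeg := by
  rw [upSeg_union_downSeg, lozSeg, Finset.disjoint_biUnion_left]
  intro j _
  rw [Finset.disjoint_biUnion_right]
  intro i _
  rw [Finset.disjoint_left]
  intro s hs hs'
  rw [block, Finset.mem_Ico] at hs
  rw [Finset.mem_Ico] at hs'
  rcases lt_trichotomy j i.castSucc with h | rfl | h
  · have := C.right_le_left h
    have := C.left_le_right i.castSucc
    omega
  · omega
  · have := C.right_add_w_le_left h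
    omega

theorem card_lozSeg : C.lozSeg.card = C.wSum := by
  rw [lozSeg, Finset.card_biUnion, wSum]
  · refine Finset.sum_congr rfl fun i _ => ?_
    rw [Nat.card_Ico, Nat.add_sub_cancel_left]
  · intro i _ i' _ h
    refine Finset.disjoint_left.2 fun s hs hs' => ?_
    rw [Finset.mem_Ico] at hs hs'
    rcases lt_or_gt_of_ne h with h | h
    · have := C.right_add_w_le_left (Fin.castSucc_lt_castSucc_iff.2 h)
      have := C.left_le_right i'.castSucc
      omega
    · have := C.right_add_w_le_left (Fin.castSucc_lt_castSucc_iff.2 h)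
      have := C.left_le_right i.castSucc
      omega

theorem lozSeg_subset : C.lozSeg ⊆ Finset.range C.len := by
  intro s hs
  obtain ⟨i, -, hs⟩ := Finset.mem_biUnion.1 hs
  have h1 := C.right_add_w_le_left (Fin.castSucc_lt_last i)
  have h2 := C.left_le_right (Fin.last C.r)
  have h3 := C.right_last
  rw [Finset.mem_Ico] at hs
  rw [Finset.mem_range]
  omega

theorem union_subset : C.upSeg ∪ C.downSeg ⊆ Finset.range C.len := by
  intro s hs
  rw [upSeg_union_downSeg] at hs
  obtain ⟨j, -, hs⟩ := Finset.mem_biUnion.1 hs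
  have := C.right_le_len j
  rw [block, Finset.mem_Ico] at hs
  rw [Finset.mem_range]
  omega

theorem len_eq : C.len = C.p + C.n + C.wSum := by
  have := congrArg Finset.card C.upSeg_union_downSeg
  rw [Finset.card_union_of_disjoint C.disjoint_upSeg_downSeg, card_upSeg, card_downSeg,
    card_block_biUnion] at this
  rw [len, this, wSum]

/-- The number of unit triangles in the blocks to the left of the `j`-th one. -/
def before (j : Fin (C.r + 1)) : ℕ := ∑ i with i < j, (C.a i).natAbs

theorem sum_le_eq (j : Fin (C.r + 1)) :
    ∑ i with i ≤ j, (C.a i).natAbs = C.before j + (C.a j).natAbs := by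
  have : (Finset.univ.filter fun i => i ≤ j) = insert j (Finset.univ.filter fun i => i < j) := by
    ext i
    simp [le_iff_eq_or_lt]
  rw [this, Finset.sum_insert (by simp), before, add_comm]

theorem p_le_before_u_add : C.p ≤ C.before C.u + (C.a C.u).natAbs := by
  have := Finset.min'_mem (Finset.univ.filter fun j => C.p ≤ ∑ i with i ≤ j, (C.a i).natAbs)
  rw [← sum_le_eq]
  exact (Finset.mem_filter.1 (this _)).2

theorem before_add_lt_p {j : Fin (C.r + 1)} (h : j < C.u) : C.before j + (C.a j).natAbs < C.p := by
  by_contra! hle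
  rw [← sum_le_eq] at hle
  exact absurd (Finset.min'_le _ _ (Finset.mem_filter.2 ⟨Finset.mem_univ j, hle⟩)) (not_le.2 h)

theorem before_succ (i : Fin C.r) :
    C.before i.succ = C.before i.castSucc + (C.a i.castSucc).natAbs := by
  rw [← sum_le_eq, before]
  refine Finset.sum_congr (Finset.filter_congr fun j _ => ?_) fun _ _ => rfl
  rw [Fin.lt_def, Fin.le_def, Fin.val_succ, Fin.val_castSucc]
  omega

theorem before_zero : C.before 0 = 0 :=
  Finset.sum_eq_zero fun _ hi => absurd (Finset.mem_filter.1 hi).2 (Fin.not_lt_zero _)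

theorem before_add_le_before {j j' : Fin (C.r + 1)} (h : j < j') :
    C.before j + (C.a j).natAbs ≤ C.before j' := by
  rw [← sum_le_eq, before]
  exact Finset.sum_le_sum_of_subset fun i hi => Finset.mem_filter.2
    ⟨Finset.mem_univ _, (Finset.mem_filter.1 hi).2.trans_lt h⟩

theorem before_u_lt_p_or : C.before C.u < C.p ∨ (C.u = 0 ∧ C.p = 0) := by
  rcases Fin.eq_zero_or_eq_succ C.u with h | ⟨i, h⟩
  · rw [h, before_zero]
    rcases Nat.eq_zero_or_pos C.p with hp | hp
    · exact Or.inr ⟨rfl, hp⟩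
    · exact Or.inl hp
  · left
    rw [h, before_succ]
    refine C.before_add_lt_p ?_
    rw [h]
    exact Fin.castSucc_lt_succ

/-- The number of elements of the blocks to the left of an element of the `j`-th block. -/
theorem card_filter_lt {j : Fin (C.r + 1)} {s : ℕ} (hs : s ∈ C.block j) :
    ((C.upSeg ∪ C.downSeg).filter (· < s)).card = C.before j + (s - C.left j) := by
  rw [block, Finset.mem_Ico] at hs
  have : (C.upSeg ∪ C.downSeg).filter (· < s) =
      (Finset.univ.filter fun i => i < j).biUnion C.block ∪ Finset.Ico (C.left j) s := by
    ext z
    simp only [upSeg_union_downSeg, Finset.mem_filter, Finset.mem_biUnion, Finset.mem_univ,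
      true_and, Finset.mem_union, block, Finset.mem_Ico]
    constructor
    · rintro ⟨⟨i, hi⟩, hz⟩
      rcases lt_trichotomy i j with h | rfl | h
      · exact Or.inl ⟨i, h, hi⟩
      · exact Or.inr ⟨hi.1, hz⟩
      · have := C.right_le_left h
        omega
    · rintro (⟨i, h, hi⟩ | hz)
      · have := C.right_le_left h
        exact ⟨⟨i, hi⟩, by omega⟩
      · exact ⟨⟨j, by omega⟩, hz.2⟩
  rw [this, Finset.card_union_of_disjoint, card_block_biUnion, Nat.card_Ico, before]
  rw [Finset.disjoint_biUnion_left]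
  intro i hi
  have := C.right_le_left (Finset.mem_filter.1 hi).2
  rw [Finset.disjoint_left]
  intro z hz hz'
  rw [block, Finset.mem_Ico] at hz
  rw [Finset.mem_Ico] at hz'
  omega

/-- The up-pointing unit triangles of the bowtie fill the blocks before the `u`-th one and an
initial part of the `u`-th block. -/
theorem bowUpSeg_eq : C.bowUpSeg = (Finset.univ.filter fun j => j < C.u).biUnion C.block ∪
    Finset.Ico (C.left C.u) (C.left C.u + (C.p - C.before C.u)) := by
  have hu := C.p_le_before_u_add
  ext s
  rw [bowUpSeg, Finset.mem_filter, Finset.mem_union (s := Finset.biUnion _ _),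
    Finset.mem_biUnion, Finset.mem_Ico]
  constructor
  · rintro ⟨hs, hlt⟩
    rw [upSeg_union_downSeg] at hs
    obtain ⟨j, -, hs⟩ := Finset.mem_biUnion.1 hs
    rw [C.card_filter_lt hs] at hlt
    rcases lt_trichotomy j C.u with h | rfl | h
    · exact Or.inl ⟨j, Finset.mem_filter.2 ⟨Finset.mem_univ _, h⟩, hs⟩
    · rw [block, Finset.mem_Ico] at hs
      right
      omega
    · have := C.before_add_le_before h
      omega
  · rintro (⟨j, hj, hs⟩ | hs)
    · refine ⟨C.upSeg_union_downSeg ▸ Finset.mem_biUnion.2 ⟨j, Finset.mem_univ _, hs⟩, ?_⟩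
      rw [C.card_filter_lt hs]
      have := C.before_add_lt_p (Finset.mem_filter.1 hj).2
      rw [block, Finset.mem_Ico, right] at hs
      omega
    · have hs' : s ∈ C.block C.u := by
        rw [block, Finset.mem_Ico, right]
        omega
      refine ⟨C.upSeg_union_downSeg ▸ Finset.mem_biUnion.2 ⟨C.u, Finset.mem_univ _, hs'⟩, ?_⟩
      rw [C.card_filter_lt hs']
      omega

theorem disjoint_biUnion_Ico_left_u : Disjoint ((Finset.univ.filter fun j => j < C.u).biUnion
    C.block) (Finset.Ico (C.left C.u) (C.left C.u + (C.p - C.before C.u))) := by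
  rw [Finset.disjoint_biUnion_left]
  intro j hj
  have := C.right_le_left (Finset.mem_filter.1 hj).2
  rw [Finset.disjoint_left]
  intro s hs hs'
  rw [block, Finset.mem_Ico] at hs
  rw [Finset.mem_Ico] at hs'
  omega

theorem card_bowUpSeg : C.bowUpSeg.card = C.p := by
  rw [bowUpSeg_eq, Finset.card_union_of_disjoint C.disjoint_biUnion_Ico_left_u,
    card_block_biUnion, Nat.card_Ico, ← before]
  rcases C.before_u_lt_p_or with h | ⟨h, h'⟩
  · omega
  · simp [h, before_zero, h']

theorem bowUpSeg_subset : C.bowUpSeg ⊆ C.upSeg ∪ C.downSeg := Finset.filter_subset _ _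

theorem bowUpSeg_union_bowDownSeg : C.bowUpSeg ∪ C.bowDownSeg = C.upSeg ∪ C.downSeg :=
  Finset.union_sdiff_of_subset C.bowUpSeg_subset

theorem disjoint_bowUpSeg_bowDownSeg : Disjoint C.bowUpSeg C.bowDownSeg := Finset.disjoint_sdiff

theorem card_bowDownSeg : C.bowDownSeg.card = C.n := by
  have := congrArg Finset.card C.bowUpSeg_union_bowDownSeg
  rw [Finset.card_union_of_disjoint C.disjoint_bowUpSeg_bowDownSeg,
    Finset.card_union_of_disjoint C.disjoint_upSeg_downSeg, card_bowUpSeg, card_upSeg,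
    card_downSeg] at this
  omega

theorem turn_eq : C.turn = C.left C.u + (C.p - C.before C.u) := by
  rcases C.before_u_lt_p_or with h | ⟨h, h'⟩
  · rw [turn]
    refine le_antisymm (Finset.sup_le fun s hs => ?_) ?_
    · rw [bowUpSeg_eq, Finset.mem_union, Finset.mem_biUnion, Finset.mem_Ico] at hs
      rcases hs with ⟨j, hj, hs⟩ | hs
      · have := C.right_le_left (Finset.mem_filter.1 hj).2
        rw [block, Finset.mem_Ico] at hs
        omega
      · omega
    · have : C.left C.u + (C.p - C.before C.u) - 1 ∈ C.bowUpSeg := by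
        rw [bowUpSeg_eq, Finset.mem_union, Finset.mem_Ico]
        right
        omega
      have := Finset.le_sup (f := fun s => s + 1) this
      omega
  · have : C.bowUpSeg = ∅ := by
      rw [← Finset.card_eq_zero, card_bowUpSeg, h']
    simp [turn, this, h, left_zero, h']

/-- The quotient of the products of a weight over the up-pointing segments of the bowtie and of the
code. The weight of a block is the quotient of the values of `G` at its ends. -/
theorem prod_bowUpSeg_div_prod_upSeg {f G : ℕ → ℚ} (hG : ∀ s, G s ≠ 0)
    (hf : ∀ u v, u ≤ v → ∏ s ∈ Finset.Ico u v, f s = G v / G u) :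
    (∏ s ∈ C.bowUpSeg, f s) / ∏ s ∈ C.upSeg, f s =
      G C.turn / G (C.left C.u) *
        (∏ j with j < C.u ∧ C.a j < 0, G (C.right j) / G (C.left j)) *
        ∏ j with C.u ≤ j ∧ 0 < C.a j, G (C.left j) / G (C.right j) := by
  have hblock : ∀ j, ∏ s ∈ C.block j, f s = G (C.right j) / G (C.left j) := fun j =>
    hf _ _ (C.left_le_right j)
  have hprod : ∀ I : Finset (Fin (C.r + 1)), ∏ s ∈ I.biUnion C.block, f s =
      ∏ j ∈ I, G (C.right j) / G (C.left j) := by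
    intro I
    rw [Finset.prod_biUnion fun j _ j' _ h => C.disjoint_block h]
    exact Finset.prod_congr rfl fun j _ => hblock j
  have hup : ∏ s ∈ C.bowUpSeg, f s =
      G C.turn / G (C.left C.u) * ∏ j with j < C.u, G (C.right j) / G (C.left j) := by
    rw [bowUpSeg_eq, Finset.prod_union C.disjoint_biUnion_Ico_left_u, hprod, ← turn_eq,
      hf _ _ (by rw [turn_eq]; omega), mul_comm]
  rw [hup, upSeg_eq, hprod, mul_div_assoc, mul_assoc]
  congr 1
  simp only [Finset.prod_filter]
  rw [← Finset.prod_div_distrib, ← Finset.prod_mul_distrib]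
  refine Finset.prod_congr rfl fun j _ => ?_
  have h1 := hG (C.left j)
  have h2 := hG (C.right j)
  have h3 : C.a j = 0 → C.right j = C.left j := fun h => by simp [right, h]
  rcases lt_or_ge j C.u with hj | hj
  · rcases lt_trichotomy (C.a j) 0 with h | h | h
    · simp [hj, h, h.not_gt, hj.not_ge]
    · simp [hj, h, h3 h, h1]
    · simp [hj, h, h.not_gt, hj.not_ge, h1, h2]
  · rcases lt_trichotomy (C.a j) 0 with h | h | h
    · simp [hj, h, h.not_gt, hj.not_gt]
    · simp [h, hj.not_gt]
    · simp [hj, h, h.not_gt, hj.not_gt]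

end Code

/-! ### The quotient of two tiling counts with the same set of hole segments -/

/-- The part of the tiling count that depends only on the set `B` of all segments carrying
a triangular hole and on the set `W` of the segments that bisect vertical lozenges. -/
noncomputable def restSum (a b c k l n w : ℕ) (B W : Finset ℤ) : ℤ :=
  ∑ Z ∈ (lineSegs a b c k l \ (B ∪ W)).powerset with
      (Z.card : ℤ) = min (b : ℤ) l + min (c : ℤ) l - l - n - w,
    vdm (extUp a b c k l ∪ (W ∪ Z)) * vdm (extDown a b c k l ∪ (W ∪ Z)) * cross B (W ∪ Z)

theorem restSum_pos {a b c k l n w : ℕ} {B W : Finset ℤ} (hBW : Disjoint B W)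
    (h0 : 0 ≤ min (b : ℤ) l + min (c : ℤ) l - l - n - w)
    (h1 : min (b : ℤ) l + min (c : ℤ) l - l - n - w ≤ (lineSegs a b c k l \ (B ∪ W)).card) :
    0 < restSum a b c k l n w B W := by
  refine Finset.sum_pos (fun Z hZ => mul_pos (mul_pos (vdm_pos _) (vdm_pos _)) (cross_pos ?_)) ?_
  · have := Finset.mem_powerset.1 (Finset.mem_filter.1 hZ).1
    exact Finset.disjoint_union_right.2
      ⟨hBW, (Finset.disjoint_sdiff.mono_left Finset.subset_union_left).mono_right this⟩
  · obtain ⟨Z, hZ, hcard⟩ := Finset.exists_subset_card_eq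
      (n := (min (b : ℤ) l + min (c : ℤ) l - l - n - w).toNat)
      (s := lineSegs a b c k l \ (B ∪ W)) (by omega)
    exact ⟨Z, Finset.mem_filter.2 ⟨Finset.mem_powerset.2 hZ, by omega⟩⟩

/-- The sum is empty if the line has too few free segments, or if the triangular holes already
overfill one of the two halves of the hexagon. -/
theorem restSum_eq_zero {a b c k l n w : ℕ} {B W : Finset ℤ}
    (h : min (b : ℤ) l + min (c : ℤ) l - l - n - w < 0 ∨
      (lineSegs a b c k l \ (B ∪ W)).card < min (b : ℤ) l + min (c : ℤ) l - l - n - w) :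
    restSum a b c k l n w B W = 0 := by
  rw [restSum, Finset.filter_false_of_mem, Finset.sum_empty]
  intro Z hZ
  have := Finset.card_le_card (Finset.mem_powerset.1 hZ)
  omega

/-- The factor of the unit segment `x` in `distQuot`: for points of the `l`-th line, `distQuot` is the
product of these factors over the segments between them (`prod_Ico_segWeight`). -/
noncomputable def segWeight (a b c k l : ℕ) (x : ℤ) : ℚ :=
  distWeight a b c k l (x + 1) / distWeight a b c k l x

theorem segWeight_ne_zero (a b c k l : ℕ) (x : ℤ) : segWeight a b c k l x ≠ 0 :=
  div_ne_zero (distWeight_ne_zero _ _ _ _ _ _) (distWeight_ne_zero _ _ _ _ _ _)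

theorem prod_Ico_segWeight (a b c k l : ℕ) (x : ℤ) {u v : ℕ} (huv : u ≤ v) :
    ∏ s ∈ Finset.Ico u v, segWeight a b c k l (x + s) =
      distWeight a b c k l (x + v) / distWeight a b c k l (x + u) := by
  induction v, huv using Nat.le_induction with
  | base => simp [distWeight_ne_zero]
  | succ v huv ih =>
    rw [Finset.prod_Ico_succ_top huv, ih, segWeight, mul_comm,
      div_mul_div_cancel₀ (distWeight_ne_zero _ _ _ _ _ _), Nat.cast_succ, add_assoc]

/-- The weights of the segments are the quotients of their products of distances to the two
extensions of the line. -/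
theorem cross_eq_prod_segWeight {a b c k l : ℕ} (hl : l ≤ b + c) {X : Finset ℤ}
    (hX : X ⊆ lineSegs a b c k l) :
    (cross X (extUp a b c k l) : ℚ) * ∏ x ∈ X, segWeight a b c k l x =
      cross X (extDown a b c k l) := by
  rw [cross, cross, Int.cast_prod, Int.cast_prod, ← Finset.prod_mul_distrib]
  refine Finset.prod_congr rfl fun x hx => ?_
  rw [segWeight, distWeight_add_one hl (hX hx), mul_div_cancel₀]
  refine Int.cast_ne_zero.2 (Finset.prod_ne_zero_iff.2 fun e he => abs_ne_zero.2 fun h => ?_)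
  rw [sub_eq_zero] at h
  exact Finset.disjoint_left.1 (disjoint_extUp_lineSegs a b c k l) he (h ▸ hX hx)

/-- The dependence of the tiling count on the distribution of the segments `X₁ ∪ X₂` between
up-pointing and down-pointing holes. -/
theorem tilingCount_mul_prod_segWeight {a b c k l hu n w : ℕ} (hhu : hu + l = b + c + k)
    (h3 : (n : ℤ) + w ≤ min (b : ℤ) (min (l : ℤ) ((b : ℤ) + c - l)))
    {Qu Qd : Set (ℤ × ℕ)} {X₁ X₂ W : Finset ℤ} (hQU : IsBase Qu (X₁ ∪ W))
    (hQD : IsBase Qd (X₂ ∪ W)) (h12 : Disjoint X₁ X₂) (hXW : Disjoint (X₁ ∪ X₂) W)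
    (hX : X₁ ∪ X₂ ⊆ lineSegs a b c k l) (hW : W ⊆ lineSegs a b c k l)
    (hc₁ : X₁.card = n + k) (hc₂ : X₂.card = n) (hcW : W.card = w) :
    (tilingCount (hexagon a b c k \ (triangles Qu l ∪ downTriangles Qd l)) : ℚ) *
        (hyperfac hu * hyperfac l) * ∏ x ∈ X₁, segWeight a b c k l x =
      vdm X₁ * vdm X₂ *
        (cross (X₁ ∪ X₂) (extDown a b c k l) * restSum a b c k l n w (X₁ ∪ X₂) W) := by
  have hl : l ≤ b + c := by omega
  have hX₁ := Finset.subset_union_left.trans hX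
  have hX₂ := Finset.subset_union_right.trans hX
  have hXW' := Finset.disjoint_union_left.1 hXW
  have hmain := tilingCount_hexagon_diff hhu h3 hQU hQD (Finset.union_subset hX₁ hW)
    (Finset.union_subset hX₂ hW)
    (by rw [Finset.card_union_of_disjoint hXW'.1, hc₁, hcW])
    (by rw [Finset.card_union_of_disjoint hXW'.2, hc₂, hcW])
  have hBW : X₁ ∪ W ∪ (X₂ ∪ W) = X₁ ∪ X₂ ∪ W := by
    ext x
    simp only [Finset.mem_union]
    tauto
  rw [hBW] at hmain
  have hsum : (tilingCount (hexagon a b c k \ (triangles Qu l ∪ downTriangles Qd l)) : ℤ) *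
      (hyperfac hu * hyperfac l) = vdm X₁ * vdm X₂ *
        (cross X₁ (extUp a b c k l) * cross X₂ (extDown a b c k l)) *
          restSum a b c k l n w (X₁ ∪ X₂) W := by
    rw [hmain, restSum, Finset.mul_sum]
    refine Finset.sum_congr rfl fun Z hZ => ?_
    have hZ' := Finset.mem_powerset.1 (Finset.mem_filter.1 hZ).1
    have hZL := hZ'.trans Finset.sdiff_subset
    exact vdm_mul_vdm h12 hXW'.1 hXW'.2
      ((disjoint_extUp_lineSegs a b c k l).mono_right
        (Finset.union_subset (Finset.union_subset hX₁ hW) hZL))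
      ((disjoint_extDown_lineSegs a b c k l).mono_right
        (Finset.union_subset (Finset.union_subset hX₂ hW) hZL))
      (Finset.disjoint_sdiff.mono_right hZ')
  rw [← Int.cast_inj (α := ℚ)] at hsum
  simp only [Int.cast_mul, Int.cast_natCast] at hsum
  rw [hsum, cross_union_left h12, Int.cast_mul, ← cross_eq_prod_segWeight hl hX₁]
  ring

/-! ### Positions of the ferns on the line -/

section Placement

variable {t : ℕ}

theorem offset_add_len_le {F : Fin t → BuddedFern} {m : Fin (t + 1) → ℕ} {i i' : Fin t}
    (h : i < i') : offset F m i + (F i).len ≤ offset F m i' := by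
  have h1 : ∑ j with j ≤ i.castSucc, m j ≤ ∑ j with j ≤ i'.castSucc, m j :=
    Finset.sum_le_sum_of_subset fun j hj => Finset.mem_filter.2 ⟨Finset.mem_univ _,
      (Finset.mem_filter.1 hj).2.trans (Fin.castSucc_le_castSucc_iff.2 h.le)⟩
  have h2 : ∑ j ∈ insert i (Finset.univ.filter fun j => j < i), (F j).len ≤
      ∑ j with j < i', (F j).len := by
    refine Finset.sum_le_sum_of_subset fun j hj => Finset.mem_filter.2 ⟨Finset.mem_univ _, ?_⟩
    rcases Finset.mem_insert.1 hj with rfl | hj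
    exacts [h, (Finset.mem_filter.1 hj).2.trans h]
  rw [Finset.sum_insert (by simp)] at h2
  rw [offset, offset]
  omega

theorem offset_add_len_le_sum (F : Fin t → BuddedFern) (m : Fin (t + 1) → ℕ) (i : Fin t) :
    offset F m i + (F i).len ≤ ∑ j, m j + ∑ j, (F j).len := by
  have h1 : ∑ j with j ≤ i.castSucc, m j ≤ ∑ j, m j :=
    Finset.sum_le_sum_of_subset (Finset.subset_univ _)
  have h2 : ∑ j ∈ insert i (Finset.univ.filter fun j => j < i), (F j).len ≤ ∑ j, (F j).len :=
    Finset.sum_le_sum_of_subset (Finset.subset_univ _)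
  rw [Finset.sum_insert (by simp)] at h2
  rw [offset]
  omega

/-- The segments of the `l`-th line that the `S i` select in the `i`-th structure. The unit segment
from `x` to `x + 1` is represented by `x`. -/
noncomputable def placed (b l : ℕ) (F : Fin t → BuddedFern) (m : Fin (t + 1) → ℕ)
    (S : Fin t → Finset ℕ) : Finset ℤ :=
  Finset.univ.biUnion fun i => (S i).image fun s : ℕ => lineLeft b l + offset F m i + s

theorem mem_placed {b l : ℕ} {F : Fin t → BuddedFern} {m : Fin (t + 1) → ℕ}
    {S : Fin t → Finset ℕ} {x : ℤ} :
    x ∈ placed b l F m S ↔ ∃ i, ∃ s ∈ S i, lineLeft b l + offset F m i + s = x := by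
  simp [placed]

variable {b l : ℕ} {F : Fin t → BuddedFern} {m : Fin (t + 1) → ℕ}

theorem placed_union (S S' : Fin t → Finset ℕ) :
    placed b l F m (fun i => S i ∪ S' i) = placed b l F m S ∪ placed b l F m S' := by
  ext x
  simp only [Finset.mem_union, mem_placed]
  constructor
  · rintro ⟨i, s, hs | hs, h⟩
    exacts [Or.inl ⟨i, s, hs, h⟩, Or.inr ⟨i, s, hs, h⟩]
  · rintro (⟨i, s, hs, h⟩ | ⟨i, s, hs, h⟩)
    exacts [⟨i, s, Or.inl hs, h⟩, ⟨i, s, Or.inr hs, h⟩]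

/-- Different structures occupy disjoint parts of the line. -/
theorem eq_of_position_eq {i i' : Fin t} {s s' : ℕ} (hs : s < (F i).len) (hs' : s' < (F i').len)
    (h : lineLeft b l + offset F m i + s = lineLeft b l + offset F m i' + s') : i = i' := by
  by_contra hne
  rcases lt_or_gt_of_ne hne with h' | h' <;>
    have := offset_add_len_le (F := F) (m := m) h' <;> omega

theorem disjoint_placed {S S' : Fin t → Finset ℕ} (hS : ∀ i, S i ⊆ Finset.range (F i).len)
    (hS' : ∀ i, S' i ⊆ Finset.range (F i).len) (h : ∀ i, Disjoint (S i) (S' i)) :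
    Disjoint (placed b l F m S) (placed b l F m S') := by
  rw [Finset.disjoint_left]
  intro x hx hx'
  obtain ⟨i, s, hs, rfl⟩ := mem_placed.1 hx
  obtain ⟨i', s', hs', hss'⟩ := mem_placed.1 hx'
  obtain rfl := eq_of_position_eq (Finset.mem_range.1 (hS' i' hs')) (Finset.mem_range.1 (hS i hs))
    hss'
  obtain rfl : s' = s := by omega
  exact Finset.disjoint_left.1 (h _) hs hs'

theorem prod_placed {S : Fin t → Finset ℕ} (hS : ∀ i, S i ⊆ Finset.range (F i).len) (f : ℤ → ℚ) :
    ∏ x ∈ placed b l F m S, f x = ∏ i, ∏ s ∈ S i, f (lineLeft b l + offset F m i + s) := by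
  rw [placed, Finset.prod_biUnion]
  · refine Finset.prod_congr rfl fun i _ => Finset.prod_image fun s _ s' _ h => ?_
    have : lineLeft b l + offset F m i + s = lineLeft b l + offset F m i + s' := h
    omega
  · intro i _ i' _ hne
    refine Finset.disjoint_left.2 fun x hx hx' => hne ?_
    obtain ⟨s, hs, rfl⟩ := Finset.mem_image.1 hx
    obtain ⟨s', hs', h⟩ := Finset.mem_image.1 hx'
    exact eq_of_position_eq (Finset.mem_range.1 (hS i hs)) (Finset.mem_range.1 (hS i' hs')) h.symm

theorem card_placed {S : Fin t → Finset ℕ} (hS : ∀ i, S i ⊆ Finset.range (F i).len) :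
    (placed b l F m S).card = ∑ i, (S i).card := by
  rw [placed, Finset.card_biUnion]
  · refine Finset.sum_congr rfl fun i _ => Finset.card_image_of_injective _ fun s s' h => ?_
    have : lineLeft b l + offset F m i + s = lineLeft b l + offset F m i + s' := h
    omega
  · intro i _ i' _ hne
    refine Finset.disjoint_left.2 fun x hx hx' => hne ?_
    obtain ⟨s, hs, rfl⟩ := Finset.mem_image.1 hx
    obtain ⟨s', hs', h⟩ := Finset.mem_image.1 hx'
    exact eq_of_position_eq (Finset.mem_range.1 (hS i hs)) (Finset.mem_range.1 (hS i' hs')) h.symm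

theorem placed_subset {a c k : ℕ} {S : Fin t → Finset ℕ} (hS : ∀ i, S i ⊆ Finset.range (F i).len)
    (hlen : ((∑ j, m j + ∑ j, (F j).len : ℕ) : ℤ) ≤ lineLength a b c k l) :
    placed b l F m S ⊆ lineSegs a b c k l := by
  intro x hx
  obtain ⟨i, s, hs, rfl⟩ := mem_placed.1 hx
  have h1 := offset_add_len_le_sum F m i
  have h2 := Finset.mem_range.1 (hS i hs)
  rw [lineSegs, Finset.mem_Ico]
  omega

theorem labels_eq_map_placed (b l : ℕ) (F : Fin t → BuddedFern) (m : Fin (t + 1) → ℕ)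
    (S : Fin t → Finset ℕ) : labels F m S =
      (placed b l F m S).map (addRightEmbedding (1 - lineLeft b l)) := by
  ext x
  simp only [labels, Finset.mem_biUnion, Finset.mem_univ, true_and, Finset.mem_image,
    Finset.mem_map, mem_placed, addRightEmbedding_apply]
  constructor
  · rintro ⟨i, s, hs, rfl⟩
    exact ⟨_, ⟨i, s, hs, rfl⟩, by push_cast; ring⟩
  · rintro ⟨_, ⟨i, s, hs, rfl⟩, rfl⟩
    exact ⟨i, s, hs, by push_cast; ring⟩

/-- The region `T(S)` is a dented trapezoid whose height is the number of dents. -/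
theorem sCount_mul_hyperfac (S : Finset ℤ) : (sCount S : ℤ) * hyperfac S.card = vdm S := by
  rcases S.eq_empty_or_nonempty with rfl | hne
  · have : dentedTrapezoid ∅ = ∅ := by
      refine Set.eq_empty_of_forall_notMem ?_
      rintro (⟨x, y⟩ | ⟨x, y⟩) h <;> simp [dentedTrapezoid, up_mem_regionOf, down_mem_regionOf] at h
    rw [sCount, this, tilingCount_empty]
    simp [hyperfac, vdm]
  · have hmin := S.min'_mem hne
    have hmax := S.max'_mem hne
    have hle : ∀ s ∈ S, S.min' hne ≤ s ∧ s ≤ S.max' hne := fun s hs =>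
      ⟨S.min'_le s hs, S.le_max' s hs⟩
    set u := S.min' hne
    set v := S.max' hne
    have huv := (hle u hmin).2
    have hsub : S.map (addRightEmbedding (-1)) ⊆
        Finset.Ico (u - 1) (u - 1 + ((v - u + 1).toNat : ℤ)) := by
      intro x hx
      obtain ⟨s, hs, rfl⟩ := Finset.mem_map.1 hx
      have := hle s hs
      rw [addRightEmbedding_apply, Finset.mem_Ico]
      omega
    have hcard := Finset.card_le_card hsub
    rw [Finset.card_map, Int.card_Ico] at hcard
    have hregion : dentedTrapezoid S = trap (u - 1) (v - u + 1).toNat 0 S.card \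
        dents (S.map (addRightEmbedding (-1))) 0 := by
      have h1 : ∀ z : ℤ, (∃ s ∈ S, s - 1 ≤ z) ↔ u - 1 ≤ z := fun z =>
        ⟨fun ⟨s, hs, h⟩ => by have := hle s hs; omega, fun h => ⟨u, hmin, h⟩⟩
      have h2 : ∀ z : ℤ, (∃ s ∈ S, z ≤ s) ↔ z ≤ v := fun z =>
        ⟨fun ⟨s, hs, h⟩ => by have := hle s hs; omega, fun h => ⟨v, hmax, h⟩⟩
      rw [dentedTrapezoid, trap]
      simp only [h1, h2]
      congr 2
      · ext P
        simp only [Set.mem_ofPred_eq]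
        omega
      · ext τ
        simp only [Finset.mem_map, addRightEmbedding_apply]
        constructor
        · rintro ⟨s, hs, rfl⟩
          exact ⟨_, ⟨s, hs, rfl⟩, rfl⟩
        · rintro ⟨_, ⟨s, hs, rfl⟩, rfl⟩
          exact ⟨s, hs, rfl⟩
    have := tilingCount_trap S.card (u - 1) (v - u + 1).toNat 0 _ (by omega) hsub (fun h0 =>
      absurd (Finset.card_pos.2 hne) (by omega))
    rw [Finset.card_map, if_pos rfl, vdm_map_add] at this
    rw [sCount, hregion, this]

end Placement

/-! ### Regions with ferns or bowties removed -/

section Regions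

variable {t : ℕ}

/-- The lattice triangles that are given, relative to the left ends of the structures, by
the `Q i`. -/
def placedTriangles (b l : ℕ) (F : Fin t → BuddedFern) (m : Fin (t + 1) → ℕ)
    (Q : Fin t → Set (ℕ × ℕ)) : Set (ℤ × ℕ) :=
  {q | ∃ i, ∃ q' ∈ Q i, q = (lineLeft b l + offset F m i + q'.1, q'.2)}

theorem isBase_placedTriangles {b l : ℕ} {F : Fin t → BuddedFern} {m : Fin (t + 1) → ℕ}
    {Q : Fin t → Set (ℕ × ℕ)} {S : Fin t → Finset ℕ}
    (h : ∀ i s, s ∈ S i ↔ ∃ q ∈ Q i, s ∈ Finset.Ico q.1 (q.1 + q.2)) :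
    IsBase (placedTriangles b l F m Q) (placed b l F m S) := by
  intro x
  rw [mem_placed]
  constructor
  · rintro ⟨i, s, hs, rfl⟩
    obtain ⟨q, hq, hs⟩ := (h i s).1 hs
    rw [Finset.mem_Ico] at hs
    exact ⟨_, ⟨i, q, hq, rfl⟩, by dsimp only; omega, by dsimp only; omega⟩
  · rintro ⟨_, ⟨i, q, hq, rfl⟩, h1, h2⟩
    dsimp only at h1 h2
    refine ⟨i, (x - (lineLeft b l + offset F m i)).toNat,
      (h i _).2 ⟨q, hq, Finset.mem_Ico.2 (by omega)⟩, by omega⟩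

/-- The tiling count if the segments of the blocks of each fern are distributed in some way between
up-pointing holes (on `S₁ i`) and down-pointing holes (on `S₂ i`). The last factor does not depend
on the distribution. -/
theorem tilingCount_placed_mul {a b c k l hu n w : ℕ} (hhu : hu + l = b + c + k)
    {F : Fin t → BuddedFern} {m : Fin (t + 1) → ℕ}
    (hp : ∑ i, (F i).p = n + k) (hn : ∑ i, (F i).n = n) (hw : ∑ i, (F i).wSum = w)
    (hlen : ((∑ j, m j + ∑ j, (F j).len : ℕ) : ℤ) ≤ lineLength a b c k l)
    (h3 : (n : ℤ) + w ≤ min (b : ℤ) (min (l : ℤ) ((b : ℤ) + c - l)))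
    {S₁ S₂ : Fin t → Finset ℕ} {Q₁ Q₂ : Fin t → Set (ℕ × ℕ)}
    (hQ₁ : ∀ i s, s ∈ S₁ i ∪ (F i).lozSeg ↔ ∃ q ∈ Q₁ i, s ∈ Finset.Ico q.1 (q.1 + q.2))
    (hQ₂ : ∀ i s, s ∈ S₂ i ∪ (F i).lozSeg ↔ ∃ q ∈ Q₂ i, s ∈ Finset.Ico q.1 (q.1 + q.2))
    (hS : ∀ i, S₁ i ∪ S₂ i = (F i).upSeg ∪ (F i).downSeg) (hdisj : ∀ i, Disjoint (S₁ i) (S₂ i))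
    (hc₁ : ∀ i, (S₁ i).card = (F i).p) (hc₂ : ∀ i, (S₂ i).card = (F i).n) :
    (tilingCount (hexagon a b c k \ (triangles (placedTriangles b l F m Q₁) l ∪
        downTriangles (placedTriangles b l F m Q₂) l)) : ℚ) *
        (hyperfac hu * hyperfac l) * ∏ x ∈ placed b l F m S₁, segWeight a b c k l x =
      vdm (placed b l F m S₁) * vdm (placed b l F m S₂) *
        (cross (placed b l F m fun i => (F i).upSeg ∪ (F i).downSeg) (extDown a b c k l) *
          restSum a b c k l n w (placed b l F m fun i => (F i).upSeg ∪ (F i).downSeg)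
            (placed b l F m fun i => (F i).lozSeg)) := by
  have hsub : ∀ i, S₁ i ∪ S₂ i ⊆ Finset.range (F i).len := fun i =>
    hS i ▸ (F i).union_subset
  have hsub₁ := fun i => Finset.subset_union_left.trans (hsub i)
  have hsub₂ := fun i => Finset.subset_union_right.trans (hsub i)
  have hloz := fun i => (F i).lozSeg_subset
  have hB : (placed b l F m fun i => (F i).upSeg ∪ (F i).downSeg) =
      placed b l F m S₁ ∪ placed b l F m S₂ := by
    rw [← placed_union]
    simp only [hS]
  rw [hB]
  refine tilingCount_mul_prod_segWeight hhu h3 ?_ ?_ (disjoint_placed hsub₁ hsub₂ hdisj) ?_ ?_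
    (placed_subset hloz hlen) ?_ ?_ ?_
  · rw [← placed_union]
    exact isBase_placedTriangles hQ₁
  · rw [← placed_union]
    exact isBase_placedTriangles hQ₂
  · rw [← hB]
    exact disjoint_placed (fun i => (F i).union_subset) hloz fun i => (F i).disjoint_union_lozSeg
  · rw [← placed_union]
    exact placed_subset hsub hlen
  · rw [card_placed hsub₁, ← hp]
    exact Finset.sum_congr rfl fun i _ => hc₁ i
  · rw [card_placed hsub₂, ← hn]
    exact Finset.sum_congr rfl fun i _ => hc₂ i
  · rw [card_placed hloz, ← hw]
    exact Finset.sum_congr rfl fun i _ => (F i).card_lozSeg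

theorem fernRegion_eq (a b c k l : ℕ) (F : Fin t → BuddedFern) (m : Fin (t + 1) → ℕ) :
    fernRegion a b c k l F m =
      hexagon a b c k \ (triangles (placedTriangles b l F m fun i => ↑(F i).ups) l ∪
        downTriangles (placedTriangles b l F m fun i => ↑(F i).downs) l) := by
  rw [fernRegion]
  congr 1
  ext τ
  simp only [Set.mem_iUnion, BuddedFern.hole, Set.mem_union, exists_prop]
  constructor
  · rintro ⟨i, ⟨q, hq, h⟩ | ⟨q, hq, h⟩⟩
    exacts [Or.inl ⟨_, ⟨i, q, hq, rfl⟩, h⟩, Or.inr ⟨_, ⟨i, q, hq, rfl⟩, h⟩]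
  · rintro (⟨_, ⟨i, q, hq, rfl⟩, h⟩ | ⟨_, ⟨i, q, hq, rfl⟩, h⟩)
    exacts [⟨i, Or.inl ⟨q, hq, h⟩⟩, ⟨i, Or.inr ⟨q, hq, h⟩⟩]

theorem bowtieRegion_eq (a b c k l : ℕ) (F : Fin t → BuddedFern) (m : Fin (t + 1) → ℕ) :
    bowtieRegion a b c k l F m =
      hexagon a b c k \ (triangles (placedTriangles b l F m fun i =>
          {q | Finset.Ico q.1 (q.1 + q.2) ⊆ (F i).bowUpSeg ∪ (F i).lozSeg}) l ∪
        downTriangles (placedTriangles b l F m fun i =>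
          {q | Finset.Ico q.1 (q.1 + q.2) ⊆ (F i).bowDownSeg ∪ (F i).lozSeg}) l) := by
  rw [bowtieRegion]
  congr 1
  ext τ
  simp only [Set.mem_iUnion, Code.bowtieHole, Set.mem_union]
  constructor
  · rintro ⟨i, ⟨z, s, hq, h⟩ | ⟨z, s, hq, h⟩⟩
    exacts [Or.inl ⟨_, ⟨i, (z, s), hq, rfl⟩, h⟩, Or.inr ⟨_, ⟨i, (z, s), hq, rfl⟩, h⟩]
  · rintro (⟨_, ⟨i, q, hq, rfl⟩, h⟩ | ⟨_, ⟨i, q, hq, rfl⟩, h⟩)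
    exacts [⟨i, Or.inl ⟨q.1, q.2, hq, h⟩⟩, ⟨i, Or.inr ⟨q.1, q.2, hq, h⟩⟩]

/-- The triangles of a bowtie have the right base, because they include all unit triangles. -/
theorem mem_iff_exists_Ico_subset (S : Finset ℕ) (s : ℕ) :
    s ∈ S ↔ ∃ q ∈ {q : ℕ × ℕ | Finset.Ico q.1 (q.1 + q.2) ⊆ S}, s ∈ Finset.Ico q.1 (q.1 + q.2) := by
  constructor
  · intro hs
    refine ⟨(s, 1), fun z hz => ?_, by simp⟩
    obtain rfl : z = s := by simpa using hz
    exact hs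
  · rintro ⟨q, hq, hs⟩
    exact hq hs

theorem sCount_labels (b l : ℕ) (F : Fin t → BuddedFern) (m : Fin (t + 1) → ℕ)
    {S : Fin t → Finset ℕ} (hS : ∀ i, S i ⊆ Finset.range (F i).len) :
    (sCount (labels F m S) : ℚ) =
      vdm (placed b l F m S) / hyperfac (∑ i, (S i).card) := by
  rw [eq_div_iff (hyperfac_ne_zero _)]
  have := sCount_mul_hyperfac (labels F m S)
  rw [labels_eq_map_placed b l, vdm_map_add, Finset.card_map, card_placed hS] at this
  rw [labels_eq_map_placed b l]
  exact_mod_cast this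

/-- The quotient of the weights of the bowties and the ferns. -/
theorem prod_segWeight_div (a b c k l : ℕ) (F : Fin t → BuddedFern) (m : Fin (t + 1) → ℕ) :
    (∏ x ∈ placed b l F m fun i => (F i).bowUpSeg, segWeight a b c k l x) /
        ∏ x ∈ placed b l F m fun i => (F i).upSeg, segWeight a b c k l x =
      ∏ i : Fin t,
        (distQuot a b c k (ptL b l F m i (F i).u) (ptT b l F m i) *
          (∏ j with j < (F i).u ∧ (F i).a j < 0,
            distQuot a b c k (ptL b l F m i j) (ptR b l F m i j)) *
          ∏ j with (F i).u ≤ j ∧ 0 < (F i).a j,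
            distQuot a b c k (ptR b l F m i j) (ptL b l F m i j)) := by
  rw [prod_placed fun i => (F i).bowUpSeg_subset.trans (F i).union_subset,
    prod_placed fun i => Finset.subset_union_left.trans (F i).union_subset,
    ← Finset.prod_div_distrib]
  refine Finset.prod_congr rfl fun i _ => ?_
  rw [(F i).prod_bowUpSeg_div_prod_upSeg
    (G := fun s => distWeight a b c k l (lineLeft b l + offset F m i + s))
    (fun s => distWeight_ne_zero _ _ _ _ _ _) fun u v huv => prod_Ico_segWeight _ _ _ _ _ _ huv]
  simp only [ptL, ptR, ptT, point, distQuot_eq]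

end Regions

end FernTiling

open FernTiling

theorem theorem2p3 (a b c k l t : ℕ) (F : Fin t → BuddedFern) (m : Fin (t + 1) → ℕ)
    (p n w : ℕ) (hp : p = ∑ i, (F i).p) (hn : n = ∑ i, (F i).n) (hw : w = ∑ i, (F i).wSum)
    (h1 : p = n + k)
    (h2 : (p : ℤ) + n + w + ∑ i, (m i : ℤ) = lineLength a b c k l)
    (h3 : (n : ℤ) + w ≤ min (b : ℤ) (min (l : ℤ) ((b : ℤ) + c - l))) :
    (n ≤ a ∧ n + w ≤ c →
      0 < tilingCount (fernRegion a b c k l F m) ∧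
      0 < tilingCount (bowtieRegion a b c k l F m) ∧
      (tilingCount (fernRegion a b c k l F m) : ℚ) / tilingCount (bowtieRegion a b c k l F m) =
        ((sCount (labelsX1 F m) : ℚ) * sCount (labelsX2 F m)) /
            ((sCount (labelsY1 F m) : ℚ) * sCount (labelsY2 F m)) *
          ∏ i : Fin t,
            (distQuot a b c k (ptL b l F m i (F i).u) (ptT b l F m i) *
              (∏ j with j < (F i).u ∧ (F i).a j < 0,
                distQuot a b c k (ptL b l F m i j) (ptR b l F m i j)) *
              ∏ j with (F i).u ≤ j ∧ 0 < (F i).a j,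
                distQuot a b c k (ptR b l F m i j) (ptL b l F m i j))) ∧
    (¬ (n ≤ a ∧ n + w ≤ c) →
      tilingCount (fernRegion a b c k l F m) = 0 ∧
      tilingCount (bowtieRegion a b c k l F m) = 0) := by
  obtain ⟨hu, hhu⟩ : ∃ hu : ℕ, hu + l = b + c + k := ⟨b + c + k - l, by omega⟩
  have hlensum : ∑ j, (F j).len = p + n + w := by
    simp only [Code.len_eq, Finset.sum_add_distrib, hp, hn, hw]
  have hlen : ((∑ j, m j + ∑ j, (F j).len : ℕ) : ℤ) = lineLength a b c k l := by
    rw [hlensum]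
    push_cast
    omega
  have hpk : ∑ i, (F i).p = n + k := hp ▸ h1
  have hup := fun i => Finset.subset_union_left.trans (F i).union_subset
  have hdown := fun i => Finset.subset_union_right.trans (F i).union_subset
  have hbow := fun i => (F i).bowUpSeg_union_bowDownSeg ▸ (F i).union_subset
  have hbup := fun i => Finset.subset_union_left.trans (hbow i)
  have hbdown := fun i => Finset.subset_union_right.trans (hbow i)
  set B := placed b l F m fun i => (F i).upSeg ∪ (F i).downSeg with hB
  set W := placed b l F m fun i => (F i).lozSeg with hW
  have hBW : Disjoint B W := disjoint_placed (fun i => (F i).union_subset)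
    (fun i => (F i).lozSeg_subset) fun i => (F i).disjoint_union_lozSeg
  have hBL : B ⊆ lineSegs a b c k l := placed_subset (fun i => (F i).union_subset) hlen.le
  have hWL : W ⊆ lineSegs a b c k l := placed_subset (fun i => (F i).lozSeg_subset) hlen.le
  have hcB : B.card = p + n := by
    rw [hB, card_placed fun i => (F i).union_subset, hp, hn, ← Finset.sum_add_distrib]
    refine Finset.sum_congr rfl fun i _ => ?_
    rw [Finset.card_union_of_disjoint (F i).disjoint_upSeg_downSeg, Code.card_upSeg,
      Code.card_downSeg]
  have hcW : W.card = w := by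
    rw [hW, card_placed fun i => (F i).lozSeg_subset, hw]
    exact Finset.sum_congr rfl fun i _ => (F i).card_lozSeg
  have hfree : ((lineSegs a b c k l \ (B ∪ W)).card : ℤ) = ∑ i, (m i : ℤ) := by
    have h := Finset.card_sdiff_add_card_eq_card (Finset.union_subset hBL hWL)
    rw [Finset.card_union_of_disjoint hBW, hcB, hcW, lineSegs, Int.card_Ico] at h
    rw [lineSegs]
    omega
  have e1 := tilingCount_placed_mul (Q₁ := fun i => ↑(F i).ups) (Q₂ := fun i => ↑(F i).downs)
    hhu hpk hn.symm hw.symm hlen.le h3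
    (fun i s => by rw [← (F i).ups_cover]; simp) (fun i s => by rw [← (F i).downs_cover]; simp)
    (fun i => rfl) (fun i => (F i).disjoint_upSeg_downSeg) (fun i => (F i).card_upSeg)
    fun i => (F i).card_downSeg
  have e2 := tilingCount_placed_mul hhu hpk hn.symm hw.symm hlen.le h3
    (fun i s => mem_iff_exists_Ico_subset _ s) (fun i s => mem_iff_exists_Ico_subset _ s)
    (fun i => (F i).bowUpSeg_union_bowDownSeg) (fun i => (F i).disjoint_bowUpSeg_bowDownSeg)
    (fun i => (F i).card_bowUpSeg) fun i => (F i).card_bowDownSeg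
  rw [← fernRegion_eq, ← hB, ← hW] at e1
  rw [← bowtieRegion_eq, ← hB, ← hW] at e2
  have hC : ((hyperfac hu : ℚ) * hyperfac l) ≠ 0 :=
    mul_ne_zero (hyperfac_ne_zero _) (hyperfac_ne_zero _)
  have hv : ∀ S, (vdm S : ℚ) ≠ 0 := fun S => Int.cast_ne_zero.2 (vdm_pos S).ne'
  have hP : ∀ S, ∏ x ∈ S, segWeight a b c k l x ≠ 0 := fun S =>
    Finset.prod_ne_zero_iff.2 fun x _ => segWeight_ne_zero _ _ _ _ _ x
  have hL : lineLength a b c k l = (a : ℤ) + k - l + min (b : ℤ) l + min (c : ℤ) l := rfl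
  constructor
  · rintro ⟨hna, hnc⟩
    have hrest : (cross B (extDown a b c k l) : ℚ) * restSum a b c k l n w B W ≠ 0 := by
      refine mul_ne_zero (Int.cast_ne_zero.2 (cross_pos ?_).ne') (Int.cast_ne_zero.2
        (restSum_pos hBW ?_ ?_).ne')
      · exact ((disjoint_extDown_lineSegs a b c k l).mono_right hBL).symm
      · omega
      · omega
    have hF : (tilingCount (fernRegion a b c k l F m) : ℚ) ≠ 0 := fun h0 => by
      rw [h0, zero_mul, zero_mul] at e1
      exact mul_ne_zero (mul_ne_zero (hv _) (hv _)) hrest e1.symm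
    have hB' : (tilingCount (bowtieRegion a b c k l F m) : ℚ) ≠ 0 := fun h0 => by
      rw [h0, zero_mul, zero_mul] at e2
      exact mul_ne_zero (mul_ne_zero (hv _) (hv _)) hrest e2.symm
    refine ⟨Nat.pos_of_ne_zero (Nat.cast_ne_zero.1 hF),
      Nat.pos_of_ne_zero (Nat.cast_ne_zero.1 hB'), ?_⟩
    rw [← prod_segWeight_div, labelsX1, labelsX2, labelsY1, labelsY2, sCount_labels b l F m hup,
      sCount_labels b l F m hdown, sCount_labels b l F m hbup, sCount_labels b l F m hbdown]
    simp only [Code.card_upSeg, Code.card_downSeg, Code.card_bowUpSeg, Code.card_bowDownSeg]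
    have hHp := hyperfac_ne_zero (∑ i, (F i).p)
    have hHn := hyperfac_ne_zero (∑ i, (F i).n)
    have hv1 := hv (placed b l F m fun i => (F i).bowUpSeg)
    have hv2 := hv (placed b l F m fun i => (F i).bowDownSeg)
    have hP1 := hP (placed b l F m fun i => (F i).upSeg)
    have hP2 := hP (placed b l F m fun i => (F i).bowUpSeg)
    rw [mul_assoc, ← eq_div_iff (mul_ne_zero hC hP1)] at e1
    rw [mul_assoc, ← eq_div_iff (mul_ne_zero hC hP2)] at e2
    rw [e1, e2]
    generalize (cross B (extDown a b c k l) : ℚ) * restSum a b c k l n w B W = R at hrest ⊢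
    generalize (hyperfac hu : ℚ) * hyperfac l = H at hC ⊢
    field_simp
  · intro hnot
    have hrest : restSum a b c k l n w B W = 0 := by
      refine restSum_eq_zero ?_
      rw [hfree]
      omega
    rw [hrest, Int.cast_zero, mul_zero, mul_zero, mul_eq_zero, mul_eq_zero] at e1 e2
    exact ⟨Nat.cast_eq_zero.1 ((e1.resolve_right (hP _)).resolve_right hC),
      Nat.cast_eq_zero.1 ((e2.resolve_right (hP _)).resolve_right hC)⟩
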